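/- Let $A$ be a simple, unital, separable, infinite-dimensional C*-algebra which is AH, i.e. isomorphic to the C*-inductive limit of a sequence $A_1\to A_2\to\cdots$ (with *-homomorphisms as connecting maps) in which each $A_i$ is a finite direct sum of algebras $p(C(X)\otimes\mathcal K)p$, where $X$ is a compact connected metrizable space, $\mathcal K$ is the algebra of compact operators on $\ell^2(\mathbb N)$, and $p\in C(X)\otimes\mathcal K$ is a projection. Assume that $A$ has stable rank one (the invertible elements are dense in $A$). Let $M_\infty(A)=\bigcup_n M_n(A)$ (along the embeddings $a\mapsto a\oplus 0$). For $a,b\in M_\infty(A)_+$ write $a\precsim b$ if there are $v_k\in M_\infty(A)$ with $\|v_kbv_k^*-a\|\to0$, and $a\sim b$ if $a\precsim b$ and $b\precsim a$; let $W(A)=M_\infty(A)_+/{\sim}$, with $\langle a\rangle$ denoting the class of $a$. Let $W(A)_+\subseteq W(A)$ be the set of classes of those $a\in M_\infty(A)_+$ that are not Cuntz equivalent to any projection in $M_\infty(A)$. For a normalised 2-quasitrace $\tau$ on $A$ (in particular for a tracial state), extended canonically (unnormalised) to $M_\infty(A)$, put $d_\tau(a)=\lim_{n\to\infty}\tau(a^{1/n})$.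 Assume that $A$ has strict comparison of positive elements: whenever $a,b\in M_\infty(A)_+$ satisfy $d_\tau(a)<d_\tau(b)$ for every normalised 2-quasitrace $\tau$ on $A$, then $a\precsim b$. Let $T(A)$ be the space of tracial states of $A$ with the weak-* topology, and let $\mathrm{LAff}_b(T(A))^{++}$ be the set of bounded, strictly positive, lower semicontinuous, affine functions $T(A)\to\mathbb R$. Then $\iota(\langle a\rangle)(\tau)=d_\tau(a)$ defines a map $\iota\colon W(A)_+\to \mathrm{LAff}_b(T(A))^{++}$, and this map is surjective. -/

import Mathlib

namespace CStarCuntz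

noncomputable section

open scoped ComplexOrder NNReal Topology
open Filter

universe u

/-! ### Matrix algebras -/

/-- The C⋆-algebra `M_n(A)`; it carries the C⋆-norm and the order given by its positive cone. -/
def Mat (n : ℕ) (A : Type u) : Type u := CStarMatrix (Fin n) (Fin n) A

namespace Mat

/-- The matrix with given entries. -/
def of {A : Type u} {n : ℕ} (f : Fin n → Fin n → A) : Mat n A :=
  CStarMatrix.ofMatrix (Matrix.of f)

/-- The entries of a matrix. -/
def entry {A : Type u} {n : ℕ} (a : Mat n A) (i j : Fin n) : A := CStarMatrix.ofMatrix.symm a i j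

theorem ext {A : Type u} {n : ℕ} {a b : Mat n A} (h : ∀ i j, a.entry i j = b.entry i j) : a = b :=
  CStarMatrix.ext h

@[simp] theorem entry_of {A : Type u} {n : ℕ} (f : Fin n → Fin n → A) (i j : Fin n) :
    (of f).entry i j = f i j := rfl

variable {A : Type u} [CStarAlgebra A] [PartialOrder A] [StarOrderedRing A] {n : ℕ}

/-- The C⋆-algebra structure of `M_n(A)`, from Mathlib's `CStarMatrix`. -/
def instCStarAlgebra : CStarAlgebra (Mat n A) :=
  CStarMatrix.instCStarAlgebra (n := Fin n) (A := A)

attribute [instance] instCStarAlgebra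

instance : PartialOrder (Mat n A) := CStarAlgebra.spectralOrder (Mat n A)

instance : StarOrderedRing (Mat n A) := CStarAlgebra.spectralOrderedRing (Mat n A)

@[simp] theorem entry_zero (i j : Fin n) : (0 : Mat n A).entry i j = 0 := rfl
@[simp] theorem entry_add (a b : Mat n A) (i j : Fin n) :
    (a + b).entry i j = a.entry i j + b.entry i j := rfl
@[simp] theorem entry_sub (a b : Mat n A) (i j : Fin n) :
    (a - b).entry i j = a.entry i j - b.entry i j := rfl
@[simp] theorem entry_smul (c : ℂ) (a : Mat n A) (i j : Fin n) :
    (c • a).entry i j = c • a.entry i j := rfl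
@[simp] theorem entry_star (a : Mat n A) (i j : Fin n) :
    (star a).entry i j = star (a.entry j i) := rfl
@[simp] theorem entry_mul (a b : Mat n A) (i j : Fin n) :
    (a * b).entry i j = ∑ k, a.entry i k * b.entry k j := rfl
theorem entry_one (i j : Fin n) : (1 : Mat n A).entry i j = if i = j then 1 else 0 := rfl
theorem norm_entry_le (a : Mat n A) (i j : Fin n) : ‖a.entry i j‖ ≤ ‖a‖ :=
  CStarMatrix.norm_entry_le_norm (M := (a : CStarMatrix (Fin n) (Fin n) A))

end Mat

section Pad

variable {A : Type u} [CStarAlgebra A] [PartialOrder A] [StarOrderedRing A] {n : ℕ}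

/-- The upper left corner map `M_n(A) → M_N(A)`, `a ↦ a ⊕ 0` (used only for `n ≤ N`). -/
def pad (N : ℕ) (a : Mat n A) : Mat N A :=
  Mat.of fun i j => if h : (i : ℕ) < n ∧ (j : ℕ) < n then a.entry ⟨i, h.1⟩ ⟨j, h.2⟩ else 0

theorem sum_fin_dite {A : Type u} [AddCommMonoid A] {n N : ℕ} (h : n ≤ N) (f : Fin n → A) :
    ∑ k : Fin N, (if hk : (k : ℕ) < n then f ⟨k, hk⟩ else 0) = ∑ k : Fin n, f k := by
  obtain ⟨d, rfl⟩ := Nat.exists_eq_add_of_le h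
  rw [Fin.sum_univ_add]
  simp

/-- `pad` as a ⋆-homomorphism. -/
def padHom {n N : ℕ} (h : n ≤ N) : Mat n A →⋆ₙₐ[ℂ] Mat N A where
  toFun := pad N
  map_smul' c a := by
    apply Mat.ext; intro i j
    by_cases hij : (i : ℕ) < n ∧ (j : ℕ) < n <;> simp [pad, hij]
  map_zero' := by
    apply Mat.ext; intro i j
    simp [pad]
  map_add' a b := by
    apply Mat.ext; intro i j
    by_cases hij : (i : ℕ) < n ∧ (j : ℕ) < n <;> simp [pad, hij]
  map_mul' a b := by
    apply Mat.ext; intro i j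
    by_cases hi : (i : ℕ) < n
    · by_cases hj : (j : ℕ) < n
      · simp only [pad, Mat.entry_of, hi, hj, and_self, dite_true, Mat.entry_mul, true_and, and_true]
        rw [← sum_fin_dite h]
        refine Finset.sum_congr rfl fun k _ => ?_
        by_cases hk : (k : ℕ) < n <;> simp [hk]
      · simp [pad, hj]
    · simp [pad, hi]
  map_star' a := by
    apply Mat.ext; intro i j
    by_cases hij : (i : ℕ) < n ∧ (j : ℕ) < n
    · simp [pad, hij]
    · have : ¬ ((j : ℕ) < n ∧ (i : ℕ) < n) := fun h => hij h.symm
      simp [pad, hij, this]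

theorem padHom_apply {n N : ℕ} (h : n ≤ N) (a : Mat n A) : padHom h a = pad N a := rfl

theorem pad_pad {n N N' : ℕ} (h : n ≤ N) (a : Mat n A) : pad N' (pad N a) = pad N' a := by
  apply Mat.ext; intro i j
  by_cases hi : (i : ℕ) < n
  · by_cases hj : (j : ℕ) < n
    · simp [pad, hi, hj, hi.trans_le h, hj.trans_le h]
    · simp [pad, hj]
  · simp [pad, hi]

theorem pad_self (a : Mat n A) : pad n a = a := by
  apply Mat.ext; intro i j
  simp [pad]

theorem padHom_injective {n N : ℕ} (h : n ≤ N) :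
    Function.Injective (padHom h : Mat n A →⋆ₙₐ[ℂ] Mat N A) := by
  intro a b hab
  apply Mat.ext; intro i j
  have := congrArg (fun x : Mat N A => x.entry ⟨i, i.2.trans_le h⟩ ⟨j, j.2.trans_le h⟩) hab
  simpa [padHom_apply, pad] using this

theorem norm_pad {n N : ℕ} (h : n ≤ N) (a : Mat n A) : ‖pad N a‖ = ‖a‖ :=
  NonUnitalStarAlgHom.norm_map (padHom h) (padHom_injective h) a

theorem pad_mul {n N : ℕ} (h : n ≤ N) (a b : Mat n A) : pad N (a * b) = pad N a * pad N b :=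
  map_mul (padHom h) a b

theorem pad_sub {n N : ℕ} (h : n ≤ N) (a b : Mat n A) : pad N (a - b) = pad N a - pad N b :=
  map_sub (padHom h) a b

theorem pad_star {n N : ℕ} (h : n ≤ N) (a : Mat n A) : pad N (star a) = star (pad N a) :=
  map_star (padHom h) a

theorem pad_nnrpow {n N : ℕ} (h : n ≤ N) {a : Mat n A} (ha : 0 ≤ a) {s : ℝ≥0} (hs : s ≠ 0) :
    pad N (a ^ s) = pad N a ^ s := by
  have hc : Continuous (padHom h : Mat n A →⋆ₙₐ[ℂ] Mat N A) := map_continuous _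
  have hpos : 0 ≤ padHom h a := by
    obtain ⟨x, rfl⟩ := CStarAlgebra.nonneg_iff_eq_star_mul_self.1 ha
    rw [map_mul, map_star]; exact star_mul_self_nonneg _
  rw [← padHom_apply h, ← padHom_apply h, CFC.nnrpow_def, CFC.nnrpow_def]
  exact NonUnitalStarAlgHomClass.map_cfcₙ (S := ℂ) (padHom h : Mat n A →⋆ₙₐ[ℂ] Mat N A) _ a
    (by exact (NNReal.continuous_nnrpow_const s).continuousOn) (by simp [hs]) hc ha hpos

/-- The upper left `n × n` block of an `N × N` matrix. -/
def cut {N : ℕ} (n : ℕ) (h : n ≤ N) (a : Mat N A) : Mat n A :=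
  Mat.of fun i j => a.entry (Fin.castLE h i) (Fin.castLE h j)

theorem pad_cut {n N : ℕ} (h : n ≤ N) (a : Mat N A) :
    pad N (cut n h a) = pad N (1 : Mat n A) * a * pad N (1 : Mat n A) := by
  have key : ∀ (x : Mat N A) (i j : Fin N),
      (pad N (1 : Mat n A) * x).entry i j = if (i : ℕ) < n then x.entry i j else 0 := by
    intro x i j
    rw [Mat.entry_mul]
    by_cases hi : (i : ℕ) < n
    · rw [if_pos hi, Finset.sum_eq_single i]
      · simp [pad, hi, Mat.entry_one]
      · intro k _ hk
        have : (i : ℕ) ≠ k := fun h => hk (Fin.ext h.symm)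
        by_cases hkn : (k : ℕ) < n <;> simp [pad, hi, hkn, Mat.entry_one, this]
      · simp
    · rw [if_neg hi]
      exact Finset.sum_eq_zero fun k _ => by simp [pad, hi]
  have key' : ∀ (x : Mat N A) (i j : Fin N),
      (x * pad N (1 : Mat n A)).entry i j = if (j : ℕ) < n then x.entry i j else 0 := by
    intro x i j
    have h1 : star (pad N (1 : Mat n A)) = pad N (1 : Mat n A) := by
      rw [← pad_star h, star_one]
    have := congrArg star (key (star x) j i)
    rw [← Mat.entry_star, star_mul, star_star, h1] at this
    rw [this]; split_ifs <;> simp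
  apply Mat.ext; intro i j
  rw [key', key]
  by_cases hi : (i : ℕ) < n
  · by_cases hj : (j : ℕ) < n
    · simp [pad, hi, hj, cut]
    · simp [pad, hj]
  · simp [pad, hi]

theorem norm_pad_one_le (n N : ℕ) (h : n ≤ N) : ‖pad N (1 : Mat n A)‖ ≤ 1 := by
  rw [norm_pad h]
  rcases subsingleton_or_nontrivial (Mat n A) with h0 | h0
  · rw [Subsingleton.elim (1 : Mat n A) 0, norm_zero]; exact zero_le_one
  · exact CStarRing.norm_one.le

end Pad

/-! ### The limit `lim τ(a^{1/n})` -/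

section DimLim

variable {M : Type u} [CStarAlgebra M] [PartialOrder M] [StarOrderedRing M]

/-- `lim_{n → ∞} φ(a^{1/n})`, for positive `a`; the powers come from the functional calculus. -/
def dimLim (φ : M → ℂ) (a : M) : ℝ :=
  limUnder atTop fun k : ℕ => (φ (a ^ ((k + 1 : ℝ≥0)⁻¹))).re

/-- Bounded positive tracial functionals. -/
structure IsPosTrace (φ : M →L[ℂ] ℂ) : Prop where
  nonneg : ∀ x : M, 0 ≤ φ (star x * x)
  tracial : ∀ x y : M, φ (x * y) = φ (y * x)

theorem IsPosTrace.mono {φ : M →L[ℂ] ℂ} (h : IsPosTrace φ) {a b : M} (hab : a ≤ b) :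
    (φ a).re ≤ (φ b).re := by
  obtain ⟨x, hx⟩ := CStarAlgebra.nonneg_iff_eq_star_mul_self.1 (sub_nonneg.2 hab)
  have h1 := h.nonneg x
  rw [← hx, map_sub] at h1
  have := (Complex.le_def.1 h1).1
  simpa using this

theorem smul_nnrpow (C : ℝ≥0) {a : M} (ha : 0 ≤ a) {s : ℝ≥0} (hs : s ≠ 0) :
    (C • a) ^ s = (C ^ (s : ℝ)) • a ^ s := by
  have hc : Continuous fun x : ℝ≥0 => x.nnrpow s := NNReal.continuous_nnrpow_const s
  rw [CFC.nnrpow_def, CFC.nnrpow_def, ← cfcₙ_smul _ _ _ hc.continuousOn (by simp [hs]),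
    ← cfcₙ_comp_smul _ _ _ hc.continuousOn (by simp [hs]) ha]
  congr 1
  funext x
  simp [NNReal.mul_rpow]

theorem re_map_smul (φ : M →L[ℂ] ℂ) (C : ℝ≥0) (a : M) : (φ (C • a)).re = C * (φ a).re := by
  have : C • a = ((C : ℝ) : ℂ) • a := by
    rw [NNReal.smul_def]
    exact (Complex.coe_smul _ _).symm
  rw [this, map_smul]
  simp

theorem tendsto_inv_succ : Tendsto (fun k : ℕ => (((k + 1 : ℝ≥0)⁻¹ : ℝ≥0) : ℝ)) atTop (𝓝 0) := by
  have := tendsto_one_div_add_atTop_nhds_zero_nat (𝕜 := ℝ)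
  simpa using this

theorem tendsto_rpow_inv_succ {C : ℝ≥0} (hC : C ≠ 0) :
    Tendsto (fun k : ℕ => ((C ^ (((k + 1 : ℝ≥0)⁻¹ : ℝ≥0) : ℝ) : ℝ≥0) : ℝ)) atTop (𝓝 1) := by
  have h1 : Tendsto (fun k : ℕ => (C : ℝ) ^ (((k + 1 : ℝ≥0)⁻¹ : ℝ≥0) : ℝ)) atTop
      (𝓝 ((C : ℝ) ^ (0 : ℝ))) :=
    tendsto_const_nhds.rpow tendsto_inv_succ (Or.inl (by exact_mod_cast hC))
  simpa using h1

theorem exp_ne (k : ℕ) : ((k + 1 : ℝ≥0)⁻¹ : ℝ≥0) ≠ 0 := by positivity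

/-- For contractions the sequence is increasing. -/
theorem IsPosTrace.monotone {φ : M →L[ℂ] ℂ} (h : IsPosTrace φ) {a : M}
    (h1 : ‖a‖ ≤ 1) : Monotone fun k : ℕ => (φ (a ^ ((k + 1 : ℝ≥0)⁻¹))).re := by
  refine monotone_nat_of_le_succ fun k => h.mono ?_
  rw [CFC.nnrpow_eq_rpow (by positivity), CFC.nnrpow_eq_rpow (by positivity), CFC.rpow_def,
    CFC.rpow_def]
  refine cfc_mono (fun x hx => ?_)
    (NNReal.continuous_rpow_const (by positivity)).continuousOn
    (NNReal.continuous_rpow_const (by positivity)).continuousOn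
  have hx1 : x ≤ 1 := by
    have hx' : ((x : ℝ≥0) : ℝ) ∈ spectrum ℝ a := by
      simpa [NNReal.algebraMap_eq_coe] using (spectrum.algebraMap_mem ℝ hx)
    have h2 := spectrum.norm_le_norm_mul_of_mem hx'
    rcases subsingleton_or_nontrivial M with h0 | h0
    · exact absurd hx (by simp [spectrum.of_subsingleton])
    · rw [CStarRing.norm_one, mul_one] at h2
      have : ((x : ℝ≥0) : ℝ) ≤ 1 := (le_abs_self _).trans (h2.trans h1)
      exact_mod_cast this
  rcases eq_or_ne x 0 with rfl | hx0
  · rw [NNReal.zero_rpow (by positivity), NNReal.zero_rpow (by positivity)]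
  · refine NNReal.rpow_le_rpow_of_exponent_ge (pos_iff_ne_zero.2 hx0) hx1 ?_
    push_cast
    gcongr
    linarith

theorem IsPosTrace.bddAbove {φ : M →L[ℂ] ℂ} (h : IsPosTrace φ) {a : M} (ha : 0 ≤ a)
    (h1 : ‖a‖ ≤ 1) : BddAbove (Set.range fun k : ℕ => (φ (a ^ ((k + 1 : ℝ≥0)⁻¹))).re) := by
  refine ⟨(φ 1).re, ?_⟩
  rintro _ ⟨k, rfl⟩
  refine h.mono ?_
  rw [← CStarAlgebra.norm_le_one_iff_of_nonneg _ CFC.nnrpow_nonneg,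
    CFC.norm_nnrpow a (by positivity) ha]
  exact Real.rpow_le_one (norm_nonneg _) h1 (by positivity)

/-- The limit defining `dimLim` exists. -/
theorem IsPosTrace.tendsto {φ : M →L[ℂ] ℂ} (h : IsPosTrace φ) {a : M} (ha : 0 ≤ a) :
    Tendsto (fun k : ℕ => (φ (a ^ ((k + 1 : ℝ≥0)⁻¹))).re) atTop (𝓝 (dimLim φ a)) := by
  suffices ∃ L, Tendsto (fun k : ℕ => (φ (a ^ ((k + 1 : ℝ≥0)⁻¹))).re) atTop (𝓝 L) from
    tendsto_nhds_limUnder this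
  set C : ℝ≥0 := ‖a‖₊ + 1 with hC
  have hC0 : C ≠ 0 := by positivity
  have hb : 0 ≤ C⁻¹ • a := smul_nonneg (by positivity) ha
  have hb1 : ‖C⁻¹ • a‖ ≤ 1 := by
    rw [NNReal.smul_def, norm_smul, hC]
    simp only [NNReal.coe_inv, NNReal.coe_add, coe_nnnorm, NNReal.coe_one, norm_inv, Real.norm_eq_abs]
    rw [abs_of_nonneg (by positivity), inv_mul_le_one₀ (by positivity)]
    linarith
  have hab : a = C • (C⁻¹ • a) := by rw [smul_smul, mul_inv_cancel₀ hC0, one_smul]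
  refine ⟨1 * _, ((tendsto_rpow_inv_succ hC0).mul
    (tendsto_atTop_ciSup (h.monotone hb1) (h.bddAbove hb hb1))).congr fun k => ?_⟩
  rw [← re_map_smul, ← smul_nnrpow C hb (exp_ne k), ← hab]

theorem IsPosTrace.dimLim_smul {φ : M →L[ℂ] ℂ} (h : IsPosTrace φ) {a : M} (ha : 0 ≤ a)
    {C : ℝ≥0} (hC : C ≠ 0) : dimLim φ (C • a) = dimLim φ a := by
  have h1 := (tendsto_rpow_inv_succ hC).mul (h.tendsto ha)
  rw [one_mul] at h1
  refine tendsto_nhds_unique (h.tendsto (smul_nonneg (by positivity) ha)) (h1.congr fun k => ?_)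
  rw [← re_map_smul, ← smul_nnrpow C ha (exp_ne k)]

/-- The terms of the sequence are controlled by the limit. -/
theorem IsPosTrace.le_dimLim {φ : M →L[ℂ] ℂ} (h : IsPosTrace φ) {a : M} (ha : 0 ≤ a)
    {C : ℝ≥0} (hC : C ≠ 0) (haC : ‖a‖ ≤ C) (k : ℕ) :
    (φ (a ^ ((k + 1 : ℝ≥0)⁻¹))).re ≤ (C ^ (((k + 1 : ℝ≥0)⁻¹ : ℝ≥0) : ℝ) : ℝ≥0) * dimLim φ a := by
  have hb : 0 ≤ C⁻¹ • a := smul_nonneg (by positivity) ha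
  have hb1 : ‖C⁻¹ • a‖ ≤ 1 := by
    rw [NNReal.smul_def, norm_smul, NNReal.coe_inv, norm_inv, Real.norm_of_nonneg C.coe_nonneg,
      inv_mul_le_one₀ (by positivity)]
    exact haC
  have hab : a = C • (C⁻¹ • a) := by rw [smul_smul, mul_inv_cancel₀ hC, one_smul]
  have h1 := (h.monotone hb1).ge_of_tendsto (h.tendsto hb) k
  rw [h.dimLim_smul ha (inv_ne_zero hC)] at h1
  conv_lhs => rw [hab]
  rw [smul_nnrpow C hb (exp_ne k), re_map_smul]
  gcongr

theorem IsPosTrace.dimLim_mono {φ : M →L[ℂ] ℂ} (h : IsPosTrace φ) {a b : M} (ha : 0 ≤ a)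
    (hab : a ≤ b) : dimLim φ a ≤ dimLim φ b :=
  le_of_tendsto_of_tendsto' (h.tendsto ha) (h.tendsto (ha.trans hab)) fun k =>
    h.mono (CFC.nnrpow_le_nnrpow ⟨zero_le, inv_le_one_of_one_le₀ (by simp)⟩ hab)

open scoped ContinuousMapZero in
/-- `φ(f(c⋆c)) = φ(f(cc⋆))` for powers `f`. -/
theorem IsPosTrace.nnrpow_comm {φ : M →L[ℂ] ℂ} (h : IsPosTrace φ) (c : M) {s : ℝ≥0} (hs : s ≠ 0) :
    φ ((star c * c) ^ s) = φ ((c * star c) ^ s) := by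
  have ha : IsSelfAdjoint (star c * c) := .star_mul_self c
  have hb : IsSelfAdjoint (c * star c) := .mul_star_self c
  set S : Set ℝ := quasispectrum ℝ (star c * c) ∪ quasispectrum ℝ (c * star c) with hS
  have hsa : quasispectrum ℝ (star c * c) ⊆ S := Set.subset_union_left
  have hsb : quasispectrum ℝ (c * star c) ⊆ S := Set.subset_union_right
  have : Fact ((0 : ℝ) ∈ S) := ⟨hsa (quasispectrum.zero_mem ℝ _)⟩
  have : CompactSpace S := isCompact_iff_compactSpace.1
    ((NonUnitalContinuousFunctionalCalculus.isCompact_quasispectrum _).union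
      (NonUnitalContinuousFunctionalCalculus.isCompact_quasispectrum _))
  set Φa : C(S, ℝ)₀ →⋆ₙₐ[ℝ] M := cfcₙHomSuperset ha hsa with hΦa
  set Φb : C(S, ℝ)₀ →⋆ₙₐ[ℝ] M := cfcₙHomSuperset hb hsb with hΦb
  have hca : Continuous Φa := cfcₙHomSuperset_continuous ha hsa
  have hcb : Continuous Φb := cfcₙHomSuperset_continuous hb hsb
  have alg : ∀ f ∈ NonUnitalStarAlgebra.adjoin ℝ {(.id S : C(S, ℝ)₀)},
      ∃ x : M, Φa f = star c * x * c ∧ Φb f = x * (c * star c) ∧ Φb f = c * star c * x := by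
    intro f hf
    induction hf using NonUnitalStarAlgebra.adjoin_induction with
    | mem f hf =>
      rw [Set.mem_singleton_iff] at hf
      subst hf
      refine ⟨1, ?_, ?_, ?_⟩
      · rw [hΦa, cfcₙHomSuperset_id, mul_one]
      · rw [hΦb, cfcₙHomSuperset_id, one_mul]
      · rw [hΦb, cfcₙHomSuperset_id, mul_one]
    | zero => exact ⟨0, by simp, by simp, by simp⟩
    | add f g _ _ hf hg =>
      obtain ⟨x, h1, h2, h3⟩ := hf
      obtain ⟨y, k1, k2, k3⟩ := hg
      refine ⟨x + y, ?_, ?_, ?_⟩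
      · rw [map_add, h1, k1, mul_add, add_mul]
      · rw [map_add, h2, k2, add_mul]
      · rw [map_add, h3, k3, mul_add]
    | mul f g _ _ hf hg =>
      obtain ⟨x, h1, h2, h3⟩ := hf
      obtain ⟨y, k1, k2, k3⟩ := hg
      refine ⟨x * (c * star c) * y, ?_, ?_, ?_⟩
      · rw [map_mul, h1, k1]; simp only [mul_assoc]
      · rw [map_mul, h2, k2]; simp only [mul_assoc]
      · rw [map_mul, h3, k3]; simp only [mul_assoc]
    | smul r f _ hf =>
      obtain ⟨x, h1, h2, h3⟩ := hf
      refine ⟨r • x, ?_, ?_, ?_⟩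
      · rw [map_smul, h1, mul_smul_comm, smul_mul_assoc]
      · rw [map_smul, h2, smul_mul_assoc]
      · rw [map_smul, h3, mul_smul_comm]
    | star f _ hf =>
      obtain ⟨x, h1, h2, h3⟩ := hf
      refine ⟨star x, ?_, ?_, ?_⟩
      · rw [map_star, h1]; simp [mul_assoc]
      · rw [map_star, h3]; simp
      · rw [map_star, h2]; simp
  have key : ∀ f : C(S, ℝ)₀, φ (Φa f) = φ (Φb f) := by
    have hcl : IsClosed {f : C(S, ℝ)₀ | φ (Φa f) = φ (Φb f)} :=
      isClosed_eq (φ.continuous.comp hca) (φ.continuous.comp hcb)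
    intro f
    refine (hcl.closure_subset_iff.2 ?_) ((ContinuousMapZero.adjoin_id_dense (𝕜 := ℝ) S) f)
    intro f hf
    obtain ⟨x, h1, h2, -⟩ := alg f hf
    change φ (Φa f) = φ (Φb f)
    rw [h1, h2, mul_assoc, h.tracial, mul_assoc]
  have hcont : Continuous fun t : ℝ => ((t.toNNReal.nnrpow s : ℝ≥0) : ℝ) :=
    NNReal.continuous_coe.comp ((NNReal.continuous_nnrpow_const s).comp continuous_real_toNNReal)
  have h0 : (((0 : ℝ).toNNReal.nnrpow s : ℝ≥0) : ℝ) = 0 := by simp [hs]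
  have := key ⟨⟨fun t : S => (((t : ℝ).toNNReal.nnrpow s : ℝ≥0) : ℝ),
    hcont.comp continuous_subtype_val⟩, h0⟩
  rw [CFC.nnrpow_def, CFC.nnrpow_def, cfcₙ_nnreal_eq_real _ _ (star_mul_self_nonneg c),
    cfcₙ_nnreal_eq_real _ _ (mul_star_self_nonneg c),
    cfcₙ_apply _ _ hcont.continuousOn h0 ha, cfcₙ_apply _ _ hcont.continuousOn h0 hb]
  exact this

/-- Cuntz comparison inside one algebra implies comparison of the limits. -/
theorem IsPosTrace.dimLim_le {φ : M →L[ℂ] ℂ} (h : IsPosTrace φ) {a b : M} (ha : 0 ≤ a)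
    (hb : 0 ≤ b) (hab : ∀ ε : ℝ, 0 < ε → ∃ v : M, ‖v * b * star v - a‖ < ε) :
    dimLim φ a ≤ dimLim φ b := by
  have hconj : ∀ v : M, 0 ≤ v * b * star v := fun v => star_right_conjugate_nonneg hb v
  have step : ∀ v : M, dimLim φ (v * b * star v) ≤ dimLim φ b := by
    intro v
    set r := CFC.sqrt b with hr
    have hrr : r * r = b := CFC.sqrt_mul_sqrt_self b hb
    have hrs : star r = r := (CFC.sqrt_nonneg b).isSelfAdjoint.star_eq
    set c := v * r with hc
    have hcc : c * star c = v * b * star v := by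
      rw [hc, star_mul, hrs, ← hrr]; simp only [mul_assoc]
    have hcs : star c * c ≤ (‖v‖₊ ^ 2 + 1) • b := by
      have h1 : star c * c = star r * (star v * v) * r := by
        rw [hc, star_mul]; simp only [mul_assoc]
      have h2 : star r * (star v * v) * r ≤ ‖star v * v‖ • (star r * r) :=
        CStarAlgebra.star_left_conjugate_le_norm_smul
      rw [h1]
      refine h2.trans ?_
      rw [hrs, hrr, CStarRing.norm_star_mul_self, NNReal.smul_def]
      refine smul_le_smul_of_nonneg_right ?_ hb
      push_cast
      nlinarith
    have heq : dimLim φ (v * b * star v) = dimLim φ (star c * c) := by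
      rw [← hcc]
      refine tendsto_nhds_unique (h.tendsto (mul_star_self_nonneg c))
        ((h.tendsto (star_mul_self_nonneg c)).congr fun k => ?_)
      rw [h.nnrpow_comm c (exp_ne k)]
    rw [heq]
    refine (h.dimLim_mono (star_mul_self_nonneg c) hcs).trans_eq ?_
    exact h.dimLim_smul hb (by positivity)
  choose v hv using fun j : ℕ => hab (1 / ((j : ℝ) + 1)) (by positivity)
  have hlim : Tendsto (fun j => v j * b * star (v j)) atTop (𝓝 a) := by
    rw [tendsto_iff_norm_sub_tendsto_zero]
    exact squeeze_zero (fun _ => norm_nonneg _) (fun j => (hv j).le)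
      tendsto_one_div_add_atTop_nhds_zero_nat
  set C : ℝ≥0 := ‖a‖₊ + 1 with hC
  have hC0 : C ≠ 0 := by positivity
  have hbound : ∀ j, ‖v j * b * star (v j)‖ ≤ C := by
    intro j
    have h1 : ‖v j * b * star (v j)‖ ≤ ‖v j * b * star (v j) - a‖ + ‖a‖ := by
      simpa using norm_add_le (v j * b * star (v j) - a) a
    have h2 : (1 : ℝ) / ((j : ℝ) + 1) ≤ 1 := by
      rw [div_le_one (by positivity)]; linarith [(Nat.cast_nonneg j : (0 : ℝ) ≤ j)]
    rw [hC]; push_cast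
    linarith [(hv j).le]
  have main : ∀ k : ℕ, (φ (a ^ ((k + 1 : ℝ≥0)⁻¹))).re ≤
      (C ^ (((k + 1 : ℝ≥0)⁻¹ : ℝ≥0) : ℝ) : ℝ≥0) * dimLim φ b := by
    intro k
    have hcont : Tendsto (fun j => (φ ((v j * b * star (v j)) ^ ((k + 1 : ℝ≥0)⁻¹))).re) atTop
        (𝓝 (φ (a ^ ((k + 1 : ℝ≥0)⁻¹))).re) := by
      have h1 := (CFC.continuousOn_nnrpow (A := M) ((k + 1 : ℝ≥0)⁻¹)) a ha
      have h2 : Tendsto (fun j => v j * b * star (v j)) atTop (𝓝[{x : M | 0 ≤ x}] a) :=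
        tendsto_nhdsWithin_iff.2 ⟨hlim, .of_forall fun j => hconj (v j)⟩
      exact (Complex.continuous_re.comp φ.continuous).continuousAt.tendsto.comp (h1.tendsto.comp h2)
    refine le_of_tendsto' hcont fun j => (h.le_dimLim (hconj (v j)) hC0 (hbound j) k).trans ?_
    gcongr
    exact step (v j)
  have h1 := (tendsto_rpow_inv_succ hC0).mul_const (dimLim φ b)
  rw [one_mul] at h1
  exact le_of_tendsto_of_tendsto' (h.tendsto ha) h1 main

end DimLim

/-! ### The Cuntz semigroup -/

section Cuntz

/-- A positive element of `M_∞(A) = ⋃ M_n(A)` (union along the corner maps `a ↦ a ⊕ 0`),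
represented at a finite stage. -/
structure MInftyPos (A : Type u) [CStarAlgebra A] [PartialOrder A] [StarOrderedRing A] where
  size : ℕ
  mat : Mat size A
  nonneg : 0 ≤ mat

variable {A : Type u} [CStarAlgebra A] [PartialOrder A] [StarOrderedRing A]

/-- Cuntz subequivalence `a ≾ b` in `M_∞(A)`: there are `v_k ∈ M_∞(A)` with
`‖v_k b v_k⋆ - a‖ → 0`. -/
def CuntzLE (a b : MInftyPos A) : Prop :=
  ∀ ε : ℝ, 0 < ε → ∃ N : ℕ, a.size ≤ N ∧ b.size ≤ N ∧
    ∃ v : Mat N A, ‖v * pad N b.mat * star v - pad N a.mat‖ < ε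

/-- The witnesses may be taken in any common matrix size. -/
theorem CuntzLE.exists_of_le {a b : MInftyPos A} (h : CuntzLE a b) {N : ℕ} (ha : a.size ≤ N)
    (hb : b.size ≤ N) {ε : ℝ} (hε : 0 < ε) :
    ∃ v : Mat N A, ‖v * pad N b.mat * star v - pad N a.mat‖ < ε := by
  obtain ⟨N', ha', hb', v, hv⟩ := h ε hε
  -- first enlarge the size of `v`
  obtain ⟨L, hNL, hNL'⟩ : ∃ L, N ≤ L ∧ N' ≤ L := ⟨max N N', le_max_left _ _, le_max_right _ _⟩
  set w : Mat L A := pad L v with hw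
  have hwv : ‖w * pad L b.mat * star w - pad L a.mat‖ < ε := by
    rw [← norm_pad hNL', pad_sub hNL', pad_mul hNL', pad_mul hNL', pad_star hNL', pad_pad hb',
      pad_pad ha'] at hv
    exact hv
  -- then cut down by the projection `e = 1_N`
  set e : Mat L A := pad L (1 : Mat N A) with he
  have hes : star e = e := by rw [he, ← pad_star hNL, star_one]
  have hemul : ∀ x : Mat N A, e * pad L x = pad L x := fun x => by
    rw [he, ← pad_mul hNL, one_mul]
  have hmule : ∀ x : Mat N A, pad L x * e = pad L x := fun x => by
    rw [he, ← pad_mul hNL, mul_one]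
  refine ⟨cut N hNL w, ?_⟩
  rw [← norm_pad hNL, pad_sub hNL, pad_mul hNL, pad_mul hNL, pad_star hNL, pad_cut hNL]
  have key : e * w * e * pad L (pad N b.mat) * star (e * w * e) - pad L (pad N a.mat)
      = e * (w * pad L b.mat * star w - pad L a.mat) * e := by
    have hb1 : e * pad L b.mat = pad L b.mat := by rw [← pad_pad hb (N' := L), hemul]
    have hb2 : pad L b.mat * e = pad L b.mat := by rw [← pad_pad hb (N' := L), hmule]
    have ha1 : e * pad L a.mat = pad L a.mat := by rw [← pad_pad ha (N' := L), hemul]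
    have ha2 : pad L a.mat * e = pad L a.mat := by rw [← pad_pad ha (N' := L), hmule]
    rw [pad_pad hb, pad_pad ha, mul_sub, sub_mul, ha1, ha2]
    congr 1
    calc e * w * e * pad L b.mat * star (e * w * e)
        = e * w * (e * pad L b.mat * e) * (star w * e) := by
          simp only [star_mul, hes, mul_assoc]
      _ = e * (w * pad L b.mat * star w) * e := by
          rw [hb1, hb2]; simp only [mul_assoc]
  rw [← he, key]
  have h1 : ‖e‖ ≤ 1 := norm_pad_one_le N L hNL
  calc ‖e * (w * pad L b.mat * star w - pad L a.mat) * e‖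
      ≤ ‖e‖ * ‖w * pad L b.mat * star w - pad L a.mat‖ * ‖e‖ :=
        (norm_mul_le _ _).trans (mul_le_mul_of_nonneg_right (norm_mul_le _ _) (norm_nonneg _))
    _ ≤ 1 * ‖w * pad L b.mat * star w - pad L a.mat‖ * 1 := by gcongr
    _ < ε := by rw [one_mul, mul_one]; exact hwv

theorem CuntzLE.refl (a : MInftyPos A) : CuntzLE a a := fun ε hε =>
  ⟨a.size, le_rfl, le_rfl, 1, by simpa using hε⟩

theorem CuntzLE.trans {a b c : MInftyPos A} (hab : CuntzLE a b) (hbc : CuntzLE b c) :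
    CuntzLE a c := by
  intro ε hε
  obtain ⟨N, ha, hb, hc⟩ : ∃ N, a.size ≤ N ∧ b.size ≤ N ∧ c.size ≤ N :=
    ⟨max a.size (max b.size c.size), by simp, by simp, by simp⟩
  refine ⟨N, ha, hc, ?_⟩
  obtain ⟨v, hv⟩ := hab.exists_of_le ha hb (half_pos hε)
  obtain ⟨w, hw⟩ := hbc.exists_of_le hb hc
    (show 0 < ε / 2 / (‖v‖ * ‖v‖ + 1) by positivity)
  refine ⟨v * w, ?_⟩
  have e1 : v * w * pad N c.mat * star (v * w) - pad N a.mat =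
      v * (w * pad N c.mat * star w - pad N b.mat) * star v +
        (v * pad N b.mat * star v - pad N a.mat) := by
    rw [star_mul, mul_sub, sub_mul]
    simp only [mul_assoc]
    abel
  rw [e1]
  have h2 : ‖v * (w * pad N c.mat * star w - pad N b.mat) * star v‖ ≤ ε / 2 := by
    calc ‖v * (w * pad N c.mat * star w - pad N b.mat) * star v‖
        ≤ ‖v‖ * ‖w * pad N c.mat * star w - pad N b.mat‖ * ‖v‖ := by
          refine (norm_mul_le _ _).trans ?_
          rw [norm_star]
          exact mul_le_mul_of_nonneg_right (norm_mul_le _ _) (norm_nonneg _)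
      _ = (‖v‖ * ‖v‖) * ‖w * pad N c.mat * star w - pad N b.mat‖ := by ring
      _ ≤ (‖v‖ * ‖v‖ + 1) * (ε / 2 / (‖v‖ * ‖v‖ + 1)) := by
          gcongr
          linarith
      _ = ε / 2 := by field_simp
  calc _ ≤ _ := norm_add_le _ _
    _ < ε := by linarith

/-- Cuntz equivalence `a ∼ b`. -/
def CuntzEquiv (a b : MInftyPos A) : Prop := CuntzLE a b ∧ CuntzLE b a

variable (A) in
/-- Cuntz equivalence as an equivalence relation. -/
def cuntzSetoid : Setoid (MInftyPos A) where
  r := CuntzEquiv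
  iseqv := ⟨fun a => ⟨.refl a, .refl a⟩, fun h => ⟨h.2, h.1⟩,
    fun h k => ⟨h.1.trans k.1, k.2.trans h.2⟩⟩

variable (A) in
/-- The Cuntz semigroup `W(A) = M_∞(A)₊ / ∼` (as a set). -/
def W : Type u := Quotient (cuntzSetoid A)

/-- The class `⟨a⟩ ∈ W(A)`. -/
def W.mk (a : MInftyPos A) : W A := Quotient.mk (cuntzSetoid A) a

/-- `a` is purely positive: it is not Cuntz equivalent to a projection of `M_∞(A)`. -/
def IsPurelyPositive (a : MInftyPos A) : Prop :=
  ∀ p : MInftyPos A, IsStarProjection p.mat → ¬ CuntzEquiv a p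

variable (A) in
/-- `W(A)₊`, the classes of purely positive elements. -/
def WPos : Set (W A) := {x | ∃ a : MInftyPos A, IsPurelyPositive a ∧ W.mk a = x}

end Cuntz

/-! ### Tracial states and the rank map -/

section Rank

/-- The tracial state space `T(A)`, with the weak-⋆ topology. -/
def tracialStates (A : Type u) [CStarAlgebra A] : Set (WeakDual ℂ A) :=
  {τ | (∀ a : A, 0 ≤ τ (star a * a)) ∧ τ 1 = 1 ∧ ∀ a b : A, τ (a * b) = τ (b * a)}

/-- `LAff_b(T(A))⁺⁺`: bounded, strictly positive, lower semicontinuous, affine functions on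
`T(A)`. -/
def LAffPos (A : Type u) [CStarAlgebra A] : Set (tracialStates A → ℝ) :=
  {f | (∃ C : ℝ, ∀ τ, |f τ| ≤ C) ∧ (∀ τ, 0 < f τ) ∧ LowerSemicontinuous f ∧
    ∀ (τ₁ τ₂ τ : tracialStates A) (s t : ℝ), 0 ≤ s → 0 ≤ t → s + t = 1 →
      (τ : WeakDual ℂ A) = (s : ℂ) • (τ₁ : WeakDual ℂ A) + (t : ℂ) • (τ₂ : WeakDual ℂ A) →
      f τ = s * f τ₁ + t * f τ₂}

variable {A : Type u} [CStarAlgebra A] [PartialOrder A] [StarOrderedRing A]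

/-- The entry map as a bounded linear map. -/
def entryL (n : ℕ) (i j : Fin n) : Mat n A →L[ℂ] A :=
  LinearMap.mkContinuous
    { toFun := fun a => a.entry i j
      map_add' := fun _ _ => rfl
      map_smul' := fun _ _ => rfl } 1 fun a => by
    rw [one_mul]; exact Mat.norm_entry_le a i j

/-- The canonical (unnormalised) extension `τ ⊗ Tr` of a functional to `M_n(A)`,
`(a_{ij}) ↦ ∑ i, τ(a_{ii})`. -/
def traceExt (τ : WeakDual ℂ A) (n : ℕ) : Mat n A →L[ℂ] ℂ :=
  ∑ i : Fin n, (WeakDual.toStrongDual τ).comp (entryL n i i)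

theorem traceExt_apply (τ : WeakDual ℂ A) (n : ℕ) (a : Mat n A) :
    traceExt τ n a = ∑ i, τ (a.entry i i) := by
  simp [traceExt, entryL]
  rfl

theorem traceExt_pad (τ : WeakDual ℂ A) {n N : ℕ} (h : n ≤ N) (a : Mat n A) :
    traceExt τ N (pad N a) = traceExt τ n a := by
  rw [traceExt_apply, traceExt_apply, ← sum_fin_dite h]
  refine Finset.sum_congr rfl fun i _ => ?_
  by_cases hi : (i : ℕ) < n <;> simp [pad, hi]

theorem isPosTrace_traceExt {τ : WeakDual ℂ A} (hτ : τ ∈ tracialStates A) (n : ℕ) :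
    IsPosTrace (traceExt τ n) := by
  obtain ⟨h1, -, h3⟩ := hτ
  constructor
  · intro x
    rw [traceExt_apply]
    refine Finset.sum_nonneg fun i _ => ?_
    rw [Mat.entry_mul, map_sum]
    exact Finset.sum_nonneg fun k _ => by rw [Mat.entry_star]; exact h1 _
  · intro x y
    simp only [traceExt_apply, Mat.entry_mul, map_sum]
    rw [Finset.sum_comm]
    exact Finset.sum_congr rfl fun i _ => Finset.sum_congr rfl fun j _ => h3 _ _

/-- `d_τ(a) = lim τ(a^{1/n})` for a tracial state `τ` and `a ∈ M_∞(A)₊`. -/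
def dTrace (τ : tracialStates A) (a : MInftyPos A) : ℝ :=
  dimLim (traceExt (τ : WeakDual ℂ A) a.size) a.mat

theorem pad_nonneg {n N : ℕ} (h : n ≤ N) {a : Mat n A} (ha : 0 ≤ a) : 0 ≤ pad N a := by
  obtain ⟨x, rfl⟩ := CStarAlgebra.nonneg_iff_eq_star_mul_self.1 ha
  rw [pad_mul h, pad_star h]
  exact star_mul_self_nonneg _

theorem dTrace_eq_pad (τ : tracialStates A) (a : MInftyPos A) {N : ℕ} (h : a.size ≤ N) :
    dTrace τ a = dimLim (traceExt (τ : WeakDual ℂ A) N) (pad N a.mat) := by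
  refine tendsto_nhds_unique ((isPosTrace_traceExt τ.2 _).tendsto a.nonneg)
    (((isPosTrace_traceExt τ.2 N).tendsto (pad_nonneg h a.nonneg)).congr fun k => ?_)
  rw [← pad_nnrpow h a.nonneg (exp_ne k), traceExt_pad _ h]

theorem dTrace_le (τ : tracialStates A) {a b : MInftyPos A} (h : CuntzLE a b) :
    dTrace τ a ≤ dTrace τ b := by
  have ha : a.size ≤ max a.size b.size := le_max_left _ _
  have hb : b.size ≤ max a.size b.size := le_max_right _ _
  rw [dTrace_eq_pad τ a ha, dTrace_eq_pad τ b hb]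
  exact (isPosTrace_traceExt τ.2 _).dimLim_le (pad_nonneg ha a.nonneg) (pad_nonneg hb b.nonneg)
    fun ε hε => h.exists_of_le ha hb hε

variable (A) in
/-- The rank map `ι(⟨a⟩)(τ) = d_τ(a)`. -/
def rankMap : W A → tracialStates A → ℝ :=
  Quotient.lift (s := cuntzSetoid A) (fun a τ => dTrace τ a) fun _ _ h =>
    funext fun τ => le_antisymm (dTrace_le τ h.1) (dTrace_le τ h.2)

end Rank

/-! ### Quasitraces and strict comparison -/

section Quasitrace

/-- A (1-)quasitrace on a C⋆-algebra. -/
structure IsQuasitrace {M : Type u} [CStarAlgebra M] (τ : M → ℂ) : Prop where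
  nonneg : ∀ x, 0 ≤ τ (star x * x)
  tracial : ∀ x, τ (star x * x) = τ (x * star x)
  add_I_smul : ∀ a b, IsSelfAdjoint a → IsSelfAdjoint b →
    τ (a + Complex.I • b) = τ a + Complex.I * τ b
  linear : ∀ B : NonUnitalStarSubalgebra ℂ M, IsClosed (B : Set M) →
    (∀ x ∈ B, ∀ y ∈ B, x * y = y * x) →
    ∀ x ∈ B, ∀ y ∈ B, ∀ c : ℂ, τ (x + y) = τ x + τ y ∧ τ (c • x) = c * τ x

/-- A normalised 2-quasitrace on `A`, presented together with its (unique) extension to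
`M_∞(A)`: a quasitrace on each `M_n(A)`, compatible with the corner maps. -/
structure QT (A : Type u) [CStarAlgebra A] [PartialOrder A] [StarOrderedRing A] where
  toFun : ∀ n : ℕ, Mat n A → ℂ
  isQuasitrace : ∀ n, IsQuasitrace (toFun n)
  compat : ∀ (n : ℕ) (a : Mat n A), toFun (n + 1) (pad (n + 1) a) = toFun n a
  normalized : toFun 1 1 = 1

variable (A : Type u) [CStarAlgebra A] [PartialOrder A] [StarOrderedRing A]

/-- The lower semicontinuous dimension functions `d_τ`, `τ ∈ QT(A)`, on `M_∞(A)₊`. -/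
def LDF : Set (MInftyPos A → ℝ) :=
  Set.range fun (τ : QT A) (a : MInftyPos A) => dimLim (τ.toFun a.size) a.mat

/-- Strict comparison of positive elements. -/
def StrictComparison : Prop :=
  ∀ a b : MInftyPos A, (∀ s ∈ LDF A, s a < s b) → CuntzLE a b

end Quasitrace

/-! ### Simplicity and stable rank one -/

/-- No closed two-sided ideals except `0` and `A`, and `A ≠ 0`. -/
def IsSimpleCStar (A : Type u) [CStarAlgebra A] : Prop :=
  Nontrivial A ∧ ∀ I : TwoSidedIdeal A, IsClosed (I : Set A) → I = ⊥ ∨ I = ⊤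

/-- Stable rank one (for a unital algebra): the invertible elements are dense. -/
def StableRankOne (A : Type u) [CStarAlgebra A] : Prop := Dense {a : A | IsUnit a}

/-! ### AH algebras -/

section AH

/-- The Hilbert space `ℓ²(ℕ)`. -/
abbrev Hilb : Type := lp (fun _ : ℕ => ℂ) 2

/-- The corner `pBp` of a C⋆-algebra. -/
def corner {B : Type} [CStarAlgebra B] (p : B) (hp : IsStarProjection p) :
    NonUnitalStarSubalgebra ℂ B where
  carrier := {f | p * f = f ∧ f * p = f}
  add_mem' hf hg := ⟨by rw [mul_add, hf.1, hg.1], by rw [add_mul, hf.2, hg.2]⟩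
  zero_mem' := ⟨mul_zero _, zero_mul _⟩
  mul_mem' hf hg := ⟨by rw [← mul_assoc, hf.1], by rw [mul_assoc, hg.2]⟩
  smul_mem' c f hf := ⟨by rw [mul_smul_comm, hf.1], by rw [smul_mul_assoc, hf.2]⟩
  star_mem' {f} hf :=
    ⟨by have := congrArg star hf.2; rwa [star_mul, hp.isSelfAdjoint.star_eq] at this,
     by have := congrArg star hf.1; rwa [star_mul, hp.isSelfAdjoint.star_eq] at this⟩

theorem isClosed_corner {B : Type} [CStarAlgebra B] (p : B) (hp : IsStarProjection p) :
    IsClosed (corner p hp : Set B) :=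
  (isClosed_eq (continuous_const.mul continuous_id) continuous_id).inter
    (isClosed_eq (continuous_id.mul continuous_const) continuous_id)

/-- The data of a homogeneous C⋆-algebra `p(C(X) ⊗ 𝓚)p`: a compact connected metrizable space `X`
and a projection `p ∈ C(X) ⊗ 𝓚 = C(X, 𝓚)`, `𝓚` the compact operators on `ℓ²(ℕ)`. -/
structure HomogeneousData where
  X : Type
  [top : TopologicalSpace X]
  [compact : CompactSpace X]
  [connected : ConnectedSpace X]
  [metrizable : TopologicalSpace.MetrizableSpace X]
  p : C(X, Hilb →L[ℂ] Hilb)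
  isStarProjection : IsStarProjection p
  isCompactOperator : ∀ x, IsCompactOperator (p x)

attribute [instance] HomogeneousData.top HomogeneousData.compact

/-- The C⋆-algebra `p(C(X) ⊗ 𝓚)p`. Since `p` takes values in `𝓚`, it is the corner
`p C(X, B(ℓ²)) p`. -/
def HomogeneousData.Alg (D : HomogeneousData) : Type := corner D.p D.isStarProjection

/-- The C⋆-algebra structure of the corner. -/
def HomogeneousData.instAlg (D : HomogeneousData) : NonUnitalCStarAlgebra D.Alg :=
  NonUnitalStarSubalgebra.nonUnitalCStarAlgebra (corner D.p D.isStarProjection)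
    (h_closed := isClosed_corner D.p D.isStarProjection)

attribute [instance] HomogeneousData.instAlg

/-- The data of a finite direct sum of homogeneous C⋆-algebras. -/
structure SemiHomogeneousData where
  r : ℕ
  block : Fin r → HomogeneousData

/-- The C⋆-algebra `⨁ j, p_j(C(X_j) ⊗ 𝓚)p_j` (with the maximum norm). -/
abbrev SemiHomogeneousData.Alg (S : SemiHomogeneousData) : Type :=
  ∀ j : Fin S.r, (S.block j).Alg

/-- A sequence `A_0 → A_1 → ⋯` of finite direct sums of homogeneous C⋆-algebras and
⋆-homomorphisms. -/
structure AHSystem where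
  S : ℕ → SemiHomogeneousData
  φ : ∀ i, (S i).Alg →⋆ₙₐ[ℂ] (S (i + 1)).Alg

/-- The composed connecting map `A_i → A_{i + k}`. -/
def AHSystem.map (𝒮 : AHSystem) (i : ℕ) : ∀ k : ℕ, (𝒮.S i).Alg →⋆ₙₐ[ℂ] (𝒮.S (i + k)).Alg
  | 0 => NonUnitalStarAlgHom.id ℂ _
  | k + 1 => (𝒮.φ (i + k)).comp (𝒮.map i k)

/-- `A` is an AH algebra: it is (isomorphic to) the C⋆-algebraic inductive limit of a sequence of
finite direct sums of homogeneous C⋆-algebras. The inductive limit is characterised by compatible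
⋆-homomorphisms `ψ i : A_i → A` with dense union of ranges and `‖ψ i x‖ = lim_k ‖φ_{i,i+k} x‖`. -/
def IsAH (A : Type u) [CStarAlgebra A] : Prop :=
  ∃ (𝒮 : AHSystem) (ψ : ∀ i, (𝒮.S i).Alg →⋆ₙₐ[ℂ] A),
    (∀ i x, ψ (i + 1) (𝒮.φ i x) = ψ i x) ∧
    (∀ i x, Tendsto (fun k => ‖𝒮.map i k x‖) atTop (𝓝 ‖ψ i x‖)) ∧
    Dense (⋃ i, Set.range (ψ i))

end AH

end

end CStarCuntz

open CStarCuntz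

namespace CStarCuntz

noncomputable section

open scoped ComplexOrder NNReal Topology
open Filter

universe u

/-! ### Invertibles from polar decompositions -/

section StableRankOne

variable {M : Type u} [CStarAlgebra M] [PartialOrder M] [StarOrderedRing M]

/-! That ranks belong to `LAffPos A` is soft: up to normalising factors, d_τ(a) is an increasing
limit of continuous affine functions of τ, and traces of a simple algebra are faithful. The content
is surjectivity.

Given f, Hahn–Banach in the weak-* dual, lower semicontinuity of f and separability of A give
selfadjoint c_n with τ(c_n) strictly increasing to f(τ) for every τ
(`exists_increasing_selfAdjoint`). Each c_n is realised, up to a small ε_n, as the rank of a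
cut-down (b_n - δ_n)₊ of a positive matrix b_n whose own rank exceeds c_n by at most ε_n
(`AHData.exists_rank_approx`). The gaps between consecutive c_n are bounded below on the compact
space T(A), so strict comparison yields b_n ≾ (b_{n+1} - δ_{n+1})₊, and b_n ≾ 1_K for a fixed K
above f. Stable rank one moves the cut-downs into M_K(A) as elements a_n and turns subequivalence
into honest inequalities a_n ≤ c R a_{n+1} R⋆ with R invertible. After undoing the conjugations, a
weighted sum of the a_n is an element a of M_K(A) with rank exactly f (`exists_sup`). Its partial
sums have rank strictly below f, whereas a projection equivalent to a would be dominated by one of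
them (`isPurelyPositive_of_tendsto`).

The AH structure enters twice. First, comparison quantifies over quasitraces while f only knows
traces. A stage is a corner of C(X, M_n). Near a point, the equivalence of rank one subprojections
forces a quasitrace to see selfadjoint elements of the corner only through their pointwise trace
(`CornerMap.quasitrace_eq`), so it is additive on them. Hence a normalised quasitrace agrees with a
tracial state on the dense union of the stages (`AHData.exists_tracialState_of_quasitrace`).
Agreement elsewhere is not needed, because the matrices b_n have entries in a single stage.

Second, it produces the b_n. If c is positive on all traces, then at some stage it is close to an
element with nonnegative pointwise trace F, in a corner whose pointwise rank is 0 or at least N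
(`AHData.exists_asymptotic`). Otherwise the normalised traces at bad points converge along an
ultrafilter to a tracial state which is either too small on c or has vanishing Gram determinants of
size N² + 1; by faithfulness the latter makes A finite-dimensional. Slicing F into layers with
values in [0, 1], each carried by a rank one projection over the corner, gives a block matrix whose
pointwise rank lies between F and F + 1; against a trace the constant 1 weighs at most 1/N. -/

theorem le_algebraMap_of_norm_le {x : M} (hx : IsSelfAdjoint x) {r : ℝ} (h : ‖x‖ ≤ r) :
    x ≤ algebraMap ℝ M r :=
  hx.le_algebraMap_norm_self.trans (algebraMap_mono M h)

theorem neg_algebraMap_le_of_norm_le {x : M} (hx : IsSelfAdjoint x) {r : ℝ} (h : ‖x‖ ≤ r) :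
    -algebraMap ℝ M r ≤ x :=
  (neg_le_neg (algebraMap_mono M h)).trans hx.neg_algebraMap_norm_le_self

/-- An element close to an element bounded below is invertible. -/
theorem isUnit_of_norm_sub_lt {P W : M} {g : ℝ} (hg : 0 < g) (hP : algebraMap ℝ M g ≤ P)
    (hW : ‖W - P‖ < g) : IsUnit W := by
  have hP0 : 0 ≤ P := (algebraMap_nonneg M hg.le).trans hP
  -- The spectrum of P lies in [g, l], so l - P has norm at most l - g and l - W has norm below l; a
  -- Neumann series inverts W.
  set l : ℝ := ‖P‖ + g with hl
  have hl0 : 0 < l := by positivity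
  have hPl : P ≤ algebraMap ℝ M l :=
    le_algebraMap_of_norm_le hP0.isSelfAdjoint (by linarith)
  have h1 : ‖algebraMap ℝ M l - P‖ ≤ l - g := by
    rw [CStarAlgebra.norm_le_iff_le_algebraMap _ (by simp [hl]) (sub_nonneg.2 hPl), map_sub]
    exact sub_le_sub_left hP _
  have h2 : ‖algebraMap ℝ M l - W‖ < l := by
    calc ‖algebraMap ℝ M l - W‖ = ‖(algebraMap ℝ M l - P) - (W - P)‖ := by congr 1; abel
      _ ≤ _ := norm_sub_le _ _
      _ < l := by linarith
  have h3 : IsUnit (1 - l⁻¹ • (algebraMap ℝ M l - W)) := by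
    apply isUnit_one_sub_of_norm_lt_one
    rw [norm_smul, norm_inv, Real.norm_of_nonneg hl0.le, inv_mul_lt_one₀ hl0]
    exact h2
  have h4 : 1 - l⁻¹ • (algebraMap ℝ M l - W) = l⁻¹ • W := by
    rw [Algebra.algebraMap_eq_smul_one, smul_sub, smul_smul, inv_mul_cancel₀ hl0.ne', one_smul]
    abel
  rw [h4] at h3
  have h5 := (Units.mk0 l⁻¹ (inv_ne_zero hl0.ne')).isUnit
  have := (isUnit_smul_iff (Units.mk0 l⁻¹ (inv_ne_zero hl0.ne')) W).1 h3
  exact this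

/-- If the invertible elements are dense, then an element which is bounded below modulo `D` agrees
with an invertible element on the right annihilator of `D`. -/
theorem exists_isUnit_mul_eq (hsr : Dense {a : M | IsUnit a}) {S D : M} (hD : 0 ≤ D) {γ : ℝ}
    (hγ : 0 < γ) (h : algebraMap ℝ M γ ≤ star S * S + D) :
    ∃ Z : M, IsUnit Z ∧ ∀ k, D * k = 0 → Z * k = S * k := by
  set m : ℝ := ‖S‖ + 1 with hm
  have hm1 : 1 ≤ m := by simp [hm]
  have hm0 : 0 < m := by positivity
  -- The third bound keeps Y⋆Y + D above γ/2 when S is replaced by Y; the fourth keeps the final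
  -- perturbation of P + D below its lower bound γ/(2m).
  obtain ⟨η, hη0, hη1, hη2, hη3⟩ : ∃ η : ℝ, 0 < η ∧ η ≤ 1 ∧ η * (2 * m) ≤ γ / 2 ∧
      η < γ / (2 * m) := by
    refine ⟨min 1 (γ / (4 * m)), by positivity, min_le_left _ _, ?_, ?_⟩
    · calc min 1 (γ / (4 * m)) * (2 * m) ≤ γ / (4 * m) * (2 * m) := by
            gcongr; exact min_le_right _ _
        _ = γ / 2 := by field_simp; ring
    · refine (min_le_right _ _).trans_lt ?_
      gcongr
      linarith
  obtain ⟨Y, hY, hYS⟩ := hsr.exists_dist_lt S hη0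
  rw [dist_eq_norm] at hYS
  -- Y is invertible, so its polar decomposition Y = wP has a unitary factor w.
  set P := CFC.abs Y with hP
  have hP0 : 0 ≤ P := CFC.abs_nonneg Y
  have hPP : P * P = star Y * Y := CFC.abs_mul_abs Y
  have hPu : IsUnit P := by
    have : IsUnit (star Y * Y) := (IsUnit.star hY).mul hY
    rwa [hP, CFC.abs, CFC.isUnit_sqrt_iff _ (star_mul_self_nonneg Y)]
  obtain ⟨p, hp⟩ := hPu
  have hps : star (↑p⁻¹ : M) = ↑p⁻¹ := by
    have : star p = p := Units.ext (by rw [Units.coe_star, hp]; exact hP0.isSelfAdjoint.star_eq)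
    rw [← Units.coe_star_inv, this]
  set w : M := Y * ↑p⁻¹ with hw
  have hww : star w * w = 1 := by
    rw [hw, star_mul, hps, mul_assoc, ← mul_assoc (star Y), ← hPP, ← hp]; simp
  have hwu : IsUnit w := hY.mul p⁻¹.isUnit
  have hwY : star w * Y = P := by
    rw [hw, star_mul, hps, mul_assoc, ← hPP, ← hp]; simp
  have hwn : ‖star w‖ ≤ 1 := by
    rw [norm_star]
    rcases subsingleton_or_nontrivial M with h0 | h0
    · rw [Subsingleton.elim w 0]; simp
    · have : ‖w‖ * ‖w‖ = 1 := by rw [← CStarRing.norm_star_mul_self, hww, CStarRing.norm_one]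
      nlinarith [norm_nonneg w]
  have hPn : ‖P‖ ≤ m := by
    rw [hP, CFC.norm_abs]
    have := norm_sub_norm_le Y S
    rw [norm_sub_rev] at hYS
    linarith
  have hlow : algebraMap ℝ M (γ / (2 * m)) ≤ P + D := by
    -- Since P ≤ m, a lower bound for P² + D yields one for P + D.
    have e1 : P * P ≤ m • P := by
      have := CStarAlgebra.star_left_conjugate_le_norm_smul (a := CFC.sqrt P) (b := P)
        hP0.isSelfAdjoint
      rw [(CFC.sqrt_nonneg P).isSelfAdjoint.star_eq] at this
      have e2 : CFC.sqrt P * P * CFC.sqrt P = P * P := by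
        have hs := CFC.sqrt_mul_sqrt_self P hP0
        nth_rewrite 2 [← hs]
        rw [mul_assoc, mul_assoc, ← mul_assoc (CFC.sqrt P), hs]
      rw [e2, CFC.sqrt_mul_sqrt_self P hP0] at this
      exact this.trans (smul_le_smul_of_nonneg_right hPn hP0)
    have e2 : algebraMap ℝ M (γ / 2) ≤ star Y * Y + D := by
      have hn : ‖star S * S - star Y * Y‖ ≤ γ / 2 := by
        have : star S * S - star Y * Y = star S * (S - Y) + star (S - Y) * Y := by
          rw [star_sub]; noncomm_ring
        rw [this]
        have hYm : ‖Y‖ ≤ m := by rw [← CFC.norm_abs]; exact hPn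
        calc _ ≤ ‖star S * (S - Y)‖ + ‖star (S - Y) * Y‖ := norm_add_le _ _
          _ ≤ ‖star S‖ * ‖S - Y‖ + ‖star (S - Y)‖ * ‖Y‖ :=
            add_le_add (norm_mul_le _ _) (norm_mul_le _ _)
          _ ≤ m * η + η * m := by
            rw [norm_star, norm_star]
            gcongr
            linarith
          _ ≤ γ / 2 := by linarith
      have hle := le_algebraMap_of_norm_le
        ((IsSelfAdjoint.star_mul_self S).sub (IsSelfAdjoint.star_mul_self Y)) hn
      have e4 : algebraMap ℝ M (γ / 2) = algebraMap ℝ M γ - algebraMap ℝ M (γ / 2) := by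
        rw [← map_sub]; congr 1; ring
      rw [e4]
      calc _ ≤ star S * S + D - (star S * S - star Y * Y) := sub_le_sub h hle
        _ = _ := by abel
    have e3 : algebraMap ℝ M (γ / 2) ≤ m • (P + D) := by
      rw [smul_add]
      refine e2.trans (add_le_add (hPP ▸ e1) ?_)
      calc D = (1 : ℝ) • D := (one_smul _ _).symm
        _ ≤ m • D := smul_le_smul_of_nonneg_right hm1 hD
    have e4 := smul_le_smul_of_nonneg_left e3 (inv_nonneg.2 hm0.le)
    rw [smul_smul, inv_mul_cancel₀ hm0.ne', one_smul, Algebra.algebraMap_eq_smul_one, smul_smul]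
      at e4
    rw [Algebra.algebraMap_eq_smul_one]
    convert e4 using 2
    field_simp
  -- w⋆(S + wD) = w⋆S + D is a small perturbation of P + D, and the added term dies on the right
  -- annihilator of D.
  refine ⟨S + w * D, ?_, fun k hk => by rw [add_mul, mul_assoc, hk, mul_zero, add_zero]⟩
  have hu : IsUnit (star w * (S + w * D)) := by
    refine isUnit_of_norm_sub_lt (g := γ / (2 * m)) (by positivity) hlow ?_
    have : star w * (S + w * D) - (P + D) = star w * (S - Y) := by
      rw [mul_add, ← mul_assoc, hww, one_mul, mul_sub, hwY]; abel
    rw [this]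
    refine (norm_mul_le _ _).trans_lt ?_
    calc ‖star w‖ * ‖S - Y‖ ≤ 1 * ‖S - Y‖ := by gcongr
      _ < γ / (2 * m) := by linarith
  have := (IsUnit.star hwu)
  obtain ⟨v, hv⟩ := this
  rw [← hv] at hu
  exact (Units.isUnit_units_mul v _).1 hu

end StableRankOne

/-! ### Stable rank one of matrix algebras -/

section StableRankOneMatrix

/-- Lower unipotent times block diagonal times upper unipotent; d is the Schur complement of a. -/
theorem isUnit_fromBlocks {R : Type*} [Ring R] {l m : Type*} [Fintype l] [Fintype m]
    [DecidableEq l] [DecidableEq m] (a : (Matrix l l R)ˣ) (b : Matrix l m R) (c : Matrix m l R)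
    (d : (Matrix m m R)ˣ) :
    IsUnit (Matrix.fromBlocks (a : Matrix l l R) b c ((d : Matrix m m R) + c * (↑a⁻¹ : Matrix l l R) * b)) := by
  set a' : Matrix l l R := ↑a⁻¹ with ha'
  have haa : (a : Matrix l l R) * a' = 1 := a.mul_inv
  have haa' : a' * (a : Matrix l l R) = 1 := a.inv_mul
  have h1 : IsUnit (Matrix.fromBlocks (1 : Matrix l l R) 0 (c * a') (1 : Matrix m m R)) := by
    refine isUnit_iff_exists.2 ⟨Matrix.fromBlocks 1 0 (-(c * a')) 1, ?_, ?_⟩ <;>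
      rw [Matrix.fromBlocks_multiply, ← Matrix.fromBlocks_one] <;> congr 1 <;> simp
  have h2 : IsUnit (Matrix.fromBlocks (a : Matrix l l R) 0 0 (d : Matrix m m R)) := by
    refine isUnit_iff_exists.2 ⟨Matrix.fromBlocks a' 0 0 (↑d⁻¹ : Matrix m m R), ?_, ?_⟩ <;>
      rw [Matrix.fromBlocks_multiply, ← Matrix.fromBlocks_one] <;> congr 1 <;> simp [haa, haa']
  have h3 : IsUnit (Matrix.fromBlocks (1 : Matrix l l R) (a' * b) 0 (1 : Matrix m m R)) := by
    refine isUnit_iff_exists.2 ⟨Matrix.fromBlocks 1 (-(a' * b)) 0 1, ?_, ?_⟩ <;>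
      rw [Matrix.fromBlocks_multiply, ← Matrix.fromBlocks_one] <;> congr 1 <;> simp
  convert (h1.mul h2).mul h3 using 1
  rw [Matrix.fromBlocks_multiply, Matrix.fromBlocks_multiply]
  congr 1
  · simp
  · simp [← Matrix.mul_assoc, haa]
  · simp [Matrix.mul_assoc, haa']
  · simp only [Matrix.zero_mul, Matrix.mul_zero, Matrix.one_mul, Matrix.mul_one, zero_add, add_zero]
    rw [Matrix.mul_assoc c a' (a : Matrix l l R), haa', Matrix.mul_one, Matrix.mul_assoc, add_comm]

variable {R : Type*} [Ring R] [TopologicalSpace R] [IsTopologicalRing R]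

/-- The upper left block is perturbed to an invertible one, and then the Schur complement is
perturbed by moving only the lower right block. -/
theorem dense_isUnit_sum {l m : Type*} [Fintype l] [Fintype m] [DecidableEq l] [DecidableEq m]
    (hl : Dense {a : Matrix l l R | IsUnit a}) (hm : Dense {a : Matrix m m R | IsUnit a}) :
    Dense {a : Matrix (l ⊕ m) (l ⊕ m) R | IsUnit a} := by
  intro x
  rw [← Matrix.fromBlocks_toBlocks x]
  set b := x.toBlocks₁₂
  set c := x.toBlocks₂₁
  have hS : ∀ a : Matrix l l R, IsUnit a → ∀ d,
      Matrix.fromBlocks a b c d ∈ closure {a : Matrix (l ⊕ m) (l ⊕ m) R | IsUnit a} := by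
    rintro _ ⟨a, rfl⟩ d
    have hc : Continuous fun y : Matrix m m R =>
        Matrix.fromBlocks (a : Matrix l l R) b c (y + c * (↑a⁻¹ : Matrix l l R) * b) := by
      fun_prop
    have := map_mem_closure hc (hm (d - c * (↑a⁻¹ : Matrix l l R) * b)) (t := {a | IsUnit a})
      (by rintro _ ⟨y, rfl⟩; exact isUnit_fromBlocks a b c y)
    simpa using this
  have hc : Continuous fun y : Matrix l l R => Matrix.fromBlocks y b c x.toBlocks₂₂ := by
    fun_prop
  have := map_mem_closure hc (hl x.toBlocks₁₁)
    (t := closure {a : Matrix (l ⊕ m) (l ⊕ m) R | IsUnit a}) (fun y hy => hS y hy _)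
  rwa [closure_closure] at this

theorem dense_isUnit_of_ringEquiv {B C : Type*} [Ring B] [Ring C] [TopologicalSpace B]
    [TopologicalSpace C] (e : B ≃+* C) (he : Continuous e) (h : Dense {b : B | IsUnit b}) :
    Dense {c : C | IsUnit c} := by
  intro c
  have := map_mem_closure he (h (e.symm c)) (t := {c | IsUnit c}) (fun y hy => hy.map e)
  simpa using this

theorem dense_isUnit_matrix (h : Dense {a : R | IsUnit a}) (n : ℕ) :
    Dense {a : Matrix (Fin n) (Fin n) R | IsUnit a} := by
  induction n with
  | zero => exact fun x => subset_closure (isUnit_of_subsingleton x)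
  | succ n ih =>
    have h1 : Dense {a : Matrix (Fin 1) (Fin 1) R | IsUnit a} := by
      refine dense_isUnit_of_ringEquiv (Matrix.uniqueRingEquiv (m := Fin 1) (A := R)).symm ?_ h
      exact continuous_matrix fun i j => continuous_id
    refine dense_isUnit_of_ringEquiv
      (Matrix.reindexRingEquiv R (finSumFinEquiv (m := n) (n := 1))) ?_ (dense_isUnit_sum ih h1)
    exact continuous_matrix fun i j => continuous_id.matrix_elem _ _

theorem stableRankOne_mat {A : Type u} [CStarAlgebra A] [PartialOrder A] [StarOrderedRing A]
    (h : StableRankOne A) (n : ℕ) : Dense {a : Mat n A | IsUnit a} := by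
  refine dense_isUnit_of_ringEquiv (B := Matrix (Fin n) (Fin n) A) (C := Mat n A)
    (CStarMatrix.ofMatrixRingEquiv (n := Fin n) (A := A)) ?_ (dense_isUnit_matrix h n)
  -- `Mat n A` carries the entrywise topology, so the identification with plain matrices is the
  -- identity on topological spaces.
  exact continuous_id

end StableRankOneMatrix

/-! ### Suprema of chains and their ranks -/

section Increasing

variable {M : Type u} [CStarAlgebra M] [PartialOrder M] [StarOrderedRing M]

theorem IsPosTrace.dimLim_conj_le {φ : M →L[ℂ] ℂ} (h : IsPosTrace φ) {a : M} (ha : 0 ≤ a) (v : M) :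
    dimLim φ (v * a * star v) ≤ dimLim φ a :=
  h.dimLim_le (star_right_conjugate_nonneg ha v) ha fun ε hε => ⟨v, by simpa using hε⟩

theorem IsPosTrace.dimLim_le_of_le_smul {φ : M →L[ℂ] ℂ} (h : IsPosTrace φ) {a b : M} (ha : 0 ≤ a)
    (hb : 0 ≤ b) {c : ℝ≥0} (hab : a ≤ c • b) : dimLim φ a ≤ dimLim φ b := by
  -- c may vanish, whereas `dimLim_smul` needs a nonzero factor.
  have h1 : a ≤ (c + 1) • b := hab.trans (by rw [add_smul, one_smul]; exact le_add_of_nonneg_right hb)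
  exact (h.dimLim_mono ha h1).trans_eq (h.dimLim_smul hb (by positivity))

theorem IsPosTrace.dimLim_nonneg {φ : M →L[ℂ] ℂ} (h : IsPosTrace φ) {a : M} (ha : 0 ≤ a) :
    0 ≤ dimLim φ a := by
  refine ge_of_tendsto' (h.tendsto ha) fun k => ?_
  have := h.mono (CFC.nnrpow_nonneg (a := a) (x := ((k + 1 : ℝ≥0)⁻¹)))
  simpa using this

/-- Lower semicontinuity of `dimLim` in the algebra variable. -/
theorem IsPosTrace.dimLim_le_of_tendsto {φ : M →L[ℂ] ℂ} (h : IsPosTrace φ) {s : ℕ → M} {a : M}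
    (hs : ∀ m, 0 ≤ s m) (ha : 0 ≤ a) (hsa : Tendsto s atTop (𝓝 a)) {B : ℝ}
    (hB : ∀ m, dimLim φ (s m) ≤ B) : dimLim φ a ≤ B := by
  obtain ⟨C, hC0, hC⟩ : ∃ C : ℝ≥0, C ≠ 0 ∧ ∀ᶠ m in atTop, ‖s m‖ ≤ C := by
    refine ⟨‖a‖₊ + 1, by positivity, ?_⟩
    have := (hsa.norm).eventually (gt_mem_nhds (show ‖a‖ < ‖a‖ + 1 by linarith))
    filter_upwards [this] with m hm
    exact hm.le
  have key : ∀ k : ℕ, (φ (a ^ ((k + 1 : ℝ≥0)⁻¹))).re ≤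
      (C ^ (((k + 1 : ℝ≥0)⁻¹ : ℝ≥0) : ℝ) : ℝ≥0) * B := by
    intro k
    have h1 := (CFC.continuousOn_nnrpow (A := M) ((k + 1 : ℝ≥0)⁻¹)) a ha
    have h2 : Tendsto s atTop (𝓝[{x : M | 0 ≤ x}] a) :=
      tendsto_nhdsWithin_iff.2 ⟨hsa, .of_forall hs⟩
    have h3 := (Complex.continuous_re.comp φ.continuous).continuousAt.tendsto.comp
      (h1.tendsto.comp h2)
    refine le_of_tendsto h3 ?_
    filter_upwards [hC] with m hm
    refine (h.le_dimLim (hs m) hC0 hm k).trans ?_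
    gcongr
    exact hB m
  have h1 := (tendsto_rpow_inv_succ hC0).mul_const B
  rw [one_mul] at h1
  exact le_of_tendsto_of_tendsto' (h.tendsto ha) h1 key

/-- A sequence of positive elements which is increasing up to scalars has a supremum. -/
theorem exists_limit_of_le_smul (a : ℕ → M) (ha : ∀ n, 0 ≤ a n) (c : ℕ → ℝ≥0)
    (hac : ∀ n, a n ≤ c n • a (n + 1)) :
    ∃ (b : M) (s : ℕ → M) (C t : ℕ → ℝ≥0), 0 ≤ b ∧ (∀ m, 0 ≤ s m) ∧ Tendsto s atTop (𝓝 b) ∧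
      (∀ n, a n ≤ t n • b) ∧ ∀ m, s m ≤ C m • a m := by
  -- The weights make the series converge and are nonzero, so each a_n is dominated by a multiple of
  -- the sum.
  set t : ℕ → ℝ≥0 := fun n => (1 / 2) ^ n * (‖a n‖₊ + 1)⁻¹ with ht
  have ht0 : ∀ n, t n ≠ 0 := fun n => by simp only [ht]; positivity
  have hsum : Summable fun n => t n • a n := by
    refine Summable.of_norm_bounded (g := fun n => (1 / 2 : ℝ) ^ n) summable_geometric_two
      fun n => ?_
    rw [NNReal.smul_def, norm_smul, ht]
    have : ‖a n‖ ≤ ‖a n‖ + 1 := by linarith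
    have h1 : (‖a n‖ + 1)⁻¹ * ‖a n‖ ≤ 1 := by
      rw [inv_mul_le_one₀ (by positivity)]; exact this
    simp only [NNReal.coe_mul, NNReal.coe_pow, NNReal.coe_inv, NNReal.coe_add, coe_nnnorm,
      NNReal.coe_one, norm_mul, norm_pow, norm_inv, NNReal.coe_div, NNReal.coe_ofNat]
    rw [Real.norm_of_nonneg (show (0 : ℝ) ≤ 1 / 2 by norm_num),
      Real.norm_of_nonneg (show (0 : ℝ) ≤ ‖a n‖ + 1 by positivity), mul_assoc]
    calc _ ≤ (1 / 2 : ℝ) ^ n * 1 := by gcongr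
      _ = _ := mul_one _
  have hta : ∀ n, 0 ≤ t n • a n := fun n => smul_nonneg (by positivity) (ha n)
  have hS := hsum.hasSum.tendsto_sum_nat
  have hle : ∀ n, t n • a n ≤ ∑' n, t n • a n := fun n =>
    hsum.le_tsum n fun j _ => hta j
  -- All earlier terms are absorbed into a multiple of the last one; the range m + 1 is what
  -- includes a_m.
  have hC : ∀ m, ∃ C : ℝ≥0, ∑ n ∈ Finset.range (m + 1), t n • a n ≤ C • a m := by
    intro m
    induction m with
    | zero => exact ⟨t 0, by simp⟩
    | succ m ih =>
      obtain ⟨C, hC⟩ := ih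
      refine ⟨C * c m + t (m + 1), ?_⟩
      rw [Finset.sum_range_succ, add_smul, mul_smul]
      gcongr
      exact hC.trans ((smul_le_smul_of_nonneg_left (hac m) (by positivity : (0 : ℝ≥0) ≤ C)).trans_eq
        (mul_smul _ _ _).symm)
  choose C hC using hC
  refine ⟨∑' n, t n • a n, fun m => ∑ n ∈ Finset.range (m + 1), t n • a n, C,
    fun n => (t n)⁻¹, tsum_nonneg hta, fun m => Finset.sum_nonneg fun n _ => hta n,
    (tendsto_add_atTop_iff_nat 1).2 hS, fun n => ?_, hC⟩
  have := smul_le_smul_of_nonneg_left (hle n) (by positivity : (0 : ℝ≥0) ≤ (t n)⁻¹)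
  rwa [smul_smul, inv_mul_cancel₀ (ht0 n), one_smul] at this

/-- Conjugating by invertible elements, a chain `aₙ ≤ cₙ Rₙ aₙ₊₁ Rₙ⋆` has a supremum. -/
theorem exists_limit_of_chain (a : ℕ → M) (ha : ∀ n, 0 ≤ a n) (c : ℕ → ℝ≥0) (R : ℕ → M)
    (hR : ∀ n, IsUnit (R n)) (hac : ∀ n, a n ≤ c n • (R n * a (n + 1) * star (R n))) :
    ∃ (b : M) (s : ℕ → M), 0 ≤ b ∧ (∀ m, 0 ≤ s m) ∧ Tendsto s atTop (𝓝 b) ∧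
      ∀ φ : M →L[ℂ] ℂ, IsPosTrace φ →
        (∀ n, dimLim φ (a n) ≤ dimLim φ b) ∧ ∀ m, dimLim φ (s m) ≤ dimLim φ (a m) := by
  choose r hr using hR
  -- v_n = R_0 ⋯ R_{n-1}; the conjugates v_n a_n v_n⋆ then increase up to scalars, and conjugation
  -- by invertibles preserves rank.
  obtain ⟨v, hv⟩ : ∃ v : ℕ → Mˣ, ∀ n, v (n + 1) = v n * r n :=
    ⟨fun n => Nat.rec 1 (fun n w => w * r n) n, fun n => rfl⟩
  have hv0 : ∀ n, 0 ≤ (v n : M) * a n * star (v n : M) := fun n =>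
    star_right_conjugate_nonneg (ha n) (v n : M)
  obtain ⟨b, s, C, t, hb, hs, hsb, htb, hC⟩ :=
    exists_limit_of_le_smul (fun n => (v n : M) * a n * star (v n : M)) hv0 c (by
      intro n
      have := star_right_conjugate_le_conjugate (hac n) (v n : M)
      refine this.trans_eq ?_
      rw [hv, Units.val_mul, hr, star_mul, mul_smul_comm, smul_mul_assoc]
      simp only [mul_assoc])
  refine ⟨b, s, hb, hs, hsb, fun φ hφ => ⟨fun n => ?_, fun m => ?_⟩⟩
  · have e : a n = ↑(v n)⁻¹ * ((v n : M) * a n * star (v n : M)) * star (↑(v n)⁻¹ : M) := by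
      have h1 : star (v n : M) * star (↑(v n)⁻¹ : M) = 1 := by
        rw [← star_mul, Units.inv_mul, star_one]
      rw [mul_assoc, mul_assoc _ (star _), h1, mul_one, Units.inv_mul_cancel_left]
    conv_lhs => rw [e]
    exact (hφ.dimLim_conj_le (hv0 n) _).trans (hφ.dimLim_le_of_le_smul (hv0 n) hb (htb n))
  · exact (hφ.dimLim_le_of_le_smul (hs m) (hv0 m) (hC m)).trans (hφ.dimLim_conj_le (ha m) _)

/-- If `p` is a projection within distance `< 1` of `x`, its rank is at most that of `x`. -/
theorem IsPosTrace.dimLim_projection_le {φ : M →L[ℂ] ℂ} (h : IsPosTrace φ) {p x : M}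
    (hp : IsStarProjection p) (hx : 0 ≤ x) (hpx : ‖x - p‖ < 1) : dimLim φ p ≤ dimLim φ x := by
  have hp0 : 0 ≤ p := hp.nonneg
  set δ : ℝ≥0 := ‖x - p‖₊ with hδ
  have hδ1 : δ < 1 := hpx
  have h1 : -algebraMap ℝ M δ ≤ x - p :=
    neg_algebraMap_le_of_norm_le (hx.isSelfAdjoint.sub hp0.isSelfAdjoint) le_rfl
  have h2 := star_right_conjugate_le_conjugate h1 p
  have hps := hp.isSelfAdjoint.star_eq
  have hpp : p * p = p := hp.isIdempotentElem
  -- Compressing x ≥ p - δ by p.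
  have h3 : (1 - δ) • p ≤ p * x * star p := by
    have e : p * -algebraMap ℝ M δ * star p = -((δ : ℝ) • p) := by
      rw [hps, Algebra.algebraMap_eq_smul_one, mul_neg, neg_mul, mul_smul_comm, mul_one,
        smul_mul_assoc, hpp]
    rw [e, mul_sub, sub_mul, hpp, hps, hpp, neg_le_sub_iff_le_add] at h2
    rw [NNReal.smul_def, NNReal.coe_sub hδ1.le, NNReal.coe_one, sub_smul, one_smul, hps]
    exact sub_le_iff_le_add.2 h2
  have h4 : p ≤ (1 - δ)⁻¹ • (p * x * star p) := by
    have := smul_le_smul_of_nonneg_left h3 (by positivity : (0 : ℝ≥0) ≤ (1 - δ)⁻¹)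
    rwa [smul_smul, inv_mul_cancel₀ (tsub_pos_of_lt hδ1).ne', one_smul] at this
  exact (h.dimLim_le_of_le_smul hp0 (star_right_conjugate_nonneg hx p) h4).trans
    (h.dimLim_conj_le hx p)

/-- Comparison relative to a decomposition `b - δ = k - D` into orthogonal positive parts. -/
theorem exists_isUnit_of_norm_sub_le (hsr : Dense {a : M | IsUnit a}) {b k D S : M} {δ : ℝ}
    (hδ : 0 < δ) (hk : 0 ≤ k) (hD : 0 ≤ D) (hb : IsSelfAdjoint b)
    (hbk : b - algebraMap ℝ M δ = k - D) (hS : ‖star S * S - b‖ ≤ δ / 2) :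
    ∃ Z : M, IsUnit Z ∧ ∀ x, D * x = 0 → Z * x = S * x := by
  -- b + D = k + δ is at least δ, and S⋆S differs from b by at most δ/2.
  refine exists_isUnit_mul_eq hsr hD (half_pos hδ) ?_
  have h1 := neg_algebraMap_le_of_norm_le ((IsSelfAdjoint.star_mul_self S).sub hb) hS
  have h2 : b + D = k + algebraMap ℝ M δ := by
    rw [sub_eq_iff_eq_add] at hbk; rw [hbk]; abel
  have e4 : algebraMap ℝ M (δ / 2) = algebraMap ℝ M δ + -algebraMap ℝ M (δ / 2) := by
    rw [← sub_eq_add_neg, ← map_sub]; congr 1; ring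
  calc algebraMap ℝ M (δ / 2) = algebraMap ℝ M δ + -algebraMap ℝ M (δ / 2) := e4
    _ ≤ (k + algebraMap ℝ M δ) + (star S * S - b) :=
      add_le_add (le_add_of_nonneg_left hk) h1
    _ = star S * S + D := by rw [← h2]; abel

/-- By uniqueness of the decomposition into orthogonal positive parts, f a⁻ is the negative part of
f a, hence 0, and f is injective. -/
theorem nonneg_of_map_nonneg {N : Type u} [CStarAlgebra N] [PartialOrder N] [StarOrderedRing N]
    (f : M →⋆ₙₐ[ℂ] N) (hf : Function.Injective f) {a : M} (h : 0 ≤ f a) : 0 ≤ a := by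
  have hmap : ∀ x : M, 0 ≤ x → 0 ≤ f x := by
    intro x hx
    obtain ⟨y, rfl⟩ := CStarAlgebra.nonneg_iff_eq_star_mul_self.1 hx
    rw [map_mul, map_star]; exact star_mul_self_nonneg _
  have hsa : IsSelfAdjoint a := hf (by rw [map_star]; exact h.isSelfAdjoint)
  have h1 := (CFC.posPart_negPart_unique (a := f a) (b := f a⁺) (c := f a⁻)
    (by rw [← map_sub, CFC.posPart_sub_negPart a])
    (by rw [← map_mul, CFC.posPart_mul_negPart, map_zero])
    (hmap _ (CFC.posPart_nonneg a)) (hmap _ (CFC.negPart_nonneg a))).2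
  have h2 : (f a)⁻ = 0 := (CFC.negPart_eq_zero_iff (f a)).2 h
  rw [h2] at h1
  have h3 : a⁻ = 0 := hf (by rw [← h1, map_zero])
  exact (CFC.negPart_eq_zero_iff a).1 h3

end Increasing

/-! ### Suprema in the Cuntz semigroup -/

section Assembly

variable {A : Type u} [CStarAlgebra A] [PartialOrder A] [StarOrderedRing A]

/-- `(b - δ)₊`. -/
def MInftyPos.cutDown (b : MInftyPos A) (δ : ℝ) : MInftyPos A where
  size := b.size
  mat := (b.mat - algebraMap ℝ (Mat b.size A) δ)⁺
  nonneg := CFC.posPart_nonneg _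

variable (A) in
/-- The unit of `M_K(A)`. -/
def oneMat (K : ℕ) : MInftyPos A where
  size := K
  mat := 1
  nonneg := zero_le_one

theorem nonneg_of_pad_nonneg {n N : ℕ} (h : n ≤ N) {a : Mat n A} (ha : 0 ≤ pad N a) : 0 ≤ a :=
  nonneg_of_map_nonneg (padHom h) (padHom_injective h) ha

theorem CuntzLE.of_eq_conj {a b : MInftyPos A} {N : ℕ} (ha : a.size ≤ N) (hb : b.size ≤ N)
    (v : Mat N A) (h : pad N a.mat = v * pad N b.mat * star v) : CuntzLE a b := fun ε hε =>
  ⟨N, ha, hb, v, by rw [h, sub_self, norm_zero]; exact hε⟩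

theorem pad_one_mul_pad {n N : ℕ} (h : n ≤ N) (a : Mat n A) :
    pad N (1 : Mat n A) * pad N a = pad N a := by rw [← pad_mul h, one_mul]

theorem pad_mul_pad_one {n N : ℕ} (h : n ≤ N) (a : Mat n A) :
    pad N a * pad N (1 : Mat n A) = pad N a := by rw [← pad_mul h, mul_one]

theorem star_pad_one {n N : ℕ} (h : n ≤ N) : star (pad N (1 : Mat n A)) = pad N (1 : Mat n A) := by
  rw [← pad_star h, star_one]

/-- A decomposition of `b - δ` in the larger matrix algebra. -/
theorem exists_decomposition (b : MInftyPos A) {δ : ℝ} (hδ : 0 ≤ δ) {N : ℕ} (hN : b.size ≤ N) :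
    ∃ D : Mat N A, 0 ≤ D ∧ D * pad N (b.cutDown δ).mat = 0 ∧
      pad N b.mat - algebraMap ℝ (Mat N A) δ = pad N (b.cutDown δ).mat - D := by
  set e : Mat N A := pad N (1 : Mat b.size A) with he
  have hes : star e = e := star_pad_one hN
  have hee : e * e = e := pad_one_mul_pad hN 1
  set x := b.mat - algebraMap ℝ (Mat b.size A) δ with hx
  have hxs : IsSelfAdjoint x := b.nonneg.isSelfAdjoint.sub (.algebraMap _ (.all _))
  have h1e : 0 ≤ 1 - e := by
    have : 1 - e = star (1 - e) * (1 - e) := by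
      rw [star_sub, star_one, hes, mul_sub, sub_mul, sub_mul, hee]; simp
    rw [this]; exact star_mul_self_nonneg _
  -- Outside the block of b the element b - δ equals -δ, so the complement of the block joins the
  -- negative part.
  refine ⟨pad N x⁻ + δ • (1 - e), add_nonneg (pad_nonneg hN (CFC.negPart_nonneg _))
    (smul_nonneg hδ h1e), ?_, ?_⟩
  · change _ * pad N x⁺ = 0
    rw [add_mul, ← pad_mul hN, CFC.negPart_mul_posPart, smul_mul_assoc, sub_mul, one_mul,
      pad_one_mul_pad hN, sub_self, smul_zero, add_zero]
    exact map_zero (padHom hN)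
  · change _ = pad N x⁺ - _
    rw [← sub_sub, ← pad_sub hN, CFC.posPart_sub_negPart x, hx, pad_sub hN,
      Algebra.algebraMap_eq_smul_one, Algebra.algebraMap_eq_smul_one]
    have : pad N (δ • (1 : Mat b.size A)) = δ • e := by
      rw [← Complex.coe_smul, ← Complex.coe_smul]
      exact map_smul (padHom hN) _ _
    rw [this, smul_sub]
    abel

/-- Moving `(b - δ)₊` into `M_K(A)`. -/
theorem exists_moved (hsr : StableRankOne A) (b : MInftyPos A) {δ : ℝ} (hδ : 0 < δ) {K : ℕ}
    (hb : CuntzLE b (oneMat A K)) :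
    ∃ N, b.size ≤ N ∧ K ≤ N ∧ ∃ (a : Mat K A) (Z Y : Mat N A), 0 ≤ a ∧ Z * Y = 1 ∧ Y * Z = 1 ∧
      pad N a = Z * pad N (b.cutDown δ).mat * star Z := by
  obtain ⟨N, hbN, hKN⟩ : ∃ N, b.size ≤ N ∧ K ≤ N := ⟨max b.size K, by simp, by simp⟩
  refine ⟨N, hbN, hKN, ?_⟩
  obtain ⟨x, hx⟩ := hb.exists_of_le hbN hKN (half_pos hδ)
  obtain ⟨D, hD, hDk, hdec⟩ := exists_decomposition b hδ.le hbN
  set k := pad N (b.cutDown δ).mat with hk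
  have hk0 : 0 ≤ k := pad_nonneg hbN (b.cutDown δ).nonneg
  set e : Mat N A := pad N (1 : Mat K A) with he
  have hes : star e = e := star_pad_one hKN
  have hee : e * e = e := pad_one_mul_pad hKN 1
  -- With S = e x⋆ one has S⋆S = x e x⋆ ≈ b, and the range of S lies under e.
  have hS : ‖star (e * star x) * (e * star x) - pad N b.mat‖ ≤ δ / 2 := by
    have : star (e * star x) * (e * star x) = x * pad N (oneMat A K).mat * star x := by
      rw [star_mul, star_star, hes, mul_assoc, ← mul_assoc e, hee, ← mul_assoc]; rfl
    rw [this]; exact hx.le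
  obtain ⟨Z, hZ, hZk⟩ := exists_isUnit_of_norm_sub_le (stableRankOne_mat hsr N) hδ hk0 hD
    (pad_nonneg hbN b.nonneg).isSelfAdjoint hdec hS
  have hks := hk0.isSelfAdjoint.star_eq
  -- Z agrees with S on k, so Z k Z⋆ = S k S⋆ lies in the corner of e, that is, in M_K(A).
  have hcut : Z * k * star Z = e * (star x * k * x) * e := by
    have h1 := hZk k hDk
    have h2 : k * star Z = k * star (e * star x) := by
      have := congrArg star h1
      rwa [star_mul, star_mul, hks] at this
    rw [mul_assoc, h2, ← mul_assoc, h1, star_mul, star_star, hes]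
    simp only [mul_assoc]
  have hpad : pad N (cut K hKN (star x * k * x)) = Z * k * star Z := by
    rw [pad_cut hKN, hcut]
  obtain ⟨z, rfl⟩ := hZ
  refine ⟨cut K hKN (star x * k * x), z, ↑z⁻¹, nonneg_of_pad_nonneg hKN ?_, z.mul_inv, z.inv_mul,
    hpad⟩
  rw [hpad]
  exact star_right_conjugate_nonneg hk0 _

set_option maxHeartbeats 1000000 in
/-- One link of the chain. -/
theorem exists_link (hsr : StableRankOne A) (b : MInftyPos A) {δ : ℝ} (hδ : 0 < δ) {K N : ℕ}
    (hbN : b.size ≤ N) (hKN : K ≤ N) {a a' : Mat K A} (ha : 0 ≤ a) (ha' : 0 ≤ a') {Z Y : Mat N A}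
    (hZY : Z * Y = 1) (hYZ : Y * Z = 1)
    (hpad : pad N a = Z * pad N (b.cutDown δ).mat * star Z)
    (hb : CuntzLE b ⟨K, a', ha'⟩) :
    ∃ (c : ℝ≥0) (R : Mat K A), IsUnit R ∧ a ≤ c • (R * a' * star R) := by
  obtain ⟨y, hy⟩ := hb.exists_of_le hbN hKN (half_pos hδ)
  simp only at hy
  obtain ⟨D, hD, hDk, hdec⟩ := exists_decomposition b hδ.le hbN
  set k := pad N (b.cutDown δ).mat with hk
  have hk0 : 0 ≤ k := pad_nonneg hbN (b.cutDown δ).nonneg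
  set e : Mat N A := pad N (1 : Mat K A) with he
  have hes : star e = e := star_pad_one hKN
  have hee : e * e = e := pad_one_mul_pad hKN 1
  have hpa0 : 0 ≤ pad N a' := pad_nonneg hKN ha'
  -- lower bound in the big algebra
  have hlow : algebraMap ℝ (Mat N A) (δ / 2) ≤ y * pad N a' * star y + D := by
    have h1 := neg_algebraMap_le_of_norm_le
      ((star_right_conjugate_nonneg hpa0 y).isSelfAdjoint.sub
        (pad_nonneg hbN b.nonneg).isSelfAdjoint) hy.le
    have h2 : pad N b.mat + D = k + algebraMap ℝ (Mat N A) δ := by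
      rw [sub_eq_iff_eq_add] at hdec; rw [hdec]; abel
    have e4 : algebraMap ℝ (Mat N A) (δ / 2) =
        algebraMap ℝ (Mat N A) δ + -algebraMap ℝ (Mat N A) (δ / 2) := by
      rw [← sub_eq_add_neg, ← map_sub]; congr 1; ring
    calc algebraMap ℝ (Mat N A) (δ / 2) = _ := e4
      _ ≤ (k + algebraMap ℝ (Mat N A) δ) + (y * pad N a' * star y - pad N b.mat) :=
        add_le_add (le_add_of_nonneg_left hk0) h1
      _ = y * pad N a' * star y + D := by rw [← h2]; abel
  set γ : ℝ := δ / 2 * (‖Z‖ ^ 2 + 1)⁻¹ with hγ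
  have hγ0 : 0 < γ := by positivity
  -- 1 = Y⋆(Z⋆Z)Y ≤ ‖Z‖² Y⋆Y; the extra 1 keeps the factor invertible.
  have hYY : algebraMap ℝ (Mat N A) (‖Z‖ ^ 2 + 1)⁻¹ ≤ star Y * Y := by
    have h1 := CStarAlgebra.star_left_conjugate_le_norm_smul (a := Y) (b := star Z * Z)
      (IsSelfAdjoint.star_mul_self Z)
    have h2 : star Y * (star Z * Z) * Y = 1 := by
      rw [mul_assoc, mul_assoc, hZY, mul_one, ← star_mul, hZY, star_one]
    rw [h2, CStarRing.norm_star_mul_self] at h1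
    have h3 : (1 : Mat N A) ≤ (‖Z‖ ^ 2 + 1) • (star Y * Y) :=
      h1.trans (smul_le_smul_of_nonneg_right (by nlinarith) (star_mul_self_nonneg Y))
    have h4 := smul_le_smul_of_nonneg_left h3 (show 0 ≤ (‖Z‖ ^ 2 + 1)⁻¹ by positivity)
    rwa [smul_smul, inv_mul_cancel₀ (by positivity), one_smul,
      ← Algebra.algebraMap_eq_smul_one] at h4
  have hlow2 : algebraMap ℝ (Mat N A) γ ≤
      star Y * (y * pad N a' * star y) * Y + star Y * D * Y := by
    have h1 := star_left_conjugate_le_conjugate hlow Y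
    rw [mul_add, add_mul] at h1
    refine le_trans ?_ h1
    rw [Algebra.algebraMap_eq_smul_one γ, Algebra.algebraMap_eq_smul_one (δ / 2), mul_smul_comm,
      mul_one, smul_mul_assoc, hγ, mul_smul]
    rw [Algebra.algebraMap_eq_smul_one] at hYY
    exact smul_le_smul_of_nonneg_left hYY (by positivity)
  -- cut down to `M_K(A)`
  set S : Mat K A := CFC.sqrt a' * star (cut K hKN (star Y * y)) with hS
  set D' : Mat K A := cut K hKN (star Y * D * Y) with hD'
  have hSS : pad N (star S * S) = e * (star Y * (y * pad N a' * star y) * Y) * e := by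
    have h1 : star S * S = cut K hKN (star Y * y) * a' * star (cut K hKN (star Y * y)) := by
      rw [hS, star_mul, star_star, (CFC.sqrt_nonneg a').isSelfAdjoint.star_eq, mul_assoc,
        ← mul_assoc (CFC.sqrt a'), CFC.sqrt_mul_sqrt_self a' ha', mul_assoc]
    have h2 : e * pad N a' * e = pad N a' := by rw [pad_one_mul_pad hKN, pad_mul_pad_one hKN]
    rw [h1, pad_mul hKN, pad_mul hKN, pad_star hKN, pad_cut hKN]
    calc e * (star Y * y) * e * pad N a' * star (e * (star Y * y) * e)
        = e * (star Y * y) * (e * pad N a' * e) * (star y * Y) * e := by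
          simp only [star_mul, star_star, hes, mul_assoc]
      _ = _ := by rw [h2]; simp only [mul_assoc]
  have hD'p : pad N D' = e * (star Y * D * Y) * e := pad_cut hKN _
  have hD'0 : 0 ≤ D' := by
    refine nonneg_of_pad_nonneg hKN ?_
    rw [hD'p]
    have := star_left_conjugate_nonneg (star_left_conjugate_nonneg hD Y) e
    rwa [hes] at this
  have hlow3 : algebraMap ℝ (Mat K A) γ ≤ star S * S + D' := by
    rw [← sub_nonneg]
    refine nonneg_of_pad_nonneg hKN ?_
    have h1 := star_left_conjugate_le_conjugate hlow2 e
    rw [hes, mul_add, add_mul, ← hSS, ← hD'p, ← sub_nonneg] at h1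
    have h2 : pad N (algebraMap ℝ (Mat K A) γ) = e * algebraMap ℝ (Mat N A) γ * e := by
      rw [Algebra.algebraMap_eq_smul_one, Algebra.algebraMap_eq_smul_one, mul_smul_comm, mul_one,
        smul_mul_assoc, hee, ← Complex.coe_smul, ← Complex.coe_smul]
      exact map_smul (padHom hKN) _ _
    rw [pad_sub hKN, h2]
    have h3 : pad N (star S * S + D') = pad N (star S * S) + pad N D' := map_add (padHom hKN) _ _
    rwa [h3]
  -- a is Z k Z⋆ and Y Z = 1, so Y⋆ D Y meets a only through D k = 0.
  have hD'a : D' * a = 0 := by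
    apply padHom_injective hKN
    rw [map_zero, padHom_apply, pad_mul hKN, hD'p, mul_assoc, pad_one_mul_pad hKN, hpad]
    have : star Y * D * Y * (Z * k * star Z) = star Y * (D * ((Y * Z) * k)) * star Z := by
      simp only [mul_assoc]
    rw [mul_assoc, this, hYZ, one_mul, hDk]
    simp
  obtain ⟨_, ⟨Z', rfl⟩, hZ'⟩ := exists_isUnit_mul_eq (stableRankOne_mat hsr K) hD'0 hγ0 hlow3
  have h1 := hZ' a hD'a
  have h2 : a * star (Z' : Mat K A) = a * star S := by
    have := congrArg star h1
    rwa [star_mul, star_mul, ha.isSelfAdjoint.star_eq] at this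
  have h3 : (Z' : Mat K A) * a * star (Z' : Mat K A) = S * a * star S := by
    rw [mul_assoc, h2, ← mul_assoc, h1]
  set x := cut K hKN (star Y * y) with hx
  -- S a S⋆ = √a' (x⋆ a x) √a', and the middle factor is at most its norm.
  have h4 : S * a * star S ≤ ‖star x * a * x‖₊ • a' := by
    have h5 := CStarAlgebra.star_left_conjugate_le_norm_smul (a := CFC.sqrt a')
      (b := star x * a * x) (star_left_conjugate_nonneg ha x).isSelfAdjoint
    rw [(CFC.sqrt_nonneg a').isSelfAdjoint.star_eq, CFC.sqrt_mul_sqrt_self a' ha'] at h5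
    rw [hS, star_mul, star_star, (CFC.sqrt_nonneg a').isSelfAdjoint.star_eq]
    simp only [mul_assoc] at h5 ⊢
    exact h5
  rw [← h3] at h4
  have h6 := star_right_conjugate_le_conjugate h4 (↑Z'⁻¹ : Mat K A)
  have h7 : (↑Z'⁻¹ : Mat K A) * (↑Z' * a * star (Z' : Mat K A)) * star (↑Z'⁻¹ : Mat K A) = a := by
    have h1 : star (Z' : Mat K A) * star (↑Z'⁻¹ : Mat K A) = 1 := by
      rw [← star_mul, Units.inv_mul, star_one]
    rw [mul_assoc, mul_assoc _ (star _), h1, mul_one, Units.inv_mul_cancel_left]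
  rw [h7, mul_smul_comm, smul_mul_assoc] at h6
  exact ⟨_, _, Z'⁻¹.isUnit, h6⟩

/-- A bounded sequence in the Cuntz semigroup, increasing in a strong sense, has a supremum. -/
theorem exists_sup (hsr : StableRankOne A) (K : ℕ) (b : ℕ → MInftyPos A) (δ : ℕ → ℝ)
    (hδ : ∀ n, 0 < δ n) (hb : ∀ n, CuntzLE (b n) ((b (n + 1)).cutDown (δ (n + 1))))
    (hK : ∀ n, CuntzLE (b n) (oneMat A K)) :
    ∃ (a : Mat K A) (ha : 0 ≤ a) (s : ℕ → Mat K A) (hs : ∀ m, 0 ≤ s m),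
      Tendsto s atTop (𝓝 a) ∧ ∀ τ : tracialStates A,
        (∀ n, dTrace τ ((b n).cutDown (δ n)) ≤ dTrace τ ⟨K, a, ha⟩) ∧
        ∀ m, dTrace τ ⟨K, s m, hs m⟩ ≤ dTrace τ ((b m).cutDown (δ m)) := by
  choose N hbN hKN a Z Y ha hZY hYZ hpad using fun n => exists_moved hsr (b n) (hδ n) (hK n)
  have hle : ∀ n, CuntzLE ((b n).cutDown (δ n)) ⟨K, a n, ha n⟩ := fun n => by
    refine CuntzLE.of_eq_conj (N := N n) (hbN n) (hKN n) (Y n) ?_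
    rw [hpad n]
    have h1 : star (Z n) * star (Y n) = 1 := by rw [← star_mul, hYZ, star_one]
    rw [mul_assoc, mul_assoc (Z n * _), h1, mul_one, ← mul_assoc, hYZ, one_mul]
  have hge : ∀ n, CuntzLE ⟨K, a n, ha n⟩ ((b n).cutDown (δ n)) := fun n =>
    CuntzLE.of_eq_conj (N := N n) (hKN n) (hbN n) (Z n) (hpad n)
  -- The link consumes b_n ≾ (b_{n+1} - δ_{n+1})₊ ≾ a_{n+1}: passing from b_n to its cut-down a_n
  -- supplies the room in which an invertible conjugator exists.
  have hlink : ∀ n, ∃ (c : ℝ≥0) (R : Mat K A), IsUnit R ∧ a n ≤ c • (R * a (n + 1) * star R) :=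
    fun n => exists_link hsr (b n) (hδ n) (hbN n) (hKN n) (ha n)
    (ha (n + 1)) (hZY n) (hYZ n) (hpad n) ((hb n).trans (hle (n + 1)))
  choose c R hR hcR using hlink
  obtain ⟨x, s, hx, hs, hsx, h⟩ := exists_limit_of_chain a ha c R hR hcR
  have hd : ∀ (τ : tracialStates A) (y : Mat K A) (hy : 0 ≤ y),
      dTrace τ ⟨K, y, hy⟩ = dimLim (traceExt (τ : WeakDual ℂ A) K) y := fun _ _ _ => rfl
  refine ⟨x, hx, s, hs, hsx, fun τ => ?_⟩
  obtain ⟨h1, h2⟩ := h _ (isPosTrace_traceExt τ.2 K)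
  refine ⟨fun n => (dTrace_le τ (hle n)).trans ?_, fun m => le_trans ?_ (dTrace_le τ (hge m))⟩
  · rw [hd, hd]; exact h1 n
  · rw [hd, hd]; exact h2 m

/-- A supremum of elements of strictly smaller rank is not equivalent to a projection. -/
theorem isPurelyPositive_of_tendsto (τ : tracialStates A) {K : ℕ} {a : Mat K A} (ha : 0 ≤ a)
    {s : ℕ → Mat K A} (hs : ∀ m, 0 ≤ s m) (hsa : Tendsto s atTop (𝓝 a))
    (hlt : ∀ m, dTrace τ ⟨K, s m, hs m⟩ < dTrace τ ⟨K, a, ha⟩) :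
    IsPurelyPositive (⟨K, a, ha⟩ : MInftyPos A) := by
  rintro p hp ⟨hap, hpa⟩
  obtain ⟨N, hKN, hpN⟩ : ∃ N, K ≤ N ∧ p.size ≤ N := ⟨max K p.size, by simp, by simp⟩
  -- For a projection p, one v with error below 1 already bounds the rank of p. This condition is
  -- open in a, so it survives replacing a by some s_m.
  obtain ⟨v, hv⟩ := hpa.exists_of_le (N := N) hpN hKN zero_lt_one
  have hcont : Continuous fun x : Mat K A => v * pad N x * star v - pad N p.mat := by
    have : Continuous (padHom hKN : Mat K A →⋆ₙₐ[ℂ] Mat N A) := map_continuous _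
    exact ((continuous_const.mul this).mul continuous_const).sub continuous_const
  have hlim := ((hcont.tendsto a).comp hsa).norm
  obtain ⟨m, hm⟩ := (hlim.eventually (gt_mem_nhds hv)).exists
  have hpp : IsStarProjection (pad N p.mat) := hp.map (padHom hpN)
  have hs0 : 0 ≤ pad N (s m) := pad_nonneg hKN (hs m)
  have hφ := isPosTrace_traceExt τ.2 N
  have h1 := hφ.dimLim_projection_le hpp (star_right_conjugate_nonneg hs0 v) hm
  have h2 := hφ.dimLim_conj_le hs0 v
  have h3 : dTrace τ p ≤ dTrace τ ⟨K, s m, hs m⟩ := by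
    rw [dTrace_eq_pad τ p hpN, dTrace_eq_pad τ ⟨K, s m, hs m⟩ hKN]
    exact h1.trans h2
  exact absurd ((dTrace_le τ hap).trans h3) (not_le.2 (hlt m))

end Assembly

/-! ### Compactness of T(A) and interpolation below an affine function -/

section TracialStates

variable {A : Type u} [CStarAlgebra A]

section Basic

variable [PartialOrder A] [StarOrderedRing A]

theorem tracialStates_nonneg {τ : WeakDual ℂ A} (hτ : τ ∈ tracialStates A) {a : A} (ha : 0 ≤ a) :
    0 ≤ τ a := by
  obtain ⟨x, rfl⟩ := CStarAlgebra.nonneg_iff_eq_star_mul_self.1 ha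
  exact hτ.1 x

theorem tracialStates_im {τ : WeakDual ℂ A} (hτ : τ ∈ tracialStates A) {a : A}
    (ha : IsSelfAdjoint a) : (τ a).im = 0 := by
  rw [← CFC.posPart_sub_negPart a, map_sub, Complex.sub_im]
  have h1 := (Complex.le_def.1 (tracialStates_nonneg hτ (CFC.posPart_nonneg a))).2
  have h2 := (Complex.le_def.1 (tracialStates_nonneg hτ (CFC.negPart_nonneg a))).2
  simp only [Complex.zero_im] at h1 h2
  rw [← h1, ← h2, sub_zero]

theorem tracialStates_eq_re {τ : WeakDual ℂ A} (hτ : τ ∈ tracialStates A) {a : A}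
    (ha : IsSelfAdjoint a) : τ a = ((τ a).re : ℂ) :=
  Complex.ext rfl (by simp [tracialStates_im hτ ha])

theorem tracialStates_re_mono {τ : WeakDual ℂ A} (hτ : τ ∈ tracialStates A) {a b : A}
    (hab : a ≤ b) : (τ a).re ≤ (τ b).re := by
  have := (Complex.le_def.1 (tracialStates_nonneg hτ (sub_nonneg.2 hab))).1
  rw [map_sub, Complex.sub_re, Complex.zero_re] at this
  linarith

theorem tracialStates_algebraMap {τ : WeakDual ℂ A} (hτ : τ ∈ tracialStates A) (r : ℝ) :
    τ (algebraMap ℝ A r) = r := by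
  rw [Algebra.algebraMap_eq_smul_one, ← Complex.coe_smul, map_smul, hτ.2.1, smul_eq_mul, mul_one]

theorem tracialStates_abs_re_le {τ : WeakDual ℂ A} (hτ : τ ∈ tracialStates A) {a : A}
    (ha : IsSelfAdjoint a) : |(τ a).re| ≤ ‖a‖ := by
  rw [abs_le]
  have h1 := tracialStates_re_mono hτ (neg_algebraMap_le_of_norm_le ha le_rfl)
  have h2 := tracialStates_re_mono hτ (le_algebraMap_of_norm_le ha le_rfl)
  rw [map_neg, tracialStates_algebraMap hτ, Complex.neg_re, Complex.ofReal_re] at h1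
  rw [tracialStates_algebraMap hτ, Complex.ofReal_re] at h2
  exact ⟨h1, h2⟩

theorem tracialStates_norm_le {τ : WeakDual ℂ A} (hτ : τ ∈ tracialStates A) (a : A) :
    ‖τ a‖ ≤ 2 * ‖a‖ := by
  have e1 : τ a = τ (realPart a : A) + Complex.I * τ (imaginaryPart a : A) := by
    conv_lhs => rw [← realPart_add_I_smul_imaginaryPart a]
    rw [map_add, map_smul, smul_eq_mul]
  have key : ∀ x : A, IsSelfAdjoint x → ‖x‖ ≤ ‖a‖ → ‖τ x‖ ≤ ‖a‖ := fun x hx hxa => by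
    rw [tracialStates_eq_re hτ hx, Complex.norm_real]
    exact (tracialStates_abs_re_le hτ hx).trans hxa
  have h1 := key _ (realPart a).2 (realPart.norm_le a)
  have h2 := key _ (imaginaryPart a).2 (imaginaryPart.norm_le a)
  rw [e1]
  refine (norm_add_le _ _).trans ?_
  rw [norm_mul, Complex.norm_I]
  linarith

theorem isClosed_tracialStates : IsClosed (tracialStates A) := by
  have hc : ∀ a : A, Continuous fun τ : WeakDual ℂ A => τ a := WeakDual.eval_continuous
  have : tracialStates A = (⋂ a : A, {τ | 0 ≤ τ (star a * a)}) ∩ {τ | τ 1 = 1} ∩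
      ⋂ a : A, ⋂ b : A, {τ | τ (a * b) = τ (b * a)} := by
    ext τ; simp [tracialStates, and_assoc]
  rw [this]
  refine ((isClosed_iInter fun a => ?_).inter (isClosed_eq (hc 1) continuous_const)).inter
    (isClosed_iInter fun a => isClosed_iInter fun b => isClosed_eq (hc _) (hc _))
  exact isClosed_le continuous_const (hc _)

theorem isCompact_tracialStates : IsCompact (tracialStates A) := by
  refine WeakDual.isCompact_of_bounded_of_closed ?_ isClosed_tracialStates
  refine (WeakDual.isBounded_closedBall (0 : StrongDual ℂ A) 2).subset fun τ hτ => ?_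
  rw [Set.mem_preimage, mem_closedBall_zero_iff]
  exact ContinuousLinearMap.opNorm_le_bound _ zero_le_two fun a => tracialStates_norm_le hτ a

instance : CompactSpace (tracialStates A) := isCompact_iff_compactSpace.1 isCompact_tracialStates

theorem continuous_tracialStates_re (c : A) :
    Continuous fun τ : tracialStates A => ((τ : WeakDual ℂ A) c).re :=
  Complex.continuous_re.comp ((WeakDual.eval_continuous c).comp continuous_subtype_val)

theorem tracialStates_combination_mem {τ₁ τ₂ : WeakDual ℂ A} (h₁ : τ₁ ∈ tracialStates A)
    (h₂ : τ₂ ∈ tracialStates A) {s t : ℝ} (hs : 0 ≤ s) (ht : 0 ≤ t) (hst : s + t = 1) :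
    (s : ℂ) • τ₁ + (t : ℂ) • τ₂ ∈ tracialStates A := by
  have e : ∀ a, ((s : ℂ) • τ₁ + (t : ℂ) • τ₂) a = s * τ₁ a + t * τ₂ a := fun a => rfl
  refine ⟨fun a => ?_, ?_, fun a b => ?_⟩
  · rw [e]
    exact add_nonneg (mul_nonneg (by exact_mod_cast hs) (h₁.1 a))
      (mul_nonneg (by exact_mod_cast ht) (h₂.1 a))
  · rw [e, h₁.2.1, h₂.2.1, mul_one, mul_one]; exact_mod_cast hst
  · rw [e, e, h₁.2.2, h₂.2.2]

end Basic

section Separation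

/-- Convexity uses real scalars on the dual, `LAffPos` complex ones. -/
theorem weakDual_real_smul (r : ℝ) (φ : WeakDual ℂ A) : r • φ = (r : ℂ) • φ :=
  DFunLike.ext _ _ fun a => (Complex.coe_smul r (φ a)).symm

instance : IsScalarTower ℝ ℂ (WeakDual ℂ A) where
  smul_assoc x y φ := by
    rw [weakDual_real_smul, smul_smul]; rfl

instance : LocallyConvexSpace ℝ (WeakDual ℂ A) :=
  (WeakDual.withSeminorms (𝕜 := ℂ) (E := A)).toLocallyConvexSpace

instance : ContinuousSMul ℝ (WeakDual ℂ A) := WeakDual.instContinuousSMul ℝ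


/-- Weak-* continuous functionals are evaluations; this is how a separating hyperplane becomes an
element of A. -/
theorem exists_eval_eq (f : StrongDual ℂ (WeakDual ℂ A)) : ∃ a : A, ∀ τ, f τ = τ a := by
  obtain ⟨a, ha⟩ := LinearMap.dualEmbedding_surjective (topDualPairing ℂ A) f
  exact ⟨a, fun τ => by rw [← ha]; rfl⟩

/-- A continuous image of s × t × [0, 1]. -/
theorem IsCompact.convexJoin' {E : Type*} [AddCommGroup E] [Module ℝ E] [TopologicalSpace E]
    [ContinuousAdd E] [ContinuousSMul ℝ E] {s t : Set E} (hs : IsCompact s) (ht : IsCompact t) :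
    IsCompact (convexJoin ℝ s t) := by
  have : convexJoin ℝ s t = (fun q : (E × E) × ℝ => (1 - q.2) • q.1.1 + q.2 • q.1.2) ''
      ((s ×ˢ t) ×ˢ Set.Icc (0 : ℝ) 1) := by
    ext x
    simp only [mem_convexJoin, segment_eq_image, Set.mem_image, Set.mem_prod, Prod.exists]
    constructor
    · rintro ⟨a, ha, b, hb, θ, hθ, rfl⟩
      exact ⟨a, b, θ, ⟨⟨ha, hb⟩, hθ⟩, rfl⟩
    · rintro ⟨a, b, θ, ⟨⟨ha, hb⟩, hθ⟩, rfl⟩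
      exact ⟨a, ha, b, hb, θ, hθ, rfl⟩
  rw [this]
  exact ((hs.prod ht).prod isCompact_Icc).image (by fun_prop)

theorem exists_separating_convexJoin {E : Type*} [AddCommGroup E] [Module ℝ E] [Module ℂ E]
    [IsScalarTower ℝ ℂ E] [TopologicalSpace E] [IsTopologicalAddGroup E] [ContinuousSMul ℝ E]
    [ContinuousSMul ℂ E] [LocallyConvexSpace ℝ E] {s₁ s₂ t : Set (E × ℂ)} (h₁ : IsCompact s₁)
    (h₂ : IsCompact s₂) (hc₁ : Convex ℝ s₁) (hc₂ : Convex ℝ s₂) (ht : Convex ℝ t)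
    (ht' : IsClosed t) (hd : Disjoint (convexJoin ℝ s₁ s₂) t) :
    ∃ (f : StrongDual ℂ (E × ℂ)) (u v : ℝ), (∀ a ∈ convexJoin ℝ s₁ s₂, (f a).re < u) ∧ u < v ∧
      ∀ b ∈ t, v < (f b).re :=
  RCLike.geometric_hahn_banach_compact_closed (𝕜 := ℂ) (hc₁.convexJoin hc₂)
    (IsCompact.convexJoin' h₁ h₂) ht ht' hd

variable [PartialOrder A] [StarOrderedRing A]

/-- Strict hypograph of `f` in `WeakDual ℂ A × ℂ`. -/
def strictHypograph (f : tracialStates A → ℝ) : Set (WeakDual ℂ A × ℂ) :=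
  {q | ∃ (τ : tracialStates A) (s : ℝ), s < f τ ∧ q = (↑τ, ↑s)}

/-- Interpolation: two compact convex sets below a lower semicontinuous affine function lie
below a continuous affine function which is still below it. -/
theorem exists_selfAdjoint_between {f : tracialStates A → ℝ} (hf : f ∈ LAffPos A)
    {K₁ K₂ : Set (WeakDual ℂ A × ℂ)} (h₁ : IsCompact K₁) (h₂ : IsCompact K₂)
    (hc₁ : Convex ℝ K₁) (hc₂ : Convex ℝ K₂) (hn₁ : K₁.Nonempty) (hn₂ : K₂.Nonempty)
    (hK₁ : K₁ ⊆ strictHypograph f) (hK₂ : K₂ ⊆ strictHypograph f) :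
    ∃ c : A, IsSelfAdjoint c ∧ (∀ τ : tracialStates A, ((τ : WeakDual ℂ A) c).re < f τ) ∧
      ∀ (τ : tracialStates A) (s : ℝ), ((τ : WeakDual ℂ A), (s : ℂ)) ∈ K₁ ∪ K₂ →
        s < ((τ : WeakDual ℂ A) c).re := by
  obtain ⟨-, -, hlsc, haff⟩ := hf
  -- The epigraph is closed by lower semicontinuity and convex by affinity. The join of K₁ and K₂
  -- stays strictly below it, so the two can be separated.
  set epi : Set (WeakDual ℂ A × ℂ) :=
    {q | ∃ (τ : tracialStates A) (s : ℝ), f τ ≤ s ∧ q = (↑τ, ↑s)} with hepi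
  have hepi_closed : IsClosed epi := by
    have hemb : Topology.IsClosedEmbedding
        (Prod.map Subtype.val Complex.ofReal : tracialStates A × ℝ → WeakDual ℂ A × ℂ) :=
      (isClosed_tracialStates.isClosedEmbedding_subtypeVal).prodMap
        Complex.isometry_ofReal.isClosedEmbedding
    have := hemb.isClosedMap _ hlsc.isClosed_epigraph
    convert this using 1
    ext q
    constructor
    · rintro ⟨τ, s, h, rfl⟩; exact ⟨(τ, s), h, rfl⟩
    · rintro ⟨⟨τ, s⟩, h, rfl⟩; exact ⟨τ, s, h, rfl⟩
  have hcomb : ∀ (τ₁ τ₂ : tracialStates A) (s₁ s₂ a b : ℝ), 0 ≤ a → 0 ≤ b → a + b = 1 →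
      ∃ τ : tracialStates A, a • ((τ₁ : WeakDual ℂ A), (s₁ : ℂ)) + b • ((τ₂ : WeakDual ℂ A), (s₂ : ℂ))
        = ((τ : WeakDual ℂ A), ((a * s₁ + b * s₂ : ℝ) : ℂ)) ∧ f τ = a * f τ₁ + b * f τ₂ := by
    intro τ₁ τ₂ s₁ s₂ a b ha hb hab
    refine ⟨⟨_, tracialStates_combination_mem τ₁.2 τ₂.2 ha hb hab⟩, ?_,
      haff τ₁ τ₂ _ a b ha hb hab rfl⟩
    ext1
    · simp [weakDual_real_smul]
    · simp
  have hepi_convex : Convex ℝ epi := by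
    rintro _ ⟨τ₁, s₁, h1, rfl⟩ _ ⟨τ₂, s₂, h2, rfl⟩ a b ha hb hab
    obtain ⟨τ, e1, e2⟩ := hcomb τ₁ τ₂ s₁ s₂ a b ha hb hab
    refine ⟨τ, _, ?_, e1⟩
    rw [e2]; gcongr
  have hdisj : Disjoint (convexJoin ℝ K₁ K₂) epi := by
    rw [Set.disjoint_left]
    rintro q hq ⟨σ, r, hr, rfl⟩
    obtain ⟨q₁, hq₁, q₂, hq₂, a, b, ha, hb, hab, hq⟩ := mem_convexJoin.1 hq
    obtain ⟨τ₁, s₁, h1, rfl⟩ := hK₁ hq₁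
    obtain ⟨τ₂, s₂, h2, rfl⟩ := hK₂ hq₂
    obtain ⟨τ, e1, e2⟩ := hcomb τ₁ τ₂ s₁ s₂ a b ha hb hab
    rw [e1, Prod.mk.injEq] at hq
    obtain ⟨hq1, hq2⟩ := hq
    have hστ : τ = σ := Subtype.ext hq1
    have hs : a * s₁ + b * s₂ = r := by exact_mod_cast hq2
    subst hστ
    have : a * s₁ + b * s₂ < a * f τ₁ + b * f τ₂ := by
      -- If a = 0 the strict inequality has to come from the second point, where b = 1.
      rcases ha.eq_or_lt with rfl | ha'
      · have hb1 : b = 1 := by linarith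
        subst hb1; linarith
      · have := mul_lt_mul_of_pos_left h1 ha'
        have := mul_le_mul_of_nonneg_left h2.le hb
        linarith
    linarith
  have separate := exists_separating_convexJoin (E := WeakDual ℂ A) (s₁ := K₁) (s₂ := K₂) (t := epi)
  obtain ⟨F, u, v, hFu, huv, hFv⟩ := separate h₁ h₂ hc₁ hc₂ hepi_convex hepi_closed hdisj
  obtain ⟨a, ha⟩ := exists_eval_eq (F.comp (ContinuousLinearMap.inl ℂ (WeakDual ℂ A) ℂ))
  set β : ℝ := (F (0, 1)).re with hβ
  have hF : ∀ (τ : WeakDual ℂ A) (s : ℝ), (F (τ, (s : ℂ))).re = (τ a).re + s * β := by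
    intro τ s
    have e : (τ, (s : ℂ)) = (τ, (0 : ℂ)) + (s : ℂ) • ((0 : WeakDual ℂ A), (1 : ℂ)) := by
      ext1 <;> simp
    rw [e, map_add, map_smul, ← ha]
    simp [hβ]
  have hsub : K₁ ∪ K₂ ⊆ convexJoin ℝ K₁ K₂ :=
    Set.union_subset (subset_convexJoin_left hn₂) (subset_convexJoin_right hn₁)
  -- F increases along the vertical segment from a point of K₁ up to the graph of f.
  have hβ0 : 0 < β := by
    obtain ⟨q, hq⟩ := hn₁
    obtain ⟨τ, s, hs, rfl⟩ := hK₁ hq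
    have h1 := hFu _ (hsub (Or.inl hq))
    have h2 := hFv _ (⟨τ, f τ, le_rfl, rfl⟩ : ((τ : WeakDual ℂ A), ((f τ : ℝ) : ℂ)) ∈ epi)
    rw [hF] at h1 h2
    by_contra h
    nlinarith [not_lt.1 h]
  -- c solves Re F(τ, c(τ)) = u, so the separating hyperplane is the graph of c over T(A).
  set c : A := algebraMap ℝ A (u / β) - β⁻¹ • (realPart a : A) with hc
  have hcτ : ∀ τ : tracialStates A,
      ((τ : WeakDual ℂ A) c).re = (u - ((τ : WeakDual ℂ A) a).re) / β := by
    intro τ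
    have e1 : ((τ : WeakDual ℂ A) (realPart a : A)).re = ((τ : WeakDual ℂ A) a).re := by
      have h2 := tracialStates_im τ.2 (imaginaryPart a).2
      conv_rhs => rw [← realPart_add_I_smul_imaginaryPart a]
      rw [map_add, map_smul, smul_eq_mul]
      simp [h2]
    rw [hc, map_sub, tracialStates_algebraMap τ.2, ← Complex.coe_smul, map_smul, Complex.sub_re,
      smul_eq_mul, Complex.re_ofReal_mul, e1, Complex.ofReal_re]
    field_simp
  refine ⟨c, (IsSelfAdjoint.algebraMap _ (.all _)).sub (IsSelfAdjoint.smul (.all _) (realPart a).2), fun τ => ?_,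
    fun τ s hs => ?_⟩
  · have h2 := hFv _ (⟨τ, f τ, le_rfl, rfl⟩ : ((τ : WeakDual ℂ A), ((f τ : ℝ) : ℂ)) ∈ epi)
    rw [hF] at h2
    rw [hcτ, div_lt_iff₀ hβ0]
    linarith
  · have h1 := hFu _ (hsub hs)
    rw [hF] at h1
    rw [hcτ, lt_div_iff₀ hβ0]
    linarith

theorem isCompact_graph (c : A) : IsCompact (Set.range fun τ : tracialStates A =>
    ((τ : WeakDual ℂ A), ((((τ : WeakDual ℂ A) c).re : ℝ) : ℂ))) :=
  isCompact_range (continuous_subtype_val.prodMk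
    (Complex.continuous_ofReal.comp (continuous_tracialStates_re c)))

theorem convex_graph (c : A) : Convex ℝ (Set.range fun τ : tracialStates A =>
    ((τ : WeakDual ℂ A), ((((τ : WeakDual ℂ A) c).re : ℝ) : ℂ))) := by
  rintro _ ⟨τ₁, rfl⟩ _ ⟨τ₂, rfl⟩ a b ha hb hab
  refine ⟨⟨_, tracialStates_combination_mem τ₁.2 τ₂.2 ha hb hab⟩, ?_⟩
  ext1
  · simp [weakDual_real_smul]
  · have e : ((a : ℂ) • (τ₁ : WeakDual ℂ A) + (b : ℂ) • (τ₂ : WeakDual ℂ A)) c =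
      a * (τ₁ : WeakDual ℂ A) c + b * (τ₂ : WeakDual ℂ A) c := rfl
    refine (congrArg (fun z : ℂ => ((z.re : ℝ) : ℂ)) e).trans ?_
    simp

theorem nonempty_graph [Nonempty (tracialStates A)] (c : A) :
    (Set.range fun τ : tracialStates A =>
      ((τ : WeakDual ℂ A), ((((τ : WeakDual ℂ A) c).re : ℝ) : ℂ))).Nonempty :=
  Set.range_nonempty _

theorem graph_subset {f : tracialStates A → ℝ} {c : A}
    (hc : ∀ τ : tracialStates A, ((τ : WeakDual ℂ A) c).re < f τ) :
    (Set.range fun τ : tracialStates A =>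
      ((τ : WeakDual ℂ A), ((((τ : WeakDual ℂ A) c).re : ℝ) : ℂ))) ⊆ strictHypograph f := by
  rintro _ ⟨τ, rfl⟩
  exact ⟨τ, _, hc τ, rfl⟩

/-- Interpolation with the graph of c as one of the two compact sets. -/
theorem exists_selfAdjoint_above {f : tracialStates A → ℝ} (hf : f ∈ LAffPos A)
    [Nonempty (tracialStates A)] {K : Set (WeakDual ℂ A × ℂ)} (hK : IsCompact K)
    (hKc : Convex ℝ K) (hKn : K.Nonempty) (hKf : K ⊆ strictHypograph f) {c : A}
    (hc : ∀ τ : tracialStates A, ((τ : WeakDual ℂ A) c).re < f τ) :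
    ∃ c' : A, IsSelfAdjoint c' ∧ (∀ τ : tracialStates A, ((τ : WeakDual ℂ A) c').re < f τ) ∧
      (∀ τ : tracialStates A, ((τ : WeakDual ℂ A) c).re < ((τ : WeakDual ℂ A) c').re) ∧
      ∀ (τ : tracialStates A) (s : ℝ), ((τ : WeakDual ℂ A), (s : ℂ)) ∈ K →
        s < ((τ : WeakDual ℂ A) c').re := by
  obtain ⟨c', h1, h2, h3⟩ := exists_selfAdjoint_between hf (isCompact_graph c) hK
    (convex_graph c) hKc (nonempty_graph c) hKn (graph_subset hc) hKf
  exact ⟨c', h1, h2, fun τ => h3 τ _ (Or.inl ⟨τ, rfl⟩), fun τ s hs => h3 τ s (Or.inr hs)⟩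

theorem exists_selfAdjoint_above_at {f : tracialStates A → ℝ} (hf : f ∈ LAffPos A)
    [Nonempty (tracialStates A)] {τ : tracialStates A} {r : ℝ} (hr : r < f τ) {c : A}
    (hc : ∀ τ : tracialStates A, ((τ : WeakDual ℂ A) c).re < f τ) :
    ∃ c' : A, (∀ τ : tracialStates A, ((τ : WeakDual ℂ A) c').re < f τ) ∧
      r < ((τ : WeakDual ℂ A) c').re := by
  have hmem : ((τ : WeakDual ℂ A), (r : ℂ)) ∈ strictHypograph f := ⟨τ, r, hr, rfl⟩
  generalize hq : ((τ : WeakDual ℂ A), (r : ℂ)) = q at hmem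
  have h1 : IsCompact {q} := isCompact_singleton
  have h2 : Convex ℝ {q} := by
    rintro x hx y hy a b - - hab
    rw [Set.mem_singleton_iff] at hx hy
    subst hx hy
    have hab' : (a : ℂ) + b = 1 := by exact_mod_cast hab
    rw [Set.mem_singleton_iff]
    ext1
    · simp only [Prod.fst_add, Prod.smul_fst, weakDual_real_smul, ← add_smul, hab', one_smul]
    · simp [← add_mul, hab']
  have h3 : ({q} : Set (WeakDual ℂ A × ℂ)).Nonempty := Set.singleton_nonempty q
  have h4 : {q} ⊆ strictHypograph f := Set.singleton_subset_iff.2 hmem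
  obtain ⟨c', h5, h6, -, h7⟩ := exists_selfAdjoint_above hf h1 h2 h3 h4 hc
  exact ⟨c', h6, h7 τ r hq⟩

/-- The recursion climbs over every member of a countable dense subset of A that lies below f. By
Hahn–Banach and density these members alone come arbitrarily close to f at each trace. -/
theorem exists_increasing_selfAdjoint [TopologicalSpace.SeparableSpace A]
    [Nonempty (tracialStates A)] {f : tracialStates A → ℝ} (hf : f ∈ LAffPos A) :
    ∃ c : ℕ → A, (∀ n, IsSelfAdjoint (c n)) ∧
      (∀ τ : tracialStates A, 0 < ((τ : WeakDual ℂ A) (c 0)).re) ∧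
      (∀ n (τ : tracialStates A), ((τ : WeakDual ℂ A) (c n)).re < ((τ : WeakDual ℂ A) (c (n + 1))).re) ∧
      (∀ n (τ : tracialStates A), ((τ : WeakDual ℂ A) (c n)).re < f τ) ∧
      ∀ (τ : tracialStates A) (r : ℝ), r < f τ → ∃ n, r < ((τ : WeakDual ℂ A) (c n)).re := by
  classical
  obtain ⟨-, hpos, hlsc, -⟩ := id hf
  -- A lower semicontinuous function attains its minimum on the compact T(A), so being strictly
  -- below f means being below it by a uniform margin.
  have hmin : ∀ d : A, (∀ τ : tracialStates A, ((τ : WeakDual ℂ A) d).re < f τ) →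
      ∃ m > 0, ∀ τ : tracialStates A, ((τ : WeakDual ℂ A) d).re + m ≤ f τ := by
    intro d hd
    have hg : LowerSemicontinuous fun τ : tracialStates A => f τ + -((τ : WeakDual ℂ A) d).re :=
      hlsc.add (continuous_tracialStates_re d).neg.lowerSemicontinuous
    obtain ⟨τ₀, -, h⟩ := (hg.lowerSemicontinuousOn Set.univ).exists_isMinOn Set.univ_nonempty
      isCompact_univ
    refine ⟨f τ₀ + -((τ₀ : WeakDual ℂ A) d).re, by linarith [hd τ₀], fun τ => ?_⟩
    · have := h (Set.mem_univ τ)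
      simp only [Set.mem_ofPred_eq] at this
      linarith
  obtain ⟨m, hm, hmf⟩ := hmin 0 (by simpa using hpos)
  obtain ⟨c₀, hc₀⟩ : ∃ c₀, c₀ = algebraMap ℝ A (m / 2) := ⟨_, rfl⟩
  have hc₀s : IsSelfAdjoint c₀ := hc₀ ▸ IsSelfAdjoint.algebraMap _ (.all _)
  have hc₀τ : ∀ τ : tracialStates A, ((τ : WeakDual ℂ A) c₀).re = m / 2 := fun τ => by
    rw [hc₀, tracialStates_algebraMap τ.2, Complex.ofReal_re]
  have hc₀f : ∀ τ : tracialStates A, ((τ : WeakDual ℂ A) c₀).re < f τ := fun τ => by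
    have := hmf τ
    rw [hc₀τ]
    simp only [map_zero, Complex.zero_re] at this
    linarith
  set d : ℕ → A := TopologicalSpace.denseSeq A
  -- Dense elements that are not below f are replaced by the harmless constant c₀.
  set g : ℕ → A := fun n => if ∀ τ : tracialStates A, ((τ : WeakDual ℂ A) (d n)).re < f τ then d n
    else c₀ with hg
  have hgf : ∀ n (τ : tracialStates A), ((τ : WeakDual ℂ A) (g n)).re < f τ := by
    intro n
    rw [hg]
    dsimp only
    split_ifs with h
    exacts [h, hc₀f]
  let C := {c : A // IsSelfAdjoint c ∧ ∀ τ : tracialStates A, ((τ : WeakDual ℂ A) c).re < f τ}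
  have step : ∀ (n : ℕ) (c : C), ∃ c' : C,
      (∀ τ : tracialStates A, ((τ : WeakDual ℂ A) c.1).re < ((τ : WeakDual ℂ A) c'.1).re) ∧
      ∀ τ : tracialStates A, ((τ : WeakDual ℂ A) (g n)).re < ((τ : WeakDual ℂ A) c'.1).re := by
    rintro n ⟨c, hc, hcf⟩
    obtain ⟨c', h1, h2, h3, h4⟩ := exists_selfAdjoint_above hf (isCompact_graph (g n))
      (convex_graph (g n)) (nonempty_graph (g n)) (graph_subset (hgf n)) hcf
    exact ⟨⟨c', h1, h2⟩, h3, fun τ => h4 τ _ ⟨τ, rfl⟩⟩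
  choose next h₁ h₂ using step
  let c : ℕ → C := fun n => Nat.rec ⟨c₀, hc₀s, hc₀f⟩ next n
  refine ⟨fun n => (c n).1, fun n => (c n).2.1, fun τ => ?_, fun n τ => h₁ n (c n) τ,
    fun n => (c n).2.2, fun τ r hr => ?_⟩
  · change 0 < ((τ : WeakDual ℂ A) c₀).re
    rw [hc₀τ]; linarith
  · have hmem : ((τ : WeakDual ℂ A), (r : ℂ)) ∈ strictHypograph f := ⟨τ, r, hr, rfl⟩
    obtain ⟨c', h2, hrc⟩ := exists_selfAdjoint_above_at hf hr hc₀f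
    obtain ⟨ε, hε, hεf⟩ := hmin c' h2
    -- Moving c' by less than η on traces keeps it below f and above r at τ. Since traces are only
    -- bounded by twice the norm, the approximation is taken within η/2.
    set η := min ε (((τ : WeakDual ℂ A) c').re - r) / 2 with hη
    have hη0 : 0 < η := half_pos (lt_min hε (by linarith))
    obtain ⟨n, hn⟩ := (TopologicalSpace.denseRange_denseSeq A).exists_dist_lt c' (half_pos hη0)
    have hdist : ∀ σ : tracialStates A,
        |((σ : WeakDual ℂ A) c').re - ((σ : WeakDual ℂ A) (d n)).re| < η := by
      intro σ
      rw [← Complex.sub_re, ← map_sub]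
      have h1 := Complex.abs_re_le_norm ((σ : WeakDual ℂ A) (c' - d n))
      have h2 := tracialStates_norm_le σ.2 (c' - d n)
      have h3 : ‖c' - d n‖ < η / 2 := by rwa [← dist_eq_norm]
      linarith
    have hη1 : η < ε := by
      have := min_le_left ε (((τ : WeakDual ℂ A) c').re - r); linarith
    have hη2 : η < ((τ : WeakDual ℂ A) c').re - r := by
      have := min_le_right ε (((τ : WeakDual ℂ A) c').re - r); linarith
    have hd : ∀ σ : tracialStates A, ((σ : WeakDual ℂ A) (d n)).re < f σ := fun σ => by
      have h1 := (abs_lt.1 (hdist σ)).1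
      have h2 := hεf σ
      linarith
    refine ⟨n + 1, lt_of_lt_of_le (b := ((τ : WeakDual ℂ A) (g n)).re) ?_ ?_⟩
    · have : g n = d n := if_pos hd
      rw [this]
      have h1 := (abs_lt.1 (hdist τ)).2
      linarith
    · exact (h₂ n (c n) τ).le

end Separation

end TracialStates

/-! ### Compression of operators to finite frames -/

section Compression

theorem Mat.continuous_iff {n : ℕ} {X : Type*} [TopologicalSpace X] {f : X → Mat n ℂ} :
    Continuous f ↔ ∀ i j, Continuous fun x => (f x).entry i j := by
  constructor
  · intro h i j
    exact (entryL (A := ℂ) n i j).continuous.comp h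
  · intro h
    exact continuous_pi fun i => continuous_pi fun j => h i j

@[simp] theorem Mat.entry_sum {A : Type u} [CStarAlgebra A] [PartialOrder A] [StarOrderedRing A]
    {n : ℕ} {ι : Type*} (s : Finset ι) (f : ι → Mat n A) (i j : Fin n) :
    (∑ k ∈ s, f k).entry i j = ∑ k ∈ s, (f k).entry i j :=
  map_sum (entryL n i j) f s

variable {H : Type*} [NormedAddCommGroup H] [InnerProductSpace ℂ H] [CompleteSpace H] {n : ℕ}

local notation "⟪" x ", " y "⟫" => inner ℂ x y

/-- The projection onto the span of an orthonormal family. -/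
def frameProj (e : Fin n → H) : H →L[ℂ] H := ∑ k, InnerProductSpace.rankOne ℂ (e k) (e k)

theorem frameProj_apply (e : Fin n → H) (x : H) : frameProj e x = ∑ k, ⟪e k, x⟫ • e k := by
  simp [frameProj]

/-- The matrix coefficients of an operator with respect to a family of vectors. -/
def compress (e : Fin n → H) : (H →L[ℂ] H) →ₗ[ℂ] Mat n ℂ where
  toFun T := Mat.of fun k l => ⟪e k, T (e l)⟫
  map_add' S T := by
    apply Mat.ext; intro i j
    simp [inner_add_right]
  map_smul' c T := by
    apply Mat.ext; intro i j
    simp [inner_smul_right]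

/-- The operator with given matrix coefficients with respect to a family of vectors. -/
def expand (e : Fin n → H) : Mat n ℂ →ₗ[ℂ] (H →L[ℂ] H) where
  toFun M := ∑ k, ∑ l, M.entry k l • InnerProductSpace.rankOne ℂ (e k) (e l)
  map_add' S T := by
    simp [add_smul, Finset.sum_add_distrib]
  map_smul' c T := by
    simp [Finset.smul_sum, mul_smul]

theorem compress_entry (e : Fin n → H) (T : H →L[ℂ] H) (k l : Fin n) :
    (compress e T).entry k l = ⟪e k, T (e l)⟫ := rfl

theorem expand_apply (e : Fin n → H) (M : Mat n ℂ) (x : H) :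
    expand e M x = ∑ k, ∑ l, (M.entry k l * ⟪e l, x⟫) • e k := by
  simp [expand, mul_smul]

theorem continuous_compress (e : Fin n → H) : Continuous (compress e) := by
  rw [Mat.continuous_iff]
  intro i j
  simp only [compress_entry]
  fun_prop

theorem continuous_expand (e : Fin n → H) : Continuous (expand e) := by
  change Continuous fun M : Mat n ℂ =>
    ∑ k, ∑ l, M.entry k l • InnerProductSpace.rankOne ℂ (e k) (e l)
  refine continuous_finsetSum _ fun k _ => continuous_finsetSum _ fun l _ => ?_
  exact ((entryL (A := ℂ) n k l).continuous).smul continuous_const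

theorem compress_star (e : Fin n → H) (T : H →L[ℂ] H) : compress e (star T) = star (compress e T) := by
  apply Mat.ext; intro i j
  rw [Mat.entry_star, compress_entry, compress_entry, ContinuousLinearMap.star_eq_adjoint,
    ContinuousLinearMap.adjoint_inner_right]
  exact (inner_conj_symm _ _).symm

theorem expand_star (e : Fin n → H) (M : Mat n ℂ) : expand e (star M) = star (expand e M) := by
  simp only [expand, LinearMap.coe_mk, AddHom.coe_mk, star_sum, star_smul, Mat.entry_star]
  rw [Finset.sum_comm]
  simp [ContinuousLinearMap.star_eq_adjoint]

variable {e : Fin n → H}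

theorem isStarProjection_frameProj (he : Orthonormal ℂ e) : IsStarProjection (frameProj e) := by
  constructor
  · ext1 x
    simp only [ContinuousLinearMap.mul_apply, frameProj_apply, map_sum]
    refine Finset.sum_congr rfl fun k _ => ?_
    simp [inner_smul_right, orthonormal_iff_ite.1 he]
  · rw [IsSelfAdjoint, frameProj, star_sum]
    simp [ContinuousLinearMap.star_eq_adjoint]

theorem compress_expand (he : Orthonormal ℂ e) (M : Mat n ℂ) : compress e (expand e M) = M := by
  apply Mat.ext; intro i j
  rw [compress_entry, expand_apply]
  simp only [inner_sum, inner_smul_right, orthonormal_iff_ite.1 he]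
  simp

theorem expand_compress (e : Fin n → H) (T : H →L[ℂ] H) :
    expand e (compress e T) = frameProj e * T * frameProj e := by
  ext1 x
  simp only [ContinuousLinearMap.mul_apply, expand_apply, frameProj_apply, compress_entry]
  refine Finset.sum_congr rfl fun k _ => ?_
  rw [map_sum, inner_sum, Finset.sum_smul]
  refine Finset.sum_congr rfl fun l _ => ?_
  rw [map_smul, inner_smul_right, mul_comm]

/-- With `compress_expand` and `expand_compress`, this identifies the corner cut out by the frame
projection of an orthonormal family with M_n(ℂ). -/
theorem compress_mul (e : Fin n → H) (S T : H →L[ℂ] H) :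
    compress e (S * frameProj e * T) = compress e S * compress e T := by
  apply Mat.ext; intro i j
  simp only [Mat.entry_mul, compress_entry, ContinuousLinearMap.mul_apply, frameProj_apply, map_sum,
    inner_sum, map_smul, inner_smul_right]
  exact Finset.sum_congr rfl fun k _ => mul_comm _ _

/-- A subspace of finite dimension is spanned by an orthonormal family. -/
theorem exists_frame (F : Submodule ℂ H) [FiniteDimensional ℂ F] :
    ∃ (n : ℕ) (e : Fin n → H), Orthonormal ℂ e ∧ ∀ x ∈ F, frameProj e x = x := by
  let b := stdOrthonormalBasis ℂ F
  refine ⟨_, fun k => (b k : H), b.orthonormal.comp_linearIsometry F.subtypeₗᵢ, fun x hx => ?_⟩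
  rw [frameProj_apply]
  have := congrArg (Subtype.val) (b.sum_repr' ⟨x, hx⟩)
  simpa using this

/-- A projection is the identity on its closed range, so compactness makes the unit ball of the
range compact, and Riesz's theorem applies. -/
theorem finiteDimensional_range_of_isCompactOperator {p : H →L[ℂ] H} (hp : IsStarProjection p)
    (hc : IsCompactOperator p) : FiniteDimensional ℂ (LinearMap.range (p : H →ₗ[ℂ] H)) := by
  have hfix : ∀ x ∈ LinearMap.range (p : H →ₗ[ℂ] H), p x = x := by
    rintro _ ⟨y, rfl⟩
    have := congrArg (fun T : H →L[ℂ] H => T y) hp.isIdempotentElem.eq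
    simpa using this
  have hclosed : IsClosed (LinearMap.range (p : H →ₗ[ℂ] H) : Set H) := by
    have : (LinearMap.range (p : H →ₗ[ℂ] H) : Set H) = {x | p x = x} := by
      ext x
      exact ⟨hfix x, fun h => ⟨x, h⟩⟩
    rw [this]
    exact isClosed_eq p.continuous continuous_id
  refine FiniteDimensional.of_isCompact_closedBall ℂ one_pos
    (c := (0 : LinearMap.range (p : H →ₗ[ℂ] H))) ?_
  rw [Subtype.isCompact_iff]
  have hcomp := hc.isCompact_closure_image_closedBall (f := (p : H →ₗ[ℂ] H)) 1
  refine hcomp.of_isClosed_subset ?_ ?_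
  · exact hclosed.isClosedEmbedding_subtypeVal.isClosedMap _ Metric.isClosed_closedBall
  · rintro _ ⟨x, hx, rfl⟩
    refine subset_closure ⟨x, ?_, hfix _ x.2⟩
    simpa using hx

/-- By compactness every p x is within 1 of one of finitely many p x₀; a frame for the sum of their
finite-dimensional ranges is fixed by each p x₀. -/
theorem exists_frame_approx {X : Type*} [TopologicalSpace X] [CompactSpace X]
    (p : C(X, H →L[ℂ] H)) (hp : IsStarProjection p) (hc : ∀ x, IsCompactOperator (p x)) :
    ∃ (n : ℕ) (e : Fin n → H), Orthonormal ℂ e ∧ ∀ x, ‖(1 - frameProj e) * p x‖ < 1 := by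
  classical
  have hpx : ∀ x, IsStarProjection (p x) := fun x =>
    ⟨congrArg (fun f : C(X, H →L[ℂ] H) => f x) hp.isIdempotentElem.eq,
      congrArg (fun f : C(X, H →L[ℂ] H) => f x) hp.isSelfAdjoint.star_eq⟩
  have hopen : ∀ x₀, IsOpen {x | ‖p x - p x₀‖ < 1} := fun x₀ =>
    isOpen_lt (by fun_prop) continuous_const
  obtain ⟨t, ht⟩ := isCompact_univ.elim_finite_subcover (fun x₀ => {x | ‖p x - p x₀‖ < 1}) hopen
    fun x _ => Set.mem_iUnion.2 ⟨x, by simp⟩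
  have := fun x => finiteDimensional_range_of_isCompactOperator (hpx x) (hc x)
  obtain ⟨n, e, he, hF⟩ := exists_frame (t.sup fun x => LinearMap.range (p x : H →ₗ[ℂ] H))
  refine ⟨n, e, he, fun x => ?_⟩
  obtain ⟨x₀, hx₀, hx⟩ := Set.mem_iUnion₂.1 (ht (Set.mem_univ x))
  have h1 : (1 - frameProj e) * p x = (1 - frameProj e) * (p x - p x₀) := by
    have : frameProj e * p x₀ = p x₀ := by
      ext1 y
      exact hF _ ((Finset.le_sup (f := fun x => LinearMap.range (p x : H →ₗ[ℂ] H)) hx₀) ⟨y, rfl⟩)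
    rw [mul_sub, sub_mul 1 _ (p x₀), this, one_mul, sub_self, sub_zero]
  rw [h1]
  have h2 : ‖1 - frameProj e‖ ≤ 1 := (isStarProjection_frameProj he).one_sub.norm_le
  calc _ ≤ ‖1 - frameProj e‖ * ‖p x - p x₀‖ := norm_mul_le _ _
    _ ≤ 1 * ‖p x - p x₀‖ := by gcongr
    _ < 1 := by rw [one_mul]; exact hx

end Compression

/-! ### Nearly dominated projections -/

section PartialIsometry

/-- A projection which is close to being dominated by `e` is Murray–von Neumann subequivalent to
`e`. -/
theorem exists_partialIsometry {B : Type*} [CStarAlgebra B] {p e : B} (hp : IsStarProjection p)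
    (he : IsStarProjection e) (h : ‖(1 - e) * p‖ < 1) : ∃ v : B, star v * v = p ∧ e * v = v := by
  have hps := hp.isSelfAdjoint.star_eq
  have hes := he.isSelfAdjoint.star_eq
  have hpp := hp.isIdempotentElem.eq
  have hee := he.isIdempotentElem.eq
  set d : B := p * (1 - e) * p with hd
  have hds : IsSelfAdjoint d := by
    rw [IsSelfAdjoint, hd]; simp [star_mul, hps, hes, mul_assoc]
  have hdn : ‖d‖ < 1 := by
    have : d = star ((1 - e) * p) * ((1 - e) * p) := by
      rw [star_mul, star_sub, star_one, hes, hps, hd]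
      simp only [mul_assoc]
      rw [← mul_assoc (1 - e) (1 - e) p, he.one_sub.isIdempotentElem.eq]
    rw [this, CStarRing.norm_star_mul_self]
    nlinarith [norm_nonneg ((1 - e) * p)]
  -- p e p = p(1 - d) with ‖d‖ < 1, so k = (1 - d)^(-1/2) normalises e p to a partial isometry v = e
  -- p k with v⋆v = p.
  set k : B := cfc (fun t : ℝ => (√(1 - t))⁻¹) d with hk
  have hlt : ∀ t ∈ spectrum ℝ d, 0 < 1 - t := by
    intro t ht
    have h1 := spectrum.norm_le_norm_mul_of_mem ht
    rcases subsingleton_or_nontrivial B with h0 | h0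
    · exact absurd ht (by simp [spectrum.of_subsingleton])
    · rw [CStarRing.norm_one, mul_one] at h1
      have := (le_abs_self t).trans h1
      linarith
  have hcont : ContinuousOn (fun t : ℝ => (√(1 - t))⁻¹) (spectrum ℝ d) :=
    ContinuousOn.inv₀ (by fun_prop) fun t ht => (Real.sqrt_pos.2 (hlt t ht)).ne'
  have hpd : Commute p d := by
    rw [Commute, SemiconjBy, hd]
    simp only [← mul_assoc, hpp]
    simp only [mul_assoc, hpp]
  have hpk : Commute k p := (hpd.symm).cfc_real _
  have hks : star k = k := (cfc_predicate _ d : IsSelfAdjoint k).star_eq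
  have hkk : k * (1 - d) * k = 1 := by
    have e1 : (1 - d) = cfc (fun t : ℝ => 1 - t) d := by
      rw [cfc_sub (fun _ => (1 : ℝ)) (fun t => t) d, cfc_const_one ℝ d, cfc_id' ℝ d]
    have hcont' : ContinuousOn (fun t : ℝ => 1 - t) (spectrum ℝ d) := by fun_prop
    have hcont2 : ContinuousOn (fun t : ℝ => (√(1 - t))⁻¹ * (1 - t)) (spectrum ℝ d) :=
      hcont.mul hcont'
    rw [e1, hk, ← cfc_mul _ (fun t : ℝ => 1 - t) d hcont hcont', ← cfc_mul _ _ d hcont2 hcont,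
      ← cfc_const_one ℝ d]
    refine cfc_congr fun t ht => ?_
    have h1 := hlt t ht
    have h2 := Real.mul_self_sqrt h1.le
    have h3 := (Real.sqrt_pos.2 h1).ne'
    field_simp
    rw [sq, h2]
  refine ⟨e * p * k, ?_, by rw [← mul_assoc, ← mul_assoc, hee]⟩
  have e2 : p * e * p = p * (1 - d) := by
    rw [hd]
    simp only [mul_sub, sub_mul, mul_one, ← mul_assoc, hpp]
    abel
  calc star (e * p * k) * (e * p * k) = k * (p * (e * e) * p) * k := by
        simp only [star_mul, hks, hps, hes, mul_assoc]
    _ = k * p * (1 - d) * k := by rw [hee, e2, mul_assoc k p]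
    _ = p * (k * (1 - d) * k) := by rw [hpk.eq]; simp only [mul_assoc]
    _ = p := by rw [hkk, mul_one]

end PartialIsometry

/-! ### Semihomogeneous algebras as corners of C(X, M_n) -/

section Block

/-- Transport of a corner `p B p ≅ C` along a partial isometry `v` with `v⋆ v = p` and `e v = v`,
`e B e` being identified with `M` by `J` and `I`. -/
theorem exists_corner_model {B M C : Type*} [CStarAlgebra B] [Ring M] [StarRing M] [Algebra ℂ M]
    [NonUnitalRing C] [StarRing C] [Module ℂ C] {p e v : B} (hp : IsStarProjection p)
    (hv : star v * v = p) (hev : e * v = v) (he : star e = e) (ι : C →⋆ₙₐ[ℂ] B) (κ : B →ₗ[ℂ] C)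
    (hιp : ∀ z, p * ι z = ι z) (hιp' : ∀ z, ι z * p = ι z) (hκι : ∀ z, κ (ι z) = z)
    (hικ : ∀ f, ι (κ f) = p * f * p) (hκs : ∀ f, κ (star f) = star (κ f)) (J : B →ₗ[ℂ] M)
    (I : M →ₗ[ℂ] B) (hJm : ∀ f g, J (f * e * g) = J f * J g) (hJs : ∀ f, J (star f) = star (J f))
    (hIs : ∀ f, I (star f) = star (I f)) (hJI : ∀ f, J (I f) = f)
    (hIJ : ∀ f, I (J f) = e * f * e) :
    ∃ (Φ : C →⋆ₙₐ[ℂ] M) (Ψ : M →ₗ[ℂ] C) (P : M), (∀ z, Ψ (Φ z) = z) ∧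
      (∀ f, Φ (Ψ f) = P * f * P) ∧ IsStarProjection P ∧ ∀ f, Ψ (star f) = star (Ψ f) := by
  have hve : star v * e = star v := by
    have := congrArg star hev
    rwa [star_mul, he] at this
  have hps := hp.isSelfAdjoint.star_eq
  have hvp : v * p = v := by
    have hpos : star (v * p - v) * (v * p - v) = 0 := by
      have hp2 := hp.isIdempotentElem.eq
      rw [star_sub, star_mul, hps]
      calc (p * star v - star v) * (v * p - v)
          = p * (star v * v) * p - p * (star v * v) - (star v * v) * p + star v * v := by
            noncomm_ring
        _ = 0 := by rw [hv]; simp [hp2]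
    exact sub_eq_zero.1 ((CStarRing.star_mul_self_eq_zero_iff _).1 hpos)
  have hpv : p * star v = star v := by
    have := congrArg star hvp
    rwa [star_mul, hps] at this
  -- Φ is conjugation by v read in M, Ψ is conjugation by v⋆ followed by compression, and P is the
  -- image of v v⋆.
  refine ⟨
    { toFun := fun z => J (v * ι z * star v)
      map_smul' := fun c z => by
        change J (v * ι (c • z) * star v) = c • J (v * ι z * star v)
        rw [map_smul, mul_smul_comm, smul_mul_assoc, map_smul]
      map_zero' := by rw [map_zero, mul_zero, zero_mul, map_zero]
      map_add' := fun z w => by rw [map_add, mul_add, add_mul, map_add]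
      map_mul' := fun z w => by
        rw [← hJm]
        congr 1
        rw [map_mul]
        calc v * (ι z * ι w) * star v
            = v * (ι z * p * ι w) * star v := by rw [hιp']
          _ = v * ι z * (star v * v) * ι w * star v := by
            rw [hv]; simp only [mul_assoc]
          _ = v * ι z * (star v * e * v) * ι w * star v := by
            rw [hve]
          _ = _ := by simp only [mul_assoc]
      map_star' := fun z => by
        rw [map_star, ← hJs]
        congr 1
        simp only [star_mul, star_star, mul_assoc] },
    κ ∘ₗ
      { toFun := fun f => star v * I f * v
        map_add' := fun f g => by rw [map_add, mul_add, add_mul]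
        map_smul' := fun c f => by rw [map_smul, mul_smul_comm, smul_mul_assoc]; rfl },
    J (v * star v), fun z => ?_, fun f => ?_, ⟨?_, ?_⟩, fun f => ?_⟩
  · change κ (star v * I (J (v * ι z * star v)) * v) = z
    rw [hIJ]
    have : star v * (e * (v * ι z * star v) * e) * v
        = (star v * e * v) * ι z * (star v * e * v) := by simp only [mul_assoc]
    rw [this, hve, hv, hιp, hιp', hκι]
  · change J (v * ι (κ (star v * I f * v)) * star v) = J (v * star v) * f * J (v * star v)
    rw [hικ]
    conv_rhs => rw [← hJI f, ← hJm, ← hJm]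
    congr 1
    calc v * (p * (star v * I f * v) * p) * star v
        = (v * p) * star v * I f * v * (p * star v) := by simp only [mul_assoc]
      _ = v * (star v * e) * I f * (e * v) * star v := by rw [hvp, hpv, hve, hev]
      _ = _ := by simp only [mul_assoc]
  · rw [IsIdempotentElem, ← hJm]
    congr 1
    calc v * star v * e * (v * star v) = v * (star v * e * v) * star v := by simp only [mul_assoc]
      _ = _ := by rw [hve, hv, hvp]
  · rw [IsSelfAdjoint, ← hJs]
    congr 1
    rw [star_mul, star_star]
  · change κ (star v * I (star f) * v) = star (κ (star v * I f * v))
    rw [← hκs, hIs]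
    congr 1
    simp only [star_mul, star_star, mul_assoc]

namespace SemiHomogeneousData

variable (S : SemiHomogeneousData)

/-- The disjoint union of the spaces of a semihomogeneous algebra. -/
abbrev Space : Type := (j : Fin S.r) × (S.block j).X

/-- The algebra `C(⨆ X_j, B(ℓ²))`. -/
abbrev Big : Type := C(S.Space, Hilb →L[ℂ] Hilb)

instance : CStarAlgebra S.Big := ContinuousMap.instCStarAlgebra

/-- The projection defining a semihomogeneous algebra. -/
def proj : S.Big := ContinuousMap.sigma fun j => (S.block j).p

/-- The ⋆-homomorphism of a semihomogeneous algebra into `C(⨆ X_j, B(ℓ²))`. -/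
def toBig : S.Alg →⋆ₙₐ[ℂ] S.Big where
  toFun z := ContinuousMap.sigma fun j => (z j).1
  map_smul' _ _ := by ext1 ⟨j, x⟩; rfl
  map_zero' := by ext1 ⟨j, x⟩; rfl
  map_add' _ _ := by ext1 ⟨j, x⟩; rfl
  map_mul' _ _ := by ext1 ⟨j, x⟩; rfl
  map_star' _ := by ext1 ⟨j, x⟩; rfl

theorem isStarProjection_proj : IsStarProjection S.proj := by
  constructor
  · ext1 ⟨j, x⟩
    exact congrArg (fun f : C((S.block j).X, Hilb →L[ℂ] Hilb) => f x)
      (S.block j).isStarProjection.isIdempotentElem.eq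
  · ext1 ⟨j, x⟩
    exact congrArg (fun f : C((S.block j).X, Hilb →L[ℂ] Hilb) => f x)
      (S.block j).isStarProjection.isSelfAdjoint.star_eq

theorem proj_mul_toBig (z : S.Alg) : S.proj * S.toBig z = S.toBig z := by
  ext1 ⟨j, x⟩
  exact congrArg (fun f : C((S.block j).X, Hilb →L[ℂ] Hilb) => f x) (z j).2.1

theorem toBig_mul_proj (z : S.Alg) : S.toBig z * S.proj = S.toBig z := by
  ext1 ⟨j, x⟩
  exact congrArg (fun f : C((S.block j).X, Hilb →L[ℂ] Hilb) => f x) (z j).2.2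

/-- The restriction of a function to a component. -/
def restrict (f : S.Big) (j : Fin S.r) : C((S.block j).X, Hilb →L[ℂ] Hilb) :=
  ⟨fun x => f ⟨j, x⟩, f.continuous.comp continuous_sigmaMk⟩

theorem restrict_mem_corner {f : S.Big} (h1 : S.proj * f = f) (h2 : f * S.proj = f)
    (j : Fin S.r) : S.restrict f j ∈ corner (S.block j).p (S.block j).isStarProjection :=
  ⟨congrArg (fun g : S.Big => S.restrict g j) h1, congrArg (fun g : S.Big => S.restrict g j) h2⟩

/-- The element of a semihomogeneous algebra given by a function into the corner. -/
def ofBig (f : S.Big) (h1 : S.proj * f = f) (h2 : f * S.proj = f) : S.Alg :=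
  fun j => ⟨S.restrict f j, S.restrict_mem_corner h1 h2 j⟩

theorem toBig_injective : Function.Injective S.toBig := by
  intro z w h
  funext j
  apply Subtype.ext
  ext1 x
  exact congrArg (fun g : S.Big => g ⟨j, x⟩) h

theorem toBig_ofBig (f : S.Big) (h1 : S.proj * f = f) (h2 : f * S.proj = f) :
    S.toBig (S.ofBig f h1 h2) = f := by
  ext1 ⟨j, x⟩
  rfl

theorem proj_mul_cut (f : S.Big) : S.proj * (S.proj * f * S.proj) = S.proj * f * S.proj := by
  have := S.isStarProjection_proj.isIdempotentElem.eq
  rw [← mul_assoc, ← mul_assoc, this]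

theorem cut_mul_proj (f : S.Big) : S.proj * f * S.proj * S.proj = S.proj * f * S.proj := by
  have := S.isStarProjection_proj.isIdempotentElem.eq
  rw [mul_assoc, this]

/-- The compression onto the corner. -/
def fromBig : S.Big →ₗ[ℂ] S.Alg where
  toFun f := S.ofBig (S.proj * f * S.proj) (S.proj_mul_cut f) (S.cut_mul_proj f)
  map_add' f g := S.toBig_injective (by
    rw [map_add, toBig_ofBig, toBig_ofBig, toBig_ofBig, mul_add, add_mul])
  map_smul' c f := S.toBig_injective (by
    rw [map_smul, toBig_ofBig, toBig_ofBig, mul_smul_comm, smul_mul_assoc]; rfl)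

theorem toBig_fromBig (f : S.Big) : S.toBig (S.fromBig f) = S.proj * f * S.proj :=
  S.toBig_ofBig _ (S.proj_mul_cut f) (S.cut_mul_proj f)

/-- The finitely many base spaces are glued to one disjoint union, so a direct sum is again a single
corner. Its projection is equivalent to a subprojection of a constant one of finite rank n. -/
theorem exists_matrix_model :
    ∃ (X : Type) (_ : TopologicalSpace X) (_ : CompactSpace X) (_ : T2Space X) (n : ℕ)
      (Φ : S.Alg →⋆ₙₐ[ℂ] C(X, Mat n ℂ)) (Ψ : C(X, Mat n ℂ) →ₗ[ℂ] S.Alg) (P : C(X, Mat n ℂ)),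
      (∀ z, Ψ (Φ z) = z) ∧ (∀ f, Φ (Ψ f) = P * f * P) ∧ IsStarProjection P ∧
        ∀ f, Ψ (star f) = star (Ψ f) := by
  letI : ∀ j, T2Space (S.block j).X := fun j =>
    haveI := (S.block j).metrizable; inferInstance
  have hpp := S.isStarProjection_proj
  obtain ⟨n, e, he, hlt⟩ := exists_frame_approx S.proj hpp
    fun x => (S.block x.1).isCompactOperator x.2
  set E : S.Big := ContinuousMap.const S.Space (frameProj e)
  have hE : IsStarProjection E :=
    ⟨ContinuousMap.ext fun x => (isStarProjection_frameProj he).isIdempotentElem.eq,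
      ContinuousMap.ext fun x => (isStarProjection_frameProj he).isSelfAdjoint.star_eq⟩
  have hEp : ‖(1 - E) * S.proj‖ < 1 := (ContinuousMap.norm_lt_iff _ one_pos).2 hlt
  obtain ⟨v, hv, hEv⟩ := exists_partialIsometry (B := S.Big) hpp hE hEp
  let J : S.Big →ₗ[ℂ] C(S.Space, Mat n ℂ) :=
    { toFun := fun f => ⟨fun x => compress e (f x), (continuous_compress e).comp f.continuous⟩
      map_add' := fun f g => ContinuousMap.ext fun x => map_add (compress e) _ _
      map_smul' := fun c f => ContinuousMap.ext fun x => map_smul (compress e) _ _ }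
  let I : C(S.Space, Mat n ℂ) →ₗ[ℂ] S.Big :=
    { toFun := fun f => ⟨fun x => expand e (f x), (continuous_expand e).comp f.continuous⟩
      map_add' := fun f g => ContinuousMap.ext fun x => map_add (expand e) _ _
      map_smul' := fun c f => ContinuousMap.ext fun x => map_smul (expand e) _ _ }
  refine ⟨S.Space, inferInstance, inferInstance, inferInstance, n, ?_⟩
  refine exists_corner_model (B := S.Big) hpp hv hEv hE.isSelfAdjoint.star_eq S.toBig S.fromBig
    S.proj_mul_toBig S.toBig_mul_proj (fun z => S.toBig_injective ?_) S.toBig_fromBig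
    (fun f => S.toBig_injective ?_) J I
    (fun f g => ContinuousMap.ext fun x => compress_mul e (f x) (g x))
    (fun f => ContinuousMap.ext fun x => compress_star e (f x))
    (fun f => ContinuousMap.ext fun x => expand_star e (f x))
    (fun f => ContinuousMap.ext fun x => compress_expand he (f x))
    (fun f => ContinuousMap.ext fun x => expand_compress e (f x))
  · rw [toBig_fromBig, proj_mul_toBig, toBig_mul_proj]
  · refine Eq.trans ?_ (map_star S.toBig (S.fromBig f)).symm
    rw [toBig_fromBig, toBig_fromBig]
    simp only [star_mul, hpp.isSelfAdjoint.star_eq, mul_assoc]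

end SemiHomogeneousData

end Block

/-! ### Quasitraces on commuting elements -/

section Quasitrace

variable {M : Type u} [CStarAlgebra M] {σ : M → ℂ}

/-- Commuting selfadjoint elements generate a commutative C⋆-subalgebra, where linearity is an
axiom. -/
theorem IsQuasitrace.exists_commutative (hσ : IsQuasitrace σ) {s : Set M}
    (hs : ∀ x ∈ s, IsSelfAdjoint x) (hc : ∀ x ∈ s, ∀ y ∈ s, Commute x y) :
    ∃ B : NonUnitalStarSubalgebra ℂ M, IsClosed (B : Set M) ∧ s ⊆ B ∧
      ∀ x ∈ B, ∀ y ∈ B, ∀ c : ℂ, σ (x + y) = σ x + σ y ∧ σ (c • x) = c * σ x := by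
  set B₀ := NonUnitalStarAlgebra.adjoin ℂ s
  have h1 : ∀ x ∈ s, ∀ y ∈ B₀, Commute x y := fun x hx y hy =>
    NonUnitalStarAlgebra.commute_of_mem_adjoin_of_forall_mem_commute hy (hc x hx)
      fun b hb => by rw [(hs b hb).star_eq]; exact hc x hx b hb
  have h2 : ∀ y ∈ B₀, ∀ z ∈ B₀, Commute y z := fun y hy z hz =>
    NonUnitalStarAlgebra.commute_of_mem_adjoin_of_forall_mem_commute hz
      (fun b hb => (h1 b hb y hy).symm)
      fun b hb => by rw [(hs b hb).star_eq]; exact (h1 b hb y hy).symm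
  letI := B₀.nonUnitalCommSemiringTopologicalClosure fun x y =>
    Subtype.ext (h2 x x.2 y y.2)
  refine ⟨B₀.topologicalClosure, B₀.isClosed_topologicalClosure,
    (NonUnitalStarAlgebra.subset_adjoin ℂ s).trans B₀.le_topologicalClosure, ?_⟩
  refine hσ.linear _ B₀.isClosed_topologicalClosure fun x hx y hy => ?_
  exact congrArg Subtype.val (mul_comm (⟨x, hx⟩ : B₀.topologicalClosure) ⟨y, hy⟩)

theorem IsQuasitrace.map_add (hσ : IsQuasitrace σ) {x y : M} (hx : IsSelfAdjoint x)
    (hy : IsSelfAdjoint y) (h : Commute x y) : σ (x + y) = σ x + σ y := by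
  obtain ⟨B, -, hB, hlin⟩ := hσ.exists_commutative (s := {x, y})
    (by rintro _ (rfl | rfl) <;> assumption)
    (by rintro _ (rfl | rfl) _ (rfl | rfl)
        exacts [Commute.refl _, h, h.symm, Commute.refl _])
  exact (hlin x (hB (by simp)) y (hB (by simp)) 0).1

theorem IsQuasitrace.map_smul (hσ : IsQuasitrace σ) {x : M} (hx : IsSelfAdjoint x) (c : ℂ) :
    σ (c • x) = c * σ x := by
  obtain ⟨B, -, hB, hlin⟩ := hσ.exists_commutative (s := {x})
    (by rintro _ rfl; assumption) (by rintro _ rfl _ rfl; exact Commute.refl _)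
  exact (hlin x (hB (by simp)) x (hB (by simp)) c).2

theorem IsQuasitrace.map_zero (hσ : IsQuasitrace σ) : σ 0 = 0 := by
  have := hσ.map_smul (IsSelfAdjoint.zero M) 0
  simpa using this

theorem IsQuasitrace.map_sum (hσ : IsQuasitrace σ) {ι : Type*} (t : Finset ι) {f : ι → M}
    (hs : ∀ i ∈ t, IsSelfAdjoint (f i)) (hc : ∀ i ∈ t, ∀ j ∈ t, Commute (f i) (f j)) :
    σ (∑ i ∈ t, f i) = ∑ i ∈ t, σ (f i) := by
  classical
  induction t using Finset.induction_on with
  | empty => simpa using hσ.map_zero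
  | insert i t hi ih =>
    rw [Finset.sum_insert hi, Finset.sum_insert hi, hσ.map_add (hs i (by simp)), ih]
    · exact fun j hj => hs j (by simp [hj])
    · exact fun j hj k hk => hc j (by simp [hj]) k (by simp [hk])
    · exact isSelfAdjoint_sum _ fun j hj => hs j (by simp [hj])
    · exact Commute.sum_right _ _ _ fun j hj => hc i (by simp) j (by simp [hj])

/-- The order comparison is carried out by additivity on commuting elements, whence the hypothesis
that x commutes with e. -/
theorem IsQuasitrace.abs_re_le (hσ : IsQuasitrace σ) [PartialOrder M] [StarOrderedRing M]
    {x e : M} (hx : IsSelfAdjoint x) (he : IsSelfAdjoint e) (hxe : Commute x e) {c : ℝ}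
    (h1 : 0 ≤ (c : ℂ) • e - x) (h2 : 0 ≤ (c : ℂ) • e + x) : ‖σ x‖ ≤ c * (σ e).re := by
  have hpos : ∀ y : M, 0 ≤ y → 0 ≤ σ y := fun y hy => by
    obtain ⟨z, rfl⟩ := CStarAlgebra.nonneg_iff_eq_star_mul_self.1 hy
    exact hσ.nonneg z
  have hce : IsSelfAdjoint ((c : ℂ) • e) := IsSelfAdjoint.smul (Complex.conj_ofReal c) he
  have hcc : Commute ((c : ℂ) • e) x := hxe.symm.smul_left _
  have h1' := hpos _ h1
  have h2' := hpos _ h2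
  rw [sub_eq_add_neg, hσ.map_add hce hx.neg hcc.neg_right, hσ.map_smul he, ← neg_one_smul ℂ x,
    hσ.map_smul hx] at h1'
  rw [hσ.map_add hce hx hcc, hσ.map_smul he] at h2'
  rw [Complex.le_def] at h1' h2'
  simp at h1' h2'
  have him : (σ x).im = 0 := by linarith [h1'.2, h2'.2]
  have : σ x = ((σ x).re : ℂ) := Complex.ext rfl (by simp [him])
  rw [this, Complex.norm_real, Real.norm_eq_abs, abs_le]
  constructor <;> linarith [h1'.1, h2'.1]

end Quasitrace

/-! ### Matrix valued functions and rank one matrices -/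

section FunctionModule

variable {X : Type*} [TopologicalSpace X] [CompactSpace X] {n : ℕ}

/-- The C⋆-algebra `C(X, M_n(ℂ))`. -/
def MF (X : Type*) [TopologicalSpace X] (n : ℕ) : Type _ := C(X, Mat n ℂ)

namespace MF

instance : CStarAlgebra (MF X n) := inferInstanceAs (CStarAlgebra C(X, Mat n ℂ))

instance : FunLike (MF X n) X (Mat n ℂ) := inferInstanceAs (FunLike C(X, Mat n ℂ) X (Mat n ℂ))

/-- A continuous function as an element of `C(X, M_n(ℂ))`. -/
def mk (f : X → Mat n ℂ) (hf : Continuous f) : MF X n := (⟨f, hf⟩ : C(X, Mat n ℂ))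

theorem continuous (f : MF X n) : Continuous f := ContinuousMap.continuous f

theorem ext {f g : MF X n} (h : ∀ x, f x = g x) : f = g := DFunLike.ext f g h

theorem mul_apply (f g : MF X n) (x : X) : (f * g) x = f x * g x := rfl
theorem add_apply (f g : MF X n) (x : X) : (f + g) x = f x + g x := rfl
theorem sub_apply (f g : MF X n) (x : X) : (f - g) x = f x - g x := rfl
theorem star_apply (f : MF X n) (x : X) : (star f) x = star (f x) := rfl
theorem smul_apply (c : ℂ) (f : MF X n) (x : X) : (c • f) x = c • f x := rfl

/-- Evaluation at a point. -/
def eval (x : X) : MF X n →⋆ₐ[ℂ] Mat n ℂ where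
  toFun f := f x
  map_one' := rfl
  map_mul' _ _ := rfl
  map_zero' := rfl
  map_add' _ _ := rfl
  commutes' _ := rfl
  map_star' _ := rfl

theorem continuous_eval (x : X) : Continuous (eval x : MF X n →⋆ₐ[ℂ] Mat n ℂ) :=
  show Continuous fun f : C(X, Mat n ℂ) => f x from ContinuousEvalConst.continuous_eval_const x

/-- Constant functions. -/
def const (X : Type*) [TopologicalSpace X] {n : ℕ} (a : Mat n ℂ) : MF X n :=
  (ContinuousMap.const X a : C(X, Mat n ℂ))

theorem const_apply (a : Mat n ℂ) (x : X) : const X a x = a := rfl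

end MF

theorem Mat.zero_smul (a : Mat n ℂ) : (0 : ℂ) • a = 0 := _root_.zero_smul ℂ a

/-- Real functions as complex functions. -/
def toComplex (g : C(X, ℝ)) : C(X, ℂ) := ⟨fun x => (g x : ℂ), by fun_prop⟩

@[simp] theorem toComplex_apply (g : C(X, ℝ)) (x : X) : toComplex g x = (g x : ℂ) := rfl

theorem star_toComplex (g : C(X, ℝ)) : star (toComplex g) = toComplex g := by
  ext x; simp

/-- Multiplication of a matrix valued function by a scalar function. -/
def fsmul (g : C(X, ℂ)) (a : MF X n) : MF X n :=
  MF.mk (fun x => g x • a x) (g.continuous.smul a.continuous)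

theorem fsmul_apply (g : C(X, ℂ)) (a : MF X n) (x : X) : fsmul g a x = g x • a x := rfl

theorem fsmul_mul_fsmul (g h : C(X, ℂ)) (a b : MF X n) :
    fsmul g a * fsmul h b = fsmul (g * h) (a * b) :=
  MF.ext fun x => smul_mul_smul_comm (g x) (a x) (h x) (b x)

theorem fsmul_mul (g : C(X, ℂ)) (a b : MF X n) : fsmul g a * b = fsmul g (a * b) :=
  MF.ext fun x => smul_mul_assoc (g x) (a x) (b x)

theorem mul_fsmul (g : C(X, ℂ)) (a b : MF X n) : a * fsmul g b = fsmul g (a * b) :=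
  MF.ext fun x => mul_smul_comm (g x) (a x) (b x)

theorem star_fsmul (g : C(X, ℂ)) (a : MF X n) : star (fsmul g a) = fsmul (star g) (star a) :=
  MF.ext fun x => star_smul (g x) (a x)

theorem fsmul_smul (g : C(X, ℂ)) (c : ℂ) (a : MF X n) :
    fsmul g (c • a) = c • fsmul g a :=
  MF.ext fun x => smul_comm (g x) c (a x)

theorem fsmul_add (g : C(X, ℂ)) (a b : MF X n) :
    fsmul g (a + b) = fsmul g a + fsmul g b :=
  MF.ext fun x => smul_add (g x) (a x) (b x)

theorem fsmul_sub (g : C(X, ℂ)) (a b : MF X n) :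
    fsmul g (a - b) = fsmul g a - fsmul g b :=
  MF.ext fun x => smul_sub (g x) (a x) (b x)

theorem add_fsmul (g h : C(X, ℂ)) (a : MF X n) :
    fsmul (g + h) a = fsmul g a + fsmul h a :=
  MF.ext fun x => add_smul (g x) (h x) (a x)

theorem fsmul_fsmul (g h : C(X, ℂ)) (a : MF X n) :
    fsmul g (fsmul h a) = fsmul (g * h) a :=
  MF.ext fun x => smul_smul (g x) (h x) (a x)

theorem isSelfAdjoint_fsmul {a : MF X n} (ha : IsSelfAdjoint a) (g : C(X, ℝ)) :
    IsSelfAdjoint (fsmul (toComplex g) a) := by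
  rw [IsSelfAdjoint, star_fsmul, star_toComplex, ha.star_eq]

theorem fsmul_congr {g : C(X, ℝ)} {a b : MF X n} (h : ∀ x, g x = 0 ∨ a x = b x) :
    fsmul (toComplex g) a = fsmul (toComplex g) b := by
  refine MF.ext fun x => ?_
  rw [fsmul_apply, fsmul_apply, toComplex_apply]
  rcases h x with h | h
  · rw [h, Complex.ofReal_zero, Mat.zero_smul, Mat.zero_smul]
  · rw [h]

theorem fsmul_zero (g : C(X, ℂ)) : fsmul g (0 : MF X n) = 0 := by
  have := fsmul_sub g (0 : MF X n) 0
  rwa [sub_self, sub_self] at this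

/-- The trace of a matrix. -/
def Mat.trace : Mat n ℂ →L[ℂ] ℂ := ∑ i, entryL n i i

theorem Mat.trace_apply (a : Mat n ℂ) : a.trace = ∑ i, a.entry i i := by
  simp only [Mat.trace, ContinuousLinearMap.sum_apply]
  rfl

theorem Mat.trace_mul_comm (a b : Mat n ℂ) : (a * b).trace = (b * a).trace := by
  simp only [Mat.trace_apply, Mat.entry_mul]
  rw [Finset.sum_comm]
  exact Finset.sum_congr rfl fun i _ => Finset.sum_congr rfl fun j _ => mul_comm _ _

/-- The matrix `v w⋆`. -/
def Mat.dyad (v w : Fin n → ℂ) : Mat n ℂ := Mat.of fun i j => v i * star (w j)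

/-- The sesquilinear form `v⋆ a w`. -/
def Mat.form (a : Mat n ℂ) (v w : Fin n → ℂ) : ℂ := ∑ i, ∑ j, star (v i) * a.entry i j * w j

theorem Mat.star_dyad (v w : Fin n → ℂ) : star (Mat.dyad v w) = Mat.dyad w v := by
  apply Mat.ext; intro i j
  simp [Mat.dyad, mul_comm]

theorem Mat.dyad_mul_mul (v w v' w' : Fin n → ℂ) (a : Mat n ℂ) :
    Mat.dyad v w * a * Mat.dyad v' w' = a.form w v' • Mat.dyad v w' := by
  apply Mat.ext; intro i j
  simp only [Mat.entry_mul, Mat.dyad, Mat.entry_of, Mat.entry_smul, Mat.form, Finset.sum_mul,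
    smul_eq_mul]
  rw [Finset.sum_comm]
  exact Finset.sum_congr rfl fun k _ => Finset.sum_congr rfl fun l _ => by ring

theorem Mat.trace_mul_dyad (a : Mat n ℂ) (v w : Fin n → ℂ) :
    (a * Mat.dyad v w).trace = a.form w v := by
  simp only [Mat.trace_apply, Mat.entry_mul, Mat.dyad, Mat.entry_of, Mat.form]
  exact Finset.sum_congr rfl fun k _ => Finset.sum_congr rfl fun l _ => by ring

theorem Mat.continuous_form (v w : Fin n → ℂ) : Continuous fun a : Mat n ℂ => a.form v w := by
  refine continuous_finsetSum _ fun i _ => continuous_finsetSum _ fun j _ => ?_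
  exact (continuous_const.mul ((entryL (A := ℂ) n i j).continuous)).mul continuous_const

theorem Mat.form_star (a : Mat n ℂ) (v w : Fin n → ℂ) : (star a).form v w = star (a.form w v) := by
  simp only [Mat.form, star_sum, star_mul', star_star, Mat.entry_star]
  rw [Finset.sum_comm]
  exact Finset.sum_congr rfl fun k _ => Finset.sum_congr rfl fun l _ => by ring

/-- A projection with nonpositive trace vanishes. -/
theorem Mat.entry_diag_of_isStarProjection {p : Mat n ℂ} (hp : IsStarProjection p) (j : Fin n) :
    p.entry j j = ((∑ i, ‖p.entry i j‖ ^ 2 : ℝ) : ℂ) := by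
  conv_lhs => rw [← hp.isIdempotentElem.eq, Mat.entry_mul]
  push_cast
  refine Finset.sum_congr rfl fun i _ => ?_
  have := congrArg (fun a : Mat n ℂ => a.entry j i) hp.isSelfAdjoint.star_eq
  simp only [Mat.entry_star] at this
  rw [← this, mul_comm, Complex.star_def, Complex.mul_conj, Complex.normSq_eq_norm_sq]
  push_cast
  rfl

theorem Mat.trace_of_isStarProjection {p : Mat n ℂ} (hp : IsStarProjection p) :
    p.trace = ((∑ j, ∑ i, ‖p.entry i j‖ ^ 2 : ℝ) : ℂ) := by
  rw [Mat.trace_apply, Complex.ofReal_sum]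
  exact Finset.sum_congr rfl fun j _ => Mat.entry_diag_of_isStarProjection hp j

theorem Mat.eq_zero_of_trace_re_nonpos {p : Mat n ℂ} (hp : IsStarProjection p)
    (h : p.trace.re ≤ 0) : p = 0 := by
  rw [Mat.trace_of_isStarProjection hp, Complex.ofReal_re] at h
  have h1 := le_antisymm h (by positivity)
  rw [Finset.sum_eq_zero_iff_of_nonneg fun _ _ => by positivity] at h1
  apply Mat.ext; intro i j
  have h2 := h1 j (Finset.mem_univ j)
  rw [Finset.sum_eq_zero_iff_of_nonneg fun _ _ => by positivity] at h2
  have h3 := h2 i (Finset.mem_univ i)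
  simpa using h3

/-- A nonzero projection fixes a unit vector. -/
theorem Mat.exists_unit_vector {p : Mat n ℂ} (hp : IsStarProjection p) (h0 : p ≠ 0) :
    ∃ v : Fin n → ℂ, p.form v v = 1 ∧ Mat.dyad v v = p * Mat.dyad v v ∧
      Mat.dyad v v = Mat.dyad v v * p := by
  obtain ⟨j, hj⟩ : ∃ j, 0 < ∑ i, ‖p.entry i j‖ ^ 2 := by
    by_contra! h
    refine h0 (Mat.ext fun i j => ?_)
    have h1 := le_antisymm (h j) (by positivity)
    rw [Finset.sum_eq_zero_iff_of_nonneg fun _ _ => by positivity] at h1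
    simpa using h1 i (Finset.mem_univ i)
  set s : ℝ := ∑ i, ‖p.entry i j‖ ^ 2 with hs
  -- A nonzero column of p, normalised; its squared length is the diagonal entry of p.
  set v : Fin n → ℂ := fun i => p.entry i j / (√s : ℂ) with hv
  have hpv : p * Mat.dyad v v = Mat.dyad v v := by
    apply Mat.ext; intro i l
    have := congrArg (fun a : Mat n ℂ => a.entry i j) hp.isIdempotentElem.eq
    simp only [Mat.entry_mul] at this
    simp only [Mat.entry_mul, Mat.dyad, Mat.entry_of, ← mul_assoc, ← Finset.sum_mul]
    congr 1
    simp only [hv, ← mul_div_assoc, ← Finset.sum_div, this]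
  have hss : ((√s : ℝ) : ℂ) * (√s : ℝ) = s := by
    rw [← Complex.ofReal_mul, Real.mul_self_sqrt hj.le]
  have hs0 : (s : ℂ) ≠ 0 := by exact_mod_cast hj.ne'
  refine ⟨v, ?_, hpv.symm, ?_⟩
  · rw [← Mat.trace_mul_dyad, hpv, Mat.trace_apply]
    have : ∀ i, (Mat.dyad v v).entry i i = ((‖p.entry i j‖ ^ 2 / s : ℝ) : ℂ) := by
      intro i
      simp only [Mat.dyad, Mat.entry_of, hv, star_div₀]
      rw [Complex.star_def, Complex.conj_ofReal, div_mul_div_comm, hss, ← Complex.star_def,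
        Complex.star_def, Complex.mul_conj, Complex.normSq_eq_norm_sq]
      push_cast
      rfl
    rw [Finset.sum_congr rfl fun i _ => this i, ← Complex.ofReal_sum, ← Finset.sum_div, ← hs,
      div_self hj.ne', Complex.ofReal_one]
  · have := congrArg star hpv
    rw [star_mul, Mat.star_dyad, hp.isSelfAdjoint.star_eq] at this
    exact this.symm

end FunctionModule

/-! ### Corner maps and equivalence of rank one pieces -/

section CornerMap

/-- A linear ⋆-preserving map `M_n(C(X)) → A` which is a ⋆-homomorphism on the corner given by a
projection `Q`, and factors through the compression to this corner. -/
structure CornerMap (X : Type) [TopologicalSpace X] [CompactSpace X] (n : ℕ)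
    (A : Type u) [CStarAlgebra A] where
  Q : MF X n
  isStarProjection : IsStarProjection Q
  toFun : MF X n →ₗ[ℂ] A
  map_star : ∀ f, toFun (star f) = star (toFun f)
  map_mul : ∀ f g, toFun f * toFun g = toFun (f * Q * g)
  map_cut : ∀ f, toFun (Q * f * Q) = toFun f

namespace CornerMap

variable {X : Type} [TopologicalSpace X] [CompactSpace X] {n : ℕ} {A : Type u} [CStarAlgebra A]
  (Θ : CornerMap X n A) {σ : A → ℂ}

theorem isSelfAdjoint {f : MF X n} (hf : IsSelfAdjoint f) : IsSelfAdjoint (Θ.toFun f) := by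
  rw [IsSelfAdjoint, ← Θ.map_star, hf.star_eq]

theorem map_mul_of_left {f : MF X n} (hf : f * Θ.Q = f) (g : MF X n) :
    Θ.toFun f * Θ.toFun g = Θ.toFun (f * g) := by
  rw [Θ.map_mul, hf]

theorem commute {f g : MF X n} (hf : f * Θ.Q = f) (hg : g * Θ.Q = g) (h : Commute f g) :
    Commute (Θ.toFun f) (Θ.toFun g) := by
  rw [Commute, SemiconjBy, Θ.map_mul_of_left hf, Θ.map_mul_of_left hg, h.eq]

theorem quasitrace_add (hσ : IsQuasitrace σ) {f g : MF X n} (hf : IsSelfAdjoint f)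
    (hg : IsSelfAdjoint g) (hfQ : f * Θ.Q = f) (hgQ : g * Θ.Q = g) (h : Commute f g) :
    σ (Θ.toFun (f + g)) = σ (Θ.toFun f) + σ (Θ.toFun g) := by
  rw [map_add, hσ.map_add (Θ.isSelfAdjoint hf) (Θ.isSelfAdjoint hg) (Θ.commute hfQ hgQ h)]

theorem quasitrace_comm (hσ : IsQuasitrace σ) {c : MF X n} (h1 : Θ.Q * c = c)
    (h2 : c * Θ.Q = c) : σ (Θ.toFun (c * star c)) = σ (Θ.toFun (star c * c)) := by
  have h3 : star c * Θ.Q = star c := by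
    have := congrArg star h1
    rwa [star_mul, Θ.isStarProjection.isSelfAdjoint.star_eq] at this
  rw [← Θ.map_mul_of_left h2, ← Θ.map_mul_of_left h3, Θ.map_star, hσ.tracial]

/-- `p` is projection valued near `x₀`. -/
def _root_.CStarCuntz.ProjNear (x₀ : X) (p : MF X n) : Prop :=
  ∀ᶠ x in 𝓝 x₀, IsStarProjection (p x)

/-- The function `1 / max (v⋆ p v) (1/2)`. -/
def _root_.CStarCuntz.invForm (p : MF X n) (v : Fin n → ℂ) : C(X, ℝ) :=
  ⟨fun x => (max ((p x).form v v).re (1 / 2))⁻¹, by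
    refine Continuous.inv₀ ?_ fun x => ?_
    · exact (Complex.continuous_re.comp ((Mat.continuous_form v v).comp p.continuous)).max
        continuous_const
    · exact (lt_max_of_lt_right (by norm_num)).ne'⟩

theorem _root_.CStarCuntz.invForm_nonneg (p : MF X n) (v : Fin n → ℂ) (x : X) :
    0 ≤ invForm p v x :=
  inv_nonneg.2 (le_max_of_le_right (by norm_num))

/-- A rank one subprojection of `p` near a point. -/
def _root_.CStarCuntz.rankOnePiece (p : MF X n) (v : Fin n → ℂ) : MF X n :=
  fsmul (toComplex (invForm p v)) (p * MF.const X (Mat.dyad v v) * p)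

/-- The truncation at 1/2 only makes `invForm` globally continuous; it is inactive where the form
exceeds 1/2. -/
theorem _root_.CStarCuntz.form_mul_invForm {p : MF X n} {v : Fin n → ℂ} {x : X}
    (hp : IsStarProjection (p x)) (h : 1 / 2 < ((p x).form v v).re) :
    (p x).form v v * (invForm p v x : ℂ) = 1 := by
  have him : ((p x).form v v).im = 0 := by
    have := Mat.form_star (p x) v v
    rw [hp.isSelfAdjoint.star_eq, Complex.star_def] at this
    exact Complex.conj_eq_iff_im.1 this.symm
  have e : (p x).form v v = (((p x).form v v).re : ℂ) := Complex.ext rfl (by simp [him])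
  have h0 : ((p x).form v v).re ≠ 0 := by linarith
  rw [e]
  simp only [invForm, ContinuousMap.coe_mk, Complex.ofReal_re, max_eq_left h.le]
  rw [← Complex.ofReal_mul, mul_inv_cancel₀ h0, Complex.ofReal_one]

theorem _root_.CStarCuntz.eventually_form_gt {p : MF X n} {v : Fin n → ℂ} {x₀ : X}
    (h : (p x₀).form v v = 1) : ∀ᶠ x in 𝓝 x₀, 1 / 2 < ((p x).form v v).re := by
  have hc : Continuous fun x => ((p x).form v v).re :=
    Complex.continuous_re.comp ((Mat.continuous_form v v).comp p.continuous)
  refine hc.continuousAt.eventually_const_lt ?_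
  simp only [h]; norm_num

/-- The two weighted pieces are c c⋆ and c⋆ c for c = s · p (v v'⋆) p', where s² is g times both
normalising factors. Off U, where p and p' may fail to be projections, g vanishes. -/
theorem rankOnePiece_equiv (hσ : IsQuasitrace σ) {p p' : MF X n} {v v' : Fin n → ℂ} {x₀ : X}
    (hp : ProjNear x₀ p) (hp' : ProjNear x₀ p') (hv : (p x₀).form v v = 1)
    (hv' : (p' x₀).form v' v' = 1) (hQp : Θ.Q * p = p) (hQp' : p' * Θ.Q = p') :
    ∃ U, IsOpen U ∧ x₀ ∈ U ∧ ∀ g : C(X, ℝ), (∀ x, 0 ≤ g x) → (∀ x ∉ U, g x = 0) →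
      σ (Θ.toFun (fsmul (toComplex g) (rankOnePiece p v))) = σ (Θ.toFun (fsmul (toComplex g) (rankOnePiece p' v'))) := by
  obtain ⟨U, hU, hUo, hxU⟩ := eventually_nhds_iff.1
    (hp.and (hp'.and ((eventually_form_gt hv).and (eventually_form_gt hv'))))
  refine ⟨U, hUo, hxU, fun g hg hgU => ?_⟩
  set s : C(X, ℝ) := ⟨fun x => √(g x * invForm p v x * invForm p' v' x), by fun_prop⟩ with hs
  have hss : ∀ x, ((s x : ℝ) : ℂ) * (s x : ℝ) = g x * invForm p v x * invForm p' v' x := by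
    intro x
    rw [← Complex.ofReal_mul, hs, ContinuousMap.coe_mk, Real.mul_self_sqrt]
    · push_cast; rfl
    · exact mul_nonneg (mul_nonneg (hg x) (invForm_nonneg p v x)) (invForm_nonneg p' v' x)
  set c : MF X n := fsmul (toComplex s) (p * MF.const X (Mat.dyad v v') * p') with hc
  have e1 : c * star c = fsmul (toComplex g) (rankOnePiece p v) := by
    refine MF.ext fun x => ?_
    simp only [hc, rankOnePiece, star_fsmul, star_mul, star_toComplex, MF.mul_apply,
      fsmul_apply, MF.star_apply, toComplex_apply, MF.const_apply,
      Mat.star_dyad]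
    by_cases hx : x ∈ U
    · obtain ⟨h1, h2, h3, h4⟩ := hU x hx
      rw [h1.isSelfAdjoint.star_eq, h2.isSelfAdjoint.star_eq, smul_mul_smul_comm, hss]
      have e : p x * Mat.dyad v v' * p' x * (p' x * (Mat.dyad v' v * p x))
          = p x * (Mat.dyad v v' * (p' x * p' x) * Mat.dyad v' v) * p x := by
        simp only [mul_assoc]
      rw [e, h2.isIdempotentElem.eq, Mat.dyad_mul_mul, mul_smul_comm, smul_mul_assoc, smul_smul,
        smul_smul]
      congr 1
      have := form_mul_invForm h2 h4
      linear_combination (g x : ℂ) * invForm p v x * this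
    · have h0 : s x = 0 := by simp [hs, hgU x hx]
      simp only [h0, hgU x hx, Complex.ofReal_zero, Mat.zero_smul, zero_mul]
  have e2 : star c * c = fsmul (toComplex g) (rankOnePiece p' v') := by
    refine MF.ext fun x => ?_
    simp only [hc, rankOnePiece, star_fsmul, star_mul, star_toComplex, MF.mul_apply,
      fsmul_apply, MF.star_apply, toComplex_apply, MF.const_apply,
      Mat.star_dyad]
    by_cases hx : x ∈ U
    · obtain ⟨h1, h2, h3, h4⟩ := hU x hx
      rw [h1.isSelfAdjoint.star_eq, h2.isSelfAdjoint.star_eq, smul_mul_smul_comm, hss]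
      have e : p' x * (Mat.dyad v' v * p x) * (p x * Mat.dyad v v' * p' x)
          = p' x * (Mat.dyad v' v * (p x * p x) * Mat.dyad v v') * p' x := by
        simp only [mul_assoc]
      rw [e, h1.isIdempotentElem.eq, Mat.dyad_mul_mul, mul_smul_comm, smul_mul_assoc, smul_smul,
        smul_smul]
      congr 1
      have := form_mul_invForm h1 h3
      linear_combination (g x : ℂ) * invForm p' v' x * this
    · have h0 : s x = 0 := by simp [hs, hgU x hx]
      simp only [h0, hgU x hx, Complex.ofReal_zero, Mat.zero_smul, zero_mul]
  rw [← e1, ← e2]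
  refine Θ.quasitrace_comm hσ ?_ ?_
  · rw [hc, mul_fsmul, ← mul_assoc, ← mul_assoc, hQp]
  · rw [hc, fsmul_mul, mul_assoc, hQp']

end CornerMap

end CornerMap

/-! ### Peeling rank one projections off a projection near a point -/

section Peeling

variable {X : Type} [TopologicalSpace X] [CompactSpace X] {n : ℕ}

theorem Mat.dyad_mul_dyad_of_form {p : Mat n ℂ} {v : Fin n → ℂ} (h1 : p.form v v = 1)
    (h2 : Mat.dyad v v = p * Mat.dyad v v) : Mat.dyad v v * Mat.dyad v v = Mat.dyad v v := by
  calc Mat.dyad v v * Mat.dyad v v = Mat.dyad v v * (p * Mat.dyad v v) := by rw [← h2]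
    _ = Mat.dyad v v := by rw [← mul_assoc, Mat.dyad_mul_mul, h1, one_smul]

theorem isStarProjection_sub {B : Type*} [Ring B] [StarRing B] {p e : B} (hp : IsStarProjection p)
    (he : IsStarProjection e) (h1 : p * e = e) (h2 : e * p = e) : IsStarProjection (p - e) := by
  refine ⟨?_, hp.isSelfAdjoint.sub he.isSelfAdjoint⟩
  rw [IsIdempotentElem, mul_sub, sub_mul, sub_mul, h1, h2, hp.isIdempotentElem.eq,
    he.isIdempotentElem.eq]
  abel

theorem Mat.one_le_trace_re {p : Mat n ℂ} (hp : IsStarProjection p) (h0 : p ≠ 0) :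
    1 ≤ p.trace.re := by
  obtain ⟨v, h1, h2, h3⟩ := Mat.exists_unit_vector hp h0
  have he : IsStarProjection (Mat.dyad v v) := ⟨Mat.dyad_mul_dyad_of_form h1 h2, Mat.star_dyad v v⟩
  have h4 := Mat.trace_of_isStarProjection (isStarProjection_sub hp he h2.symm h3.symm)
  have h5 : (Mat.dyad v v).trace = 1 := by rw [h2, Mat.trace_mul_dyad, h1]
  rw [map_sub, h5] at h4
  have h6 := congrArg Complex.re h4
  rw [Complex.sub_re, Complex.one_re, Complex.ofReal_re] at h6
  have : (0 : ℝ) ≤ ∑ j, ∑ i, ‖(p - Mat.dyad v v).entry i j‖ ^ 2 := by positivity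
  linarith

/-- A projection of norm below 1 is zero, and the norm is continuous. -/
theorem ProjNear.eventually_eq_zero {x₀ : X} {p : MF X n} (hp : ProjNear x₀ p)
    (h : p x₀ = 0) : ∀ᶠ x in 𝓝 x₀, p x = 0 := by
  have hc : Continuous fun x => ‖p x‖ := p.continuous.norm
  have hlt : ∀ᶠ x in 𝓝 x₀, ‖p x‖ < 1 :=
    hc.continuousAt.eventually_lt_const (by simp only [h, norm_zero]; exact one_pos)
  filter_upwards [hp, hlt] with x h1 h2
  have h3 := CStarRing.norm_star_mul_self (x := p x)
  rw [h1.isSelfAdjoint.star_eq, h1.isIdempotentElem.eq] at h3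
  have h4 : ‖p x‖ = 0 := by
    by_contra h0
    have := mul_left_cancel₀ h0 (h3.symm.trans (mul_one _).symm)
    linarith
  exact norm_eq_zero.1 h4

theorem rankOnePiece_apply (p : MF X n) (v : Fin n → ℂ) (x : X) :
    rankOnePiece p v x = (invForm p v x : ℂ) • (p x * Mat.dyad v v * p x) := rfl

theorem isSelfAdjoint_rankOnePiece {p : MF X n} (hp : IsSelfAdjoint p) (v : Fin n → ℂ) :
    IsSelfAdjoint (rankOnePiece p v) := by
  refine isSelfAdjoint_fsmul ?_ _
  have : star (MF.const X (Mat.dyad v v) : MF X n)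
      = MF.const X (Mat.dyad v v) :=
    MF.ext fun x => Mat.star_dyad v v
  rw [IsSelfAdjoint, star_mul, star_mul, hp.star_eq, this, mul_assoc]

theorem rankOnePiece_isStarProjection {p : MF X n} {v : Fin n → ℂ} {x : X}
    (hp : IsStarProjection (p x)) (h : 1 / 2 < ((p x).form v v).re) :
    IsStarProjection (rankOnePiece p v x) ∧ p x * rankOnePiece p v x = rankOnePiece p v x ∧
      rankOnePiece p v x * p x = rankOnePiece p v x := by
  have hpp := hp.isIdempotentElem.eq
  rw [rankOnePiece_apply]
  refine ⟨⟨?_, ?_⟩, ?_, ?_⟩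
  · rw [IsIdempotentElem, smul_mul_smul_comm]
    have e : p x * Mat.dyad v v * p x * (p x * Mat.dyad v v * p x)
        = p x * (Mat.dyad v v * (p x * p x) * Mat.dyad v v) * p x := by simp only [mul_assoc]
    rw [e, hpp, Mat.dyad_mul_mul, mul_smul_comm, smul_mul_assoc, smul_smul]
    congr 1
    linear_combination (invForm p v x : ℂ) * form_mul_invForm hp h
  · rw [IsSelfAdjoint, star_smul, star_mul, star_mul, hp.isSelfAdjoint.star_eq, Mat.star_dyad,
      mul_assoc, Complex.star_def, Complex.conj_ofReal]
  · rw [mul_smul_comm, ← mul_assoc, ← mul_assoc, hpp]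
  · rw [smul_mul_assoc, mul_assoc, hpp]

theorem rankOnePiece_self {p : MF X n} {v : Fin n → ℂ} {x : X}
    (hp : IsStarProjection (p x)) (h1 : (p x).form v v = 1)
    (h2 : Mat.dyad v v = p x * Mat.dyad v v) (h3 : Mat.dyad v v = Mat.dyad v v * p x) :
    rankOnePiece p v x = Mat.dyad v v := by
  have := form_mul_invForm (v := v) hp (by rw [h1]; norm_num)
  rw [h1, one_mul] at this
  rw [rankOnePiece_apply, this, one_smul, ← h2, ← h3]

end Peeling

namespace CornerMap

variable {X : Type} [TopologicalSpace X] [CompactSpace X] {n : ℕ} {A : Type u} [CStarAlgebra A]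
  (Θ : CornerMap X n A) {σ : A → ℂ}

/-- κ g is the value of σ on g times a fixed rank one piece of Q. Locally every rank one piece has
this value, and p is peeled into such pieces by induction on its rank at x₀. The neighbourhood
depends on p, but κ does not. -/
theorem exists_rank_function (hσ : IsQuasitrace σ) (x₀ : X) : ∃ κ : C(X, ℝ) → ℂ,
    ∀ p, ProjNear x₀ p → IsSelfAdjoint p → Θ.Q * p = p → p * Θ.Q = p →
      ∃ U, IsOpen U ∧ x₀ ∈ U ∧ ∀ g : C(X, ℝ), (∀ x, 0 ≤ g x) → (∀ x ∉ U, g x = 0) →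
        σ (Θ.toFun (fsmul (toComplex g) p)) = (p x₀).trace * κ g := by
  have hQ : ∀ x, IsStarProjection (Θ.Q x) := fun x =>
    ⟨congrArg (fun f : MF X n => f x) Θ.isStarProjection.isIdempotentElem.eq,
      congrArg (fun f : MF X n => f x) Θ.isStarProjection.isSelfAdjoint.star_eq⟩
  have hzero : ∀ (p : MF X n) (z : ℂ), ProjNear x₀ p → p x₀ = 0 →
      ∃ U, IsOpen U ∧ x₀ ∈ U ∧ ∀ g : C(X, ℝ), (∀ x, 0 ≤ g x) → (∀ x ∉ U, g x = 0) →
        σ (Θ.toFun (fsmul (toComplex g) p)) = 0 := by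
    intro p z hp h0
    obtain ⟨U, hU, hUo, hxU⟩ := eventually_nhds_iff.1 (hp.eventually_eq_zero h0)
    refine ⟨U, hUo, hxU, fun g _ hg => ?_⟩
    have : fsmul (toComplex g) p = 0 := by
      rw [← fsmul_zero (toComplex g)]
      exact fsmul_congr fun x => or_iff_not_imp_right.2 fun h => hg x fun hx => h (hU x hx)
    rw [this, map_zero, hσ.map_zero]
  by_cases hQ0 : Θ.Q x₀ = 0
  · refine ⟨0, fun p hp _ hQp _ => ?_⟩
    have h0 : p x₀ = 0 := by
      rw [← hQp, MF.mul_apply, hQ0, zero_mul]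
    obtain ⟨U, h1, h2, h3⟩ := hzero p 0 hp h0
    exact ⟨U, h1, h2, fun g hg hgU => by rw [h3 g hg hgU, Pi.zero_apply, mul_zero]⟩
  obtain ⟨v₀, hv₀, -, -⟩ := Mat.exists_unit_vector (hQ x₀) hQ0
  refine ⟨fun g => σ (Θ.toFun (fsmul (toComplex g) (rankOnePiece Θ.Q v₀))), fun p hp hps hQp hpQ => ?_⟩
  -- The induction is on an integer bound for the trace, so integrality of ranks is never needed: a
  -- projection of trace at most 0 vanishes.
  obtain ⟨k, hk⟩ := exists_nat_ge (p x₀).trace.re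
  induction k generalizing p with
  | zero =>
    have h0 := Mat.eq_zero_of_trace_re_nonpos hp.self_of_nhds (by simpa using hk)
    obtain ⟨U, h1, h2, h3⟩ := hzero p 0 hp h0
    exact ⟨U, h1, h2, fun g hg hgU => by rw [h3 g hg hgU, h0, map_zero, zero_mul]⟩
  | succ k ih =>
    by_cases h0 : p x₀ = 0
    · obtain ⟨U, h1, h2, h3⟩ := hzero p 0 hp h0
      exact ⟨U, h1, h2, fun g hg hgU => by rw [h3 g hg hgU, h0, map_zero, zero_mul]⟩
    obtain ⟨v, hv1, hv2, hv3⟩ := Mat.exists_unit_vector hp.self_of_nhds h0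
    set e := rankOnePiece p v with he
    have hes : IsSelfAdjoint e := isSelfAdjoint_rankOnePiece hps v
    have hnear : ∀ᶠ x in 𝓝 x₀, IsStarProjection (p x) ∧ IsStarProjection (e x) ∧
        p x * e x = e x ∧ e x * p x = e x := by
      filter_upwards [hp, eventually_form_gt hv1] with x h1 h2
      exact ⟨h1, rankOnePiece_isStarProjection h1 h2⟩
    have hQe : Θ.Q * e = e := by
      rw [he, rankOnePiece, mul_fsmul, ← mul_assoc, ← mul_assoc, hQp]
    have heQ : e * Θ.Q = e := by
      rw [he, rankOnePiece, fsmul_mul, mul_assoc, hpQ]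
    have htr : (e x₀).trace = 1 := by
      rw [he, rankOnePiece_self hp.self_of_nhds hv1 hv2 hv3, hv2, Mat.trace_mul_dyad, hv1]
    have hp' : ProjNear x₀ (p - e) := by
      filter_upwards [hnear] with x hx
      exact isStarProjection_sub hx.1 hx.2.1 hx.2.2.1 hx.2.2.2
    have htr' : ((p - e) x₀).trace = (p x₀).trace - 1 := by
      rw [MF.sub_apply, map_sub, htr]
    obtain ⟨U₁, hU₁, hx₁, h₁⟩ := ih (p - e) hp' (hps.sub hes) (by rw [mul_sub, hQp, hQe])
      (by rw [sub_mul, hpQ, heQ]) (by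
        rw [htr', Complex.sub_re, Complex.one_re]
        push_cast at hk
        linarith)
    obtain ⟨U₂, hU₂, hx₂, h₂⟩ := Θ.rankOnePiece_equiv hσ hp
      (Eventually.of_forall hQ : ProjNear x₀ Θ.Q) hv1 hv₀ hQp
      Θ.isStarProjection.isIdempotentElem.eq
    obtain ⟨U₃, h₃, hU₃, hx₃⟩ := eventually_nhds_iff.1 hnear
    refine ⟨U₁ ∩ U₂ ∩ U₃, (hU₁.inter hU₂).inter hU₃, ⟨⟨hx₁, hx₂⟩, hx₃⟩, fun g hg hgU => ?_⟩
    have e1 : fsmul (toComplex g) p = fsmul (toComplex g) e + fsmul (toComplex g) (p - e) := by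
      rw [← fsmul_add, add_sub_cancel]
    have hz1 : fsmul (toComplex g) e * fsmul (toComplex g) (p - e) = 0 := by
      have : fsmul (toComplex g) (e * (p - e)) = fsmul (toComplex g) 0 := by
        refine fsmul_congr fun x => or_iff_not_imp_right.2 fun h => hgU x fun hx => h ?_
        obtain ⟨-, h6, h7, h8⟩ := h₃ x hx.2
        rw [MF.mul_apply, MF.sub_apply, mul_sub, h8, h6.isIdempotentElem.eq,
          sub_self]
        rfl
      rw [fsmul_mul_fsmul, ← fsmul_fsmul, this, fsmul_zero, fsmul_zero]
    have hz2 : fsmul (toComplex g) (p - e) * fsmul (toComplex g) e = 0 := by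
      have := congrArg star hz1
      rwa [star_mul, (isSelfAdjoint_fsmul hes g).star_eq, (isSelfAdjoint_fsmul (hps.sub hes) g).star_eq, star_zero] at this
    rw [e1, Θ.quasitrace_add hσ (isSelfAdjoint_fsmul hes g) (isSelfAdjoint_fsmul (hps.sub hes) g) (by rw [fsmul_mul, heQ])
      (by rw [fsmul_mul, sub_mul, hpQ, heQ]) (by rw [Commute, SemiconjBy, hz1, hz2]),
      h₂ g hg (fun x hx => hgU x fun h => hx h.1.2), h₁ g hg (fun x hx => hgU x fun h => hx h.1.1),
      htr']
    ring

end CornerMap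

/-! ### Spectral separation and functional calculus in a corner -/

theorem Mat.finite_spectrum {n : ℕ} (a : Mat n ℂ) : (spectrum ℝ a).Finite :=
  Matrix.finite_real_spectrum (𝕜 := ℂ) (A := (a : Matrix (Fin n) (Fin n) ℂ))

/-- The points of a finite set of reals are uniformly separated. -/
theorem Set.Finite.exists_separation {S : Set ℝ} (hS : S.Finite) :
    ∃ δ > 0, ∀ s ∈ S, ∀ t ∈ S, s ≠ t → δ ≤ |s - t| := by
  classical
  induction S, hS using Set.Finite.induction_on with
  | empty => exact ⟨1, one_pos, by simp⟩
  | @insert a S ha hS ih =>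
    obtain ⟨δ, hδ, h⟩ := ih
    obtain ⟨δ', hδ', h'⟩ : ∃ δ' > 0, ∀ s ∈ S, δ' ≤ |a - s| := by
      rcases S.eq_empty_or_nonempty with rfl | hne
      · exact ⟨1, one_pos, by simp⟩
      · obtain ⟨b, hb, hmin⟩ := hS.exists_minimalFor (fun s => |a - s|) S hne
        refine ⟨|a - b|, abs_pos.2 (sub_ne_zero.2 fun h => ha (h ▸ hb)), fun s hs => ?_⟩
        rcases le_total (|a - b|) (|a - s|) with h1 | h1
        exacts [h1, hmin hs h1]
    refine ⟨min δ δ', lt_min hδ hδ', ?_⟩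
    rintro s (rfl | hs) t (rfl | ht) hst
    · exact absurd rfl hst
    · exact (min_le_right _ _).trans (h' t ht)
    · rw [abs_sub_comm]; exact (min_le_right _ _).trans (h' s hs)
    · exact (min_le_left _ _).trans (h s hs t ht hst)

/-- A bump function at `l` of width `η`. -/
def bump (η l t : ℝ) : ℝ := max 0 (min 1 (2 - |t - l| / η))

theorem continuous_bump (η l : ℝ) : Continuous (bump η l) := by
  unfold bump; fun_prop

theorem bump_eq_one {η l t : ℝ} (hη : 0 < η) (h : |t - l| < η) : bump η l t = 1 := by
  have : |t - l| / η ≤ 1 := (div_le_one hη).2 h.le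
  rw [bump, min_eq_left (by linarith), max_eq_right zero_le_one]

theorem bump_eq_zero {η l t : ℝ} (hη : 0 < η) (h : 2 * η ≤ |t - l|) : bump η l t = 0 := by
  have : 2 ≤ |t - l| / η := (le_div_iff₀ hη).2 h
  rw [bump, max_eq_left]
  exact (min_le_right _ _).trans (by linarith)

/-- With separation 3η, a point within η of l₀ is at least 2η away from every other l, where the
bump at l has vanished. -/
theorem bump_cases {S : Set ℝ} {η : ℝ} (hη : 0 < η)
    (hS : ∀ s ∈ S, ∀ t ∈ S, s ≠ t → 3 * η ≤ |s - t|) {l₀ t : ℝ} (hl₀ : l₀ ∈ S)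
    (ht : |t - l₀| < η) {l : ℝ} (hl : l ∈ S) : bump η l t = if l = l₀ then 1 else 0 := by
  split_ifs with h
  · subst h; exact bump_eq_one hη ht
  · refine bump_eq_zero hη ?_
    have h1 := hS l hl l₀ hl₀ h
    have h2 := abs_sub_le l t l₀
    rw [abs_sub_comm l t] at h2
    linarith

namespace CornerMap

variable {X : Type} [TopologicalSpace X] [CompactSpace X] {n : ℕ} {A : Type u} [CStarAlgebra A]
  (Θ : CornerMap X n A) {σ : A → ℂ}

theorem isStarProjection_apply (x : X) : IsStarProjection (Θ.Q x) :=
  ⟨congrArg (fun f : MF X n => f x) Θ.isStarProjection.isIdempotentElem.eq,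
    congrArg (fun f : MF X n => f x) Θ.isStarProjection.isSelfAdjoint.star_eq⟩

/-- Functional calculus in the corner. -/
def cornerCfc (a : ℝ → ℝ) (w : MF X n) : MF X n := Θ.Q * cfc a w

section CornerCfc

variable {w : MF X n} (hw : IsSelfAdjoint w) (hQw : Θ.Q * w = w) (hwQ : w * Θ.Q = w)
include hw hQw hwQ

theorem commute_cfc (a : ℝ → ℝ) : Commute Θ.Q (cfc a w) :=
  ((show Commute w Θ.Q by rw [Commute, SemiconjBy, hQw, hwQ]).cfc_real a).symm

omit hw hQw hwQ in
theorem Q_mul_cornerCfc (a : ℝ → ℝ) : Θ.Q * Θ.cornerCfc a w = Θ.cornerCfc a w := by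
  rw [cornerCfc, ← mul_assoc, Θ.isStarProjection.isIdempotentElem.eq]

theorem cornerCfc_mul_Q (a : ℝ → ℝ) : Θ.cornerCfc a w * Θ.Q = Θ.cornerCfc a w := by
  rw [cornerCfc, mul_assoc, ← (Θ.commute_cfc hw hQw hwQ a).eq, ← mul_assoc,
    Θ.isStarProjection.isIdempotentElem.eq]

theorem isSelfAdjoint_cornerCfc (a : ℝ → ℝ) : IsSelfAdjoint (Θ.cornerCfc a w) := by
  have h1 : IsSelfAdjoint (cfc a w) := cfc_predicate _ _
  rw [IsSelfAdjoint, cornerCfc, star_mul, h1.star_eq, Θ.isStarProjection.isSelfAdjoint.star_eq,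
    (Θ.commute_cfc hw hQw hwQ a).eq]

theorem cornerCfc_mul {a b : ℝ → ℝ} (ha : Continuous a) (hb : Continuous b) :
    Θ.cornerCfc a w * Θ.cornerCfc b w = Θ.cornerCfc (fun t => a t * b t) w := by
  rw [cornerCfc, cornerCfc, cornerCfc, cfc_mul a b w ha.continuousOn hb.continuousOn, ← mul_assoc,
    mul_assoc Θ.Q (cfc a w) Θ.Q, ← (Θ.commute_cfc hw hQw hwQ a).eq, ← mul_assoc,
    Θ.isStarProjection.isIdempotentElem.eq, mul_assoc]

theorem cornerCfc_commute {a b : ℝ → ℝ} (ha : Continuous a) (hb : Continuous b) (g h : C(X, ℂ)) :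
    Commute (fsmul g (Θ.cornerCfc a w)) (fsmul h (Θ.cornerCfc b w)) := by
  rw [Commute, SemiconjBy, fsmul_mul_fsmul, fsmul_mul_fsmul, Θ.cornerCfc_mul hw hQw hwQ ha hb,
    Θ.cornerCfc_mul hw hQw hwQ hb ha, mul_comm g h]
  simp only [mul_comm]

theorem cornerCfc_id : Θ.cornerCfc (fun t => t) w = w := by
  rw [cornerCfc, cfc_id' ℝ w hw, hQw]

omit hQw hwQ in
theorem cornerCfc_apply {a : ℝ → ℝ} (ha : Continuous a) (x : X) :
    Θ.cornerCfc a w x = Θ.Q x * cfc a (w x) := by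
  rw [cornerCfc, MF.mul_apply]
  congr 1
  have hx : IsSelfAdjoint (w x) := congrArg (fun f : MF X n => f x) hw.star_eq
  exact StarAlgHom.map_cfc (MF.eval x) a w ha.continuousOn
    (MF.continuous_eval x) hw hx

omit hQw hwQ in
theorem cornerCfc_congr {a b : ℝ → ℝ} (ha : Continuous a) (hb : Continuous b) {x : X}
    (h : ∀ t ∈ spectrum ℝ (w x), a t = b t) : Θ.cornerCfc a w x = Θ.cornerCfc b w x := by
  rw [Θ.cornerCfc_apply hw ha, Θ.cornerCfc_apply hw hb, cfc_congr h]

/-- The spectrum of a matrix valued function is upper semicontinuous. -/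
theorem eventually_spectrum (x₀ : X) {η : ℝ} (hη : 0 < η) :
    ∀ᶠ x in 𝓝 x₀, ∀ t ∈ spectrum ℝ (w x), ∃ l ∈ spectrum ℝ (w x₀), |t - l| < η := by
  classical
  set S := (Mat.finite_spectrum (w x₀)).toFinset with hS
  -- d is the product of the t - l over the spectrum at x₀, so d(w) vanishes at x₀ and is small
  -- nearby; at distance at least η from all the l it would be at least η to the number of factors.
  set d : ℝ → ℝ := fun t => ∏ l ∈ S, (t - l) with hd
  have hdc : Continuous d := by fun_prop
  have hsa : ∀ x, IsSelfAdjoint (w x) := fun x =>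
    congrArg (fun f : MF X n => f x) hw.star_eq
  have happ : ∀ x, (cfc d w) x = cfc d (w x) := fun x =>
    StarAlgHom.map_cfc (MF.eval x) d w hdc.continuousOn
      (MF.continuous_eval x) hw (hsa x)
  have h0 : (cfc d w) x₀ = 0 := by
    rw [happ, ← cfc_zero (R := ℝ) (w x₀)]
    refine cfc_congr fun t ht => ?_
    exact Finset.prod_eq_zero (i := t) ((Set.Finite.mem_toFinset _).2 ht) (sub_self t)
  have hc : Continuous fun x => ‖(cfc d w) x‖ := (cfc d w).continuous.norm
  have hlt : ∀ᶠ x in 𝓝 x₀, ‖(cfc d w) x‖ < η ^ S.card :=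
    hc.continuousAt.eventually_lt_const (by simp only [h0, norm_zero]; positivity)
  filter_upwards [hlt] with x hx t ht
  by_contra! hcon
  rw [happ] at hx
  have h1 := (norm_apply_le_norm_cfc d (w x) ht hdc.continuousOn (hsa x)).trans_lt hx
  have h2 : η ^ S.card ≤ ‖d t‖ := by
    rw [hd, norm_prod, ← Finset.prod_const]
    refine Finset.prod_le_prod (fun _ _ => hη.le) fun l hl => ?_
    exact hcon l ((Set.Finite.mem_toFinset _).1 hl)
  linarith

end CornerCfc

end CornerMap

/-! ### Local estimates for quasitraces -/

namespace CornerMap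

variable {X : Type} [TopologicalSpace X] [CompactSpace X] {n : ℕ} {A : Type u} [CStarAlgebra A]
  (Θ : CornerMap X n A) {σ : A → ℂ}

theorem cornerCfc_add {a b : ℝ → ℝ} (ha : Continuous a) (hb : Continuous b) (w : MF X n) :
    Θ.cornerCfc (fun t => a t + b t) w = Θ.cornerCfc a w + Θ.cornerCfc b w := by
  rw [cornerCfc, cornerCfc, cornerCfc, cfc_add w a b ha.continuousOn hb.continuousOn, mul_add]

theorem cornerCfc_const_mul {a : ℝ → ℝ} (c : ℝ) (ha : Continuous a) (w : MF X n) :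
    Θ.cornerCfc (fun t => c * a t) w = (c : ℂ) • Θ.cornerCfc a w := by
  rw [cornerCfc, cornerCfc, cfc_const_mul c a w ha.continuousOn, ← mul_smul_comm]
  rfl

theorem cornerCfc_sum {ι : Type*} {a : ι → ℝ → ℝ} (t : Finset ι) (ha : ∀ i, Continuous (a i))
    (w : MF X n) : Θ.cornerCfc (fun y => ∑ i ∈ t, a i y) w = ∑ i ∈ t, Θ.cornerCfc (a i) w := by
  have : (fun y => ∑ i ∈ t, a i y) = ∑ i ∈ t, a i := by ext y; simp
  rw [cornerCfc, this, cfc_sum a w t fun i _ => (ha i).continuousOn, Finset.mul_sum]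
  rfl

theorem cornerCfc_const (c : ℝ) {w : MF X n} (hw : IsSelfAdjoint w) :
    Θ.cornerCfc (fun _ => c) w = (c : ℂ) • Θ.Q := by
  rw [cornerCfc, cfc_const c w hw, Algebra.algebraMap_eq_smul_one, mul_smul_comm, mul_one]
  exact (Complex.coe_smul c _).symm

/-- Multiplication by a scalar function as a linear map. -/
def _root_.CStarCuntz.fsmulL (g : C(X, ℂ)) : MF X n →ₗ[ℂ] MF X n where
  toFun := fsmul g
  map_add' := fsmul_add g
  map_smul' := fsmul_smul g

theorem nonneg_of_star_mul_self [PartialOrder A] [StarOrderedRing A] {y : MF X n}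
    (hy : Θ.Q * y = y) : 0 ≤ Θ.toFun (star y * y) := by
  have h : star y * Θ.Q = star y := by
    have := congrArg star hy
    rwa [star_mul, Θ.isStarProjection.isSelfAdjoint.star_eq] at this
  rw [← Θ.map_mul_of_left h, Θ.map_star]
  exact star_mul_self_nonneg _

/-- The element is y⋆y for y = √g · √(a⁺)(w); the sign of a matters only over the support of g. -/
theorem nonneg_fsmul_cornerCfc [PartialOrder A] [StarOrderedRing A] {w : MF X n}
    (hw : IsSelfAdjoint w) (hQw : Θ.Q * w = w) (hwQ : w * Θ.Q = w) {a : ℝ → ℝ} (ha : Continuous a)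
    {g : C(X, ℝ)} (hg : ∀ x, 0 ≤ g x)
    (hga : ∀ x, g x = 0 ∨ ∀ t ∈ spectrum ℝ (w x), 0 ≤ a t) :
    0 ≤ Θ.toFun (fsmul (toComplex g) (Θ.cornerCfc a w)) := by
  set b : ℝ → ℝ := fun t => √(max (a t) 0) with hb
  have hbc : Continuous b := by fun_prop
  set s : C(X, ℝ) := ⟨fun x => √(g x), by fun_prop⟩ with hs
  set y : MF X n := fsmul (toComplex s) (Θ.cornerCfc b w) with hy
  have e : star y * y = fsmul (toComplex g) (Θ.cornerCfc a w) := by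
    rw [hy, (isSelfAdjoint_fsmul (Θ.isSelfAdjoint_cornerCfc hw hQw hwQ b) s).star_eq,
      fsmul_mul_fsmul, Θ.cornerCfc_mul hw hQw hwQ hbc hbc]
    have : toComplex s * toComplex s = toComplex g := by
      ext x
      simp only [ContinuousMap.mul_apply, toComplex_apply, ← Complex.ofReal_mul, hs,
        ContinuousMap.coe_mk, Real.mul_self_sqrt (hg x)]
    rw [this]
    refine fsmul_congr fun x => (hga x).imp_right fun h => ?_
    refine Θ.cornerCfc_congr hw (a := fun t => b t * b t) (hbc.mul hbc) ha fun t ht => ?_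
    simp only [hb, max_eq_left (h t ht), Real.mul_self_sqrt (h t ht)]
  rw [← e]
  refine Θ.nonneg_of_star_mul_self ?_
  rw [hy, mul_fsmul, Θ.Q_mul_cornerCfc]

/-- Locally, a quasitrace is small on elements with vanishing trace at the base point. -/
theorem quasitrace_local_bound [PartialOrder A] [StarOrderedRing A] (hσ : IsQuasitrace σ)
    {w : MF X n} (hw : IsSelfAdjoint w) (hQw : Θ.Q * w = w) (hwQ : w * Θ.Q = w) {x₀ : X}
    (htr : (w x₀).trace = 0) {η : ℝ} (hη : 0 < η) : ∃ U, IsOpen U ∧ x₀ ∈ U ∧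
      ∀ g : C(X, ℝ), (∀ x, 0 ≤ g x) → (∀ x ∉ U, g x = 0) →
        ‖σ (Θ.toFun (fsmul (toComplex g) w))‖ ≤ η * (σ (Θ.toFun (fsmul (toComplex g) Θ.Q))).re := by
  classical
  obtain ⟨κ, hκ⟩ := Θ.exists_rank_function hσ x₀
  have hfin := Mat.finite_spectrum (w x₀)
  obtain ⟨δ, hδ, hsep⟩ := Set.Finite.exists_separation hfin
  -- At most η so that rounding the spectrum costs at most η; at most a third of the spectral gap so
  -- that `bump_cases` applies.
  set η' := min η (δ / 3) with hη'
  have hη'0 : 0 < η' := lt_min hη (by positivity)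
  have hsep' : ∀ s ∈ spectrum ℝ (w x₀), ∀ t ∈ spectrum ℝ (w x₀), s ≠ t → 3 * η' ≤ |s - t| :=
    fun s hs t ht h => by
      have := hsep s hs t ht h
      have := min_le_right η (δ / 3)
      linarith
  set S := hfin.toFinset with hS
  have hmemS : ∀ {l}, l ∈ S ↔ l ∈ spectrum ℝ (w x₀) := hfin.mem_toFinset
  set p : ℝ → MF X n := fun l => Θ.cornerCfc (bump η' l) w with hp
  have hps : ∀ l, IsSelfAdjoint (p l) := fun l => Θ.isSelfAdjoint_cornerCfc hw hQw hwQ _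
  have hQp : ∀ l, Θ.Q * p l = p l := fun l => Θ.Q_mul_cornerCfc _
  have hpQ : ∀ l, p l * Θ.Q = p l := fun l => Θ.cornerCfc_mul_Q hw hQw hwQ _
  have hbc : ∀ l, Continuous (bump η' l) := continuous_bump η'
  have hev := Θ.eventually_spectrum hw hQw hwQ x₀ hη'0
  have hnear : ∀ l ∈ S, ProjNear x₀ (p l) := by
    intro l hl
    filter_upwards [hev] with x hx
    refine ⟨?_, congrArg (fun f : MF X n => f x) (hps l).star_eq⟩
    rw [IsIdempotentElem, ← MF.mul_apply, Θ.cornerCfc_mul hw hQw hwQ (hbc l) (hbc l)]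
    refine Θ.cornerCfc_congr hw (a := fun t => bump η' l t * bump η' l t)
      ((hbc l).mul (hbc l)) (hbc l) fun t ht => ?_
    obtain ⟨l₀, hl₀, hlt⟩ := hx t ht
    simp only [bump_cases hη'0 hsep' hl₀ hlt (hmemS.1 hl)]
    split_ifs <;> simp
  have hU : ∀ l ∈ S, ∃ U, IsOpen U ∧ x₀ ∈ U ∧ ∀ g : C(X, ℝ), (∀ x, 0 ≤ g x) →
      (∀ x ∉ U, g x = 0) →
        σ (Θ.toFun (fsmul (toComplex g) (p l))) = (p l x₀).trace * κ g := fun l hl =>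
    hκ (p l) (hnear l hl) (hps l) (hQp l) (hpQ l)
  choose! U hUo hxU hUg using hU
  obtain ⟨V, hV, hVo, hxV⟩ := eventually_nhds_iff.1 hev
  set W : Set X := V ∩ ⋂ l ∈ S, U l with hW
  refine ⟨W, hVo.inter (isOpen_biInter_finset hUo), ⟨hxV, Set.mem_iInter₂.2 hxU⟩,
    fun g hg hgW => ?_⟩
  -- Near x₀, s rounds each spectral value to the eigenvalue of w x₀ it came from. Thus w = ∑ l p_l
  -- + R with spectral projections p_l and R of size at most η.
  set s : ℝ → ℝ := fun t => ∑ l ∈ S, l * bump η' l t with hs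
  have hsc : Continuous s := continuous_finset_sum _ fun l _ => continuous_const.mul (hbc l)
  have hsval : ∀ {l₀ t}, l₀ ∈ spectrum ℝ (w x₀) → |t - l₀| < η' → s t = l₀ := by
    intro l₀ t hl₀ ht
    rw [hs]
    simp only
    rw [Finset.sum_congr rfl fun l hl => by
      rw [bump_cases hη'0 hsep' hl₀ ht (hmemS.1 hl)]]
    simp [hmemS.2 hl₀]
  have hrc : Continuous fun t => t - s t := continuous_id.sub hsc
  set R := Θ.cornerCfc (fun t => t - s t) w with hR
  have hcs : Θ.cornerCfc s w = ∑ l ∈ S, (l : ℂ) • p l := by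
    rw [hs, Θ.cornerCfc_sum (a := fun l t => l * bump η' l t) S
      fun l => continuous_const.mul (hbc l)]
    exact Finset.sum_congr rfl fun l _ => Θ.cornerCfc_const_mul l (hbc l) w
  have hwsum : w = Θ.cornerCfc s w + R := by
    rw [hR, ← Θ.cornerCfc_add hsc hrc]
    simp only [add_sub_cancel]
    exact (Θ.cornerCfc_id hw hQw hwQ).symm
  have hRs : IsSelfAdjoint R := Θ.isSelfAdjoint_cornerCfc hw hQw hwQ _
  have hRQ : R * Θ.Q = R := Θ.cornerCfc_mul_Q hw hQw hwQ _
  -- the main part contributes nothing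
  have hmain : σ (Θ.toFun (fsmul (toComplex g) (Θ.cornerCfc s w))) = 0 := by
    have h1 : Θ.toFun (fsmul (toComplex g) (Θ.cornerCfc s w))
        = ∑ l ∈ S, (l : ℂ) • Θ.toFun (fsmul (toComplex g) (p l)) := by
      rw [hcs]
      change (Θ.toFun ∘ₗ fsmulL (toComplex g)) _ = _
      rw [map_sum]
      exact Finset.sum_congr rfl fun l _ => map_smul _ _ _
    have hsa : ∀ l, IsSelfAdjoint (Θ.toFun (fsmul (toComplex g) (p l))) := fun l =>
      Θ.isSelfAdjoint (isSelfAdjoint_fsmul (hps l) g)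
    have hcom : ∀ l k, Commute (Θ.toFun (fsmul (toComplex g) (p l)))
        (Θ.toFun (fsmul (toComplex g) (p k))) := fun l k =>
      Θ.commute (by rw [fsmul_mul, hpQ]) (by rw [fsmul_mul, hpQ])
        (Θ.cornerCfc_commute hw hQw hwQ (hbc l) (hbc k) _ _)
    -- The common factor κ g leaves ∑ l tr(p_l x₀), which is the trace of w x₀.
    have h2 : ∑ l ∈ S, (l : ℂ) * (p l x₀).trace = 0 := by
      have h3 : Θ.cornerCfc s w x₀ = w x₀ := by
        conv_rhs => rw [← Θ.cornerCfc_id hw hQw hwQ]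
        refine Θ.cornerCfc_congr hw hsc continuous_id fun t ht => ?_
        exact hsval ht (by simpa using hη'0)
      rw [← htr, ← h3, hcs]
      change _ = Mat.trace (MF.eval x₀ _)
      rw [map_sum, map_sum]
      refine Finset.sum_congr rfl fun l _ => ?_
      rw [map_smul, map_smul, smul_eq_mul]
      rfl
    rw [h1, hσ.map_sum S (fun l _ => (IsSelfAdjoint.smul (Complex.conj_ofReal l) (hsa l)))
      (fun l _ k _ => ((hcom l k).smul_left _).smul_right _)]
    calc _ = ∑ l ∈ S, ((l : ℂ) * (p l x₀).trace) * κ g := by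
          refine Finset.sum_congr rfl fun l hl => ?_
          rw [hσ.map_smul (hsa l), hUg l hl g hg fun x hx =>
            hgW x fun h => hx (Set.mem_iInter₂.1 h.2 l hl), mul_assoc]
      _ = 0 := by rw [← Finset.sum_mul, h2, zero_mul]
  have hsplit : σ (Θ.toFun (fsmul (toComplex g) w)) = σ (Θ.toFun (fsmul (toComplex g) R)) := by
    conv_lhs => rw [hwsum, fsmul_add]
    rw [Θ.quasitrace_add hσ
      (isSelfAdjoint_fsmul (Θ.isSelfAdjoint_cornerCfc hw hQw hwQ s) g) (isSelfAdjoint_fsmul hRs g)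
      (by rw [fsmul_mul, Θ.cornerCfc_mul_Q hw hQw hwQ]) (by rw [fsmul_mul, hRQ])
      (Θ.cornerCfc_commute hw hQw hwQ hsc hrc _ _), hmain, zero_add]
  have hQc := Θ.cornerCfc_const 1 hw
  rw [Complex.ofReal_one, one_smul] at hQc
  have hbound : ∀ x, g x = 0 ∨ ∀ t ∈ spectrum ℝ (w x), |t - s t| ≤ η := by
    intro x
    refine or_iff_not_imp_right.2 fun h => hgW x fun hx => h fun t ht => ?_
    obtain ⟨l₀, hl₀, hlt⟩ := hV x hx.1 t ht
    rw [hsval hl₀ hlt]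
    exact hlt.le.trans (min_le_left _ _)
  have hQs := Θ.isStarProjection.isSelfAdjoint
  have hQQ := Θ.isStarProjection.isIdempotentElem.eq
  rw [hsplit]
  -- The remainder satisfies -ηQ ≤ R ≤ ηQ over the support of g, and it commutes with Q.
  refine hσ.abs_re_le (Θ.isSelfAdjoint (isSelfAdjoint_fsmul hRs g))
    (Θ.isSelfAdjoint (isSelfAdjoint_fsmul hQs g))
    (Θ.commute (by rw [fsmul_mul, hRQ]) (by rw [fsmul_mul, hQQ]) ?_) ?_ ?_
  · rw [← hQc]
    exact Θ.cornerCfc_commute hw hQw hwQ hrc continuous_const _ _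
  · have := Θ.nonneg_fsmul_cornerCfc hw hQw hwQ (a := fun t => η + (-1) * (t - s t))
      (by fun_prop) hg fun x => (hbound x).imp_right fun h t ht => by
        have := (abs_le.1 (h t ht)).2
        linarith
    rw [Θ.cornerCfc_add continuous_const (by fun_prop), Θ.cornerCfc_const η hw,
      Θ.cornerCfc_const_mul (-1) hrc, ← hR] at this
    rw [fsmul_add, fsmul_smul, fsmul_smul, map_add, map_smul, map_smul] at this
    simpa [sub_eq_add_neg] using this
  · have := Θ.nonneg_fsmul_cornerCfc hw hQw hwQ (a := fun t => η + (t - s t))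
      (by fun_prop) hg fun x => (hbound x).imp_right fun h t ht => by
        have := (abs_le.1 (h t ht)).1
        linarith
    rw [Θ.cornerCfc_add continuous_const hrc, Θ.cornerCfc_const η hw, ← hR] at this
    rw [fsmul_add, fsmul_smul, map_add, map_smul] at this
    exact this

end CornerMap

/-! ### Quasitraces on a corner are integrals of the pointwise trace -/

namespace CornerMap

variable {X : Type} [TopologicalSpace X] [CompactSpace X] {n : ℕ} {A : Type u} [CStarAlgebra A]
  (Θ : CornerMap X n A) {σ : A → ℂ}

theorem sum_fsmul {ι : Type*} (t : Finset ι) (g : ι → C(X, ℝ)) (hg : ∀ x, ∑ i ∈ t, g i x = 1)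
    (w : MF X n) : ∑ i ∈ t, fsmul (toComplex (g i)) w = w := by
  have h1 : ∀ x, (∑ i ∈ t, fsmul (toComplex (g i)) w) x = ∑ i ∈ t, (g i x : ℂ) • w x := fun x => by
    change MF.eval x _ = _
    rw [map_sum]
    rfl
  refine MF.ext fun x => ?_
  rw [h1]
  refine (Finset.sum_smul (R := ℂ) (M := Mat n ℂ)).symm.trans ?_
  rw [← Complex.ofReal_sum, hg, Complex.ofReal_one, one_smul]

theorem quasitrace_sum (hσ : IsQuasitrace σ) {ι : Type*} (t : Finset ι) (g : ι → C(X, ℝ))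
    (hg : ∀ x, ∑ i ∈ t, g i x = 1) {w : MF X n} (hw : IsSelfAdjoint w) (hwQ : w * Θ.Q = w) :
    σ (Θ.toFun w) = ∑ i ∈ t, σ (Θ.toFun (fsmul (toComplex (g i)) w)) := by
  conv_lhs => rw [← sum_fsmul t g hg w, map_sum]
  refine hσ.map_sum t (fun i _ => Θ.isSelfAdjoint (isSelfAdjoint_fsmul hw _)) fun i _ j _ =>
    Θ.commute (by rw [fsmul_mul, hwQ]) (by rw [fsmul_mul, hwQ]) ?_
  rw [Commute, SemiconjBy, fsmul_mul_fsmul, fsmul_mul_fsmul, mul_comm]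

/-- Quasitraces vanish on elements with vanishing pointwise trace. -/
theorem quasitrace_eq_zero [T2Space X] [PartialOrder A] [StarOrderedRing A]
    (hσ : IsQuasitrace σ) {w : MF X n} (hw : IsSelfAdjoint w) (hQw : Θ.Q * w = w)
    (hwQ : w * Θ.Q = w) (htr : ∀ x, (w x).trace = 0) : σ (Θ.toFun w) = 0 := by
  -- A partition of unity adds the local bounds to η σ(Q), and η is arbitrary.
  have key : ∀ η > 0, ‖σ (Θ.toFun w)‖ ≤ η * (σ (Θ.toFun Θ.Q)).re := by
    intro η hη
    have h := fun x => Θ.quasitrace_local_bound hσ hw hQw hwQ (htr x) hη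
    choose U hU hxU hUg using h
    obtain ⟨t, ht⟩ := isCompact_univ.elim_finite_subcover U hU
      fun x _ => Set.mem_iUnion.2 ⟨x, hxU x⟩
    obtain ⟨g, hg1, hg2, hg3, -⟩ := exists_continuous_sum_one_of_isOpen_isCompact
      (s := fun i => U (t.equivFin.symm i)) (fun i => hU _) isCompact_univ (by
        intro x hx
        obtain ⟨y, hy, hxy⟩ := Set.mem_iUnion₂.1 (ht hx)
        exact Set.mem_iUnion.2 ⟨t.equivFin ⟨y, hy⟩, by simpa using hxy⟩)
    have hsum : ∀ x, ∑ i ∈ Finset.univ, g i x = 1 := fun x => by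
      have := hg2 (Set.mem_univ x)
      simpa using this
    rw [Θ.quasitrace_sum hσ _ g hsum hw hwQ, Θ.quasitrace_sum hσ _ g hsum
      Θ.isStarProjection.isSelfAdjoint Θ.isStarProjection.isIdempotentElem.eq, Complex.re_sum,
      Finset.mul_sum]
    refine (norm_sum_le _ _).trans (Finset.sum_le_sum fun i _ => ?_)
    refine hUg (t.equivFin.symm i) (g i) (fun x => (hg3 i x).1) fun x hx => ?_
    by_contra h0
    exact hx (hg1 i (subset_tsupport _ h0))
  have hC : (0 : ℝ) ≤ (σ (Θ.toFun Θ.Q)).re := by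
    have := key 1 one_pos
    rw [one_mul] at this
    exact (norm_nonneg _).trans this
  refine norm_le_zero_iff.1 (le_of_forall_pos_le_add fun ε hε => ?_)
  have := key (ε / ((σ (Θ.toFun Θ.Q)).re + 1)) (by positivity)
  refine this.trans ?_
  rw [zero_add, div_mul_eq_mul_div, div_le_iff₀ (by positivity)]
  nlinarith

/-- The pointwise rank of the corner projection. -/
def rho : C(X, ℝ) := ⟨fun x => ((Θ.Q x).trace).re, by
  exact Complex.continuous_re.comp (Mat.trace.continuous.comp Θ.Q.continuous)⟩

/-- The pointwise trace of the compression to the corner. -/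
def tr (y : MF X n) : C(X, ℝ) := ⟨fun x => ((Θ.Q x * y x * Θ.Q x).trace).re, by
  exact Complex.continuous_re.comp (Mat.trace.continuous.comp (Θ.Q * y * Θ.Q).continuous)⟩

/-- The inverse of the rank, where it is not zero. -/
def invRho : C(X, ℝ) := ⟨fun x => Θ.rho x / (max (Θ.rho x) 1) ^ 2,
  Θ.rho.continuous.div₀ ((Θ.rho.continuous.max continuous_const).pow 2)
    fun x => (pow_pos (lt_max_of_lt_right one_pos) 2).ne'⟩

/-- A projection has rank 0 or at least 1, so the continuous expression ρ / max(ρ, 1)² is 0 in the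
first case and 1/ρ in the second. -/
theorem rho_cases (x : X) : (Θ.Q x = 0 ∧ Θ.rho x = 0 ∧ Θ.invRho x = 0) ∨
    (1 ≤ Θ.rho x ∧ Θ.invRho x * Θ.rho x = 1) := by
  by_cases h : Θ.Q x = 0
  · have : Θ.rho x = 0 := by simp [rho, h]
    exact Or.inl ⟨h, this, by simp [invRho, this]⟩
  · have h1 : 1 ≤ Θ.rho x := Mat.one_le_trace_re (Θ.isStarProjection_apply x) h
    refine Or.inr ⟨h1, ?_⟩
    have : Θ.rho x ≠ 0 := by linarith
    simp only [invRho, ContinuousMap.coe_mk, max_eq_left h1]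
    field_simp

theorem invRho_nonneg (x : X) : 0 ≤ Θ.invRho x := by
  have : 0 ≤ Θ.rho x := by
    rcases Θ.rho_cases x with h | h
    · exact h.2.1.ge
    · linarith [h.1]
  exact div_nonneg this (by positivity)

theorem Q_mul_mul_Q (y : MF X n) : Θ.Q * (Θ.Q * y * Θ.Q) = Θ.Q * y * Θ.Q := by
  rw [← mul_assoc, ← mul_assoc, Θ.isStarProjection.isIdempotentElem.eq]

theorem mul_Q_mul_Q (y : MF X n) : Θ.Q * y * Θ.Q * Θ.Q = Θ.Q * y * Θ.Q := by
  rw [mul_assoc, Θ.isStarProjection.isIdempotentElem.eq]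

theorem _root_.CStarCuntz.Mat.trace_im {n : ℕ} {a : Mat n ℂ} (ha : IsSelfAdjoint a) : a.trace.im = 0 := by
  rw [Mat.trace_apply, Complex.im_sum]
  refine Finset.sum_eq_zero fun i _ => ?_
  have := congrArg (fun b : Mat n ℂ => b.entry i i) ha.star_eq
  rw [Mat.entry_star, Complex.star_def] at this
  exact Complex.conj_eq_iff_im.1 this

/-- On a corner a quasitrace only depends on the pointwise trace. -/
theorem quasitrace_eq [T2Space X] [PartialOrder A] [StarOrderedRing A]
    (hσ : IsQuasitrace σ) {y : MF X n} (hy : IsSelfAdjoint y) :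
    σ (Θ.toFun y) = σ (Θ.toFun (fsmul (toComplex (Θ.invRho * Θ.tr y)) Θ.Q)) := by
  have hQs := Θ.isStarProjection.isSelfAdjoint
  have hQQ := Θ.isStarProjection.isIdempotentElem.eq
  -- z has the same pointwise trace as the compression v of y and is central in the corner, so v - z
  -- commutes with z and σ(v - z) = 0.
  set z := fsmul (toComplex (Θ.invRho * Θ.tr y)) Θ.Q with hz
  set v := Θ.Q * y * Θ.Q with hv
  have hvs : IsSelfAdjoint v := by
    rw [IsSelfAdjoint, hv, star_mul, star_mul, hQs.star_eq, hy.star_eq, mul_assoc]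
  have hzs : IsSelfAdjoint z := isSelfAdjoint_fsmul hQs _
  have hQv : Θ.Q * v = v := Θ.Q_mul_mul_Q y
  have hvQ : v * Θ.Q = v := Θ.mul_Q_mul_Q y
  have hQz : Θ.Q * z = z := by rw [hz, mul_fsmul, hQQ]
  have hzQ : z * Θ.Q = z := by rw [hz, fsmul_mul, hQQ]
  have hcom : Commute v z := by
    rw [Commute, SemiconjBy, hz, mul_fsmul, fsmul_mul, hvQ, hQv]
  have h0 : σ (Θ.toFun (v - z)) = 0 := by
    refine Θ.quasitrace_eq_zero hσ (hvs.sub hzs) (by rw [mul_sub, hQv, hQz])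
      (by rw [sub_mul, hvQ, hzQ]) fun x => ?_
    have h1 : (v x).trace = (Θ.tr y x : ℂ) :=
      Complex.ext rfl (Mat.trace_im (congrArg (fun f : MF X n => f x) hvs.star_eq))
    have h2 : (Θ.Q x).trace = (Θ.rho x : ℂ) :=
      Complex.ext rfl (Mat.trace_im (congrArg (fun f : MF X n => f x) hQs.star_eq))
    rw [MF.sub_apply, map_sub, hz, fsmul_apply, map_smul, h1, h2, toComplex_apply,
      ContinuousMap.mul_apply, smul_eq_mul, ← Complex.ofReal_mul, ← Complex.ofReal_sub]
    norm_cast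
    rcases Θ.rho_cases x with ⟨h3, h4, h5⟩ | ⟨-, h3⟩
    · have : Θ.tr y x = 0 := by simp [tr, h3]
      rw [this, h4]; ring
    · linear_combination (-(Θ.tr y x)) * h3
  rw [← Θ.map_cut y, ← hv]
  conv_lhs => rw [← sub_add_cancel v z]
  rw [Θ.quasitrace_add hσ (hvs.sub hzs) hzs (by rw [sub_mul, hvQ, hzQ]) hzQ
    (hcom.sub_left (Commute.refl z)), h0, zero_add]

/-- Quasitraces are additive on the selfadjoint part of a corner. -/
theorem quasitrace_add_of_isSelfAdjoint [T2Space X] [PartialOrder A] [StarOrderedRing A]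
    (hσ : IsQuasitrace σ) {y y' : MF X n} (hy : IsSelfAdjoint y) (hy' : IsSelfAdjoint y') :
    σ (Θ.toFun (y + y')) = σ (Θ.toFun y) + σ (Θ.toFun y') := by
  have hQs := Θ.isStarProjection.isSelfAdjoint
  have hQQ := Θ.isStarProjection.isIdempotentElem.eq
  have h1 : Θ.tr (y + y') = Θ.tr y + Θ.tr y' := by
    ext x
    simp only [tr, ContinuousMap.add_apply, ContinuousMap.coe_mk, MF.add_apply, mul_add, add_mul,
      map_add, Complex.add_re]
  have h2 : toComplex (Θ.invRho * (Θ.tr y + Θ.tr y'))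
      = toComplex (Θ.invRho * Θ.tr y) + toComplex (Θ.invRho * Θ.tr y') := by
    ext x
    simp [mul_add]
  -- After the reduction all terms are multiples of Q by scalar functions; these commute and depend
  -- additively on the trace.
  rw [Θ.quasitrace_eq hσ hy, Θ.quasitrace_eq hσ hy', Θ.quasitrace_eq hσ (hy.add hy'), h1, h2,
    add_fsmul, Θ.quasitrace_add hσ (isSelfAdjoint_fsmul hQs _) (isSelfAdjoint_fsmul hQs _)
      (by rw [fsmul_mul, hQQ]) (by rw [fsmul_mul, hQQ])
      (by rw [Commute, SemiconjBy, fsmul_mul_fsmul, fsmul_mul_fsmul, mul_comm])]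

end CornerMap

/-! ### Tracial states from dense subalgebras -/

section Extension

variable {A : Type u} [CStarAlgebra A]

/-- Polarisation with a⋆ + b and a⋆ + ib. -/
theorem mul_comm_of_tracial {τ : A →ₗ[ℂ] ℂ} (h : ∀ x, τ (star x * x) = τ (x * star x)) (a b : A) :
    τ (a * b) = τ (b * a) := by
  have h1 := h (star a + b)
  have h2 := h (star a + Complex.I • b)
  simp only [star_add, star_star, star_smul, add_mul, mul_add, map_add, smul_mul_assoc,
    mul_smul_comm, map_smul, smul_eq_mul, Complex.star_def, Complex.conj_I] at h1 h2
  have h3 := h (star a)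
  have h4 := h b
  rw [star_star] at h3
  have hI := Complex.I_mul_I
  linear_combination (1 / 2 : ℂ) * h1 - (1 / 2 : ℂ) * Complex.I * h2
    + ((-1 + Complex.I) / 2) * h3 + ((-1 + Complex.I) / 2) * h4
    + (1 / 2 : ℂ) * (τ (a * b) - τ (b * a) - τ (star b * star a) + τ (star a * star b)
      - Complex.I * (τ (star b * b) - τ (b * star b))) * hI

/-- Tracial states may be constructed on a dense subalgebra. -/
theorem exists_tracialState {E : Type*} [NonUnitalRing E] [StarRing E] [Module ℂ E]
    (e : E →⋆ₙₐ[ℂ] A) (he : DenseRange e) (f : E →ₗ[ℂ] ℂ) {C : ℝ} (hC : ∀ x, ‖f x‖ ≤ C * ‖e x‖)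
    (hpos : ∀ x, 0 ≤ f (star x * x)) (htr : ∀ x, f (star x * x) = f (x * star x))
    {v : E} (hv : e v = 1) (hfv : f v = 1) :
    ∃ τ : tracialStates A, ∀ x, (τ : WeakDual ℂ A) (e x) = f x := by
  set eL : E →ₗ[ℂ] A :=
    { toFun := e, map_add' := map_add e, map_smul' := map_smul e } with heL
  set T : A →L[ℂ] ℂ := f.extendOfNorm eL with hT
  have hTe : ∀ x, T (e x) = f x := fun x =>
    LinearMap.extendOfNorm_eq (f := f) (e := eL) he ⟨C, hC⟩ x
  have h1 : ∀ a : A, 0 ≤ T (star a * a) := by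
    intro a
    refine he.induction_on (p := fun a => 0 ≤ T (star a * a)) a ?_ fun x => ?_
    · exact (isClosed_Ici (a := (0 : ℂ))).preimage (T.continuous.comp (by fun_prop))
    · rw [← map_star, ← map_mul, hTe]; exact hpos x
  have h2 : ∀ a : A, T (star a * a) = T (a * star a) := by
    intro a
    refine he.induction_on (p := fun a => T (star a * a) = T (a * star a)) a ?_ fun x => ?_
    · exact isClosed_eq (T.continuous.comp (by fun_prop)) (T.continuous.comp (by fun_prop))
    · rw [← map_star, ← map_mul, ← map_mul, hTe, hTe, htr]
  refine ⟨⟨StrongDual.toWeakDual T, h1, ?_, mul_comm_of_tracial (τ := T.toLinearMap) h2⟩, hTe⟩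
  change T 1 = 1
  rw [← hv, hTe, hfv]

end Extension

/-! ### Threads in an inductive system and matrix models of its stages -/

/-- An algebra presented as an inductive limit of direct sums of homogeneous algebras. -/
structure AHData (A : Type u) [CStarAlgebra A] where
  sys : AHSystem
  ψ : ∀ i, (sys.S i).Alg →⋆ₙₐ[ℂ] A
  ψ_φ : ∀ i x, ψ (i + 1) (sys.φ i x) = ψ i x
  tendsto_norm : ∀ i x, Tendsto (fun k => ‖sys.map i k x‖) atTop (𝓝 ‖ψ i x‖)
  dense : Dense (⋃ i, Set.range (ψ i))

namespace AHData

variable {A : Type u} [CStarAlgebra A] (D : AHData A)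

/-- Sequences which eventually follow the connecting maps. -/
def thread : NonUnitalStarSubalgebra ℂ (∀ i, (D.sys.S i).Alg) where
  carrier := {y | ∀ᶠ i in atTop, y (i + 1) = D.sys.φ i (y i)}
  add_mem' {x y} hx hy := by
    filter_upwards [hx, hy] with i h1 h2
    simp only [Pi.add_apply, h1, h2, map_add]
  zero_mem' := Eventually.of_forall fun i => (map_zero (D.sys.φ i)).symm
  mul_mem' {x y} hx hy := by
    filter_upwards [hx, hy] with i h1 h2
    simp only [Pi.mul_apply, h1, h2, map_mul]
  smul_mem' c x hx := by
    filter_upwards [hx] with i h1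
    simp only [Pi.smul_apply, h1, map_smul]
  star_mem' {x} hx := by
    filter_upwards [hx] with i h1
    simp only [Pi.star_apply, h1, map_star]

theorem exists_lim (y : D.thread) : ∃ a : A, ∀ᶠ i in atTop, D.ψ i (y.1 i) = a := by
  obtain ⟨l, hl⟩ := eventually_atTop.1 y.2
  refine ⟨D.ψ l (y.1 l), eventually_atTop.2 ⟨l, fun i hi => ?_⟩⟩
  induction i, hi using Nat.le_induction with
  | base => rfl
  | succ i hi ih => rw [hl i hi, D.ψ_φ, ih]

/-- The eventual image of a thread. -/
def lim (y : D.thread) : A := (D.exists_lim y).choose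

theorem lim_spec (y : D.thread) : ∀ᶠ i in atTop, D.ψ i (y.1 i) = D.lim y :=
  (D.exists_lim y).choose_spec

theorem lim_eq {y : D.thread} {a : A} (h : ∀ᶠ i in atTop, D.ψ i (y.1 i) = a) : D.lim y = a := by
  obtain ⟨i, h1, h2⟩ := ((D.lim_spec y).and h).exists
  exact h1.symm.trans h2

/-- The map from threads to the limit algebra. -/
def limHom : D.thread →⋆ₙₐ[ℂ] A where
  toFun := D.lim
  map_zero' := D.lim_eq (Eventually.of_forall fun i => map_zero (D.ψ i))
  map_add' x y := D.lim_eq (by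
    filter_upwards [D.lim_spec x, D.lim_spec y] with i h1 h2
    rw [← h1, ← h2, ← map_add]
    rfl)
  map_mul' x y := D.lim_eq (by
    filter_upwards [D.lim_spec x, D.lim_spec y] with i h1 h2
    rw [← h1, ← h2, ← map_mul]
    rfl)
  map_smul' c x := D.lim_eq (by
    filter_upwards [D.lim_spec x] with i h1
    rw [← h1]
    exact map_smul (D.ψ i) c _)
  map_star' x := D.lim_eq (by
    filter_upwards [D.lim_spec x] with i h1
    rw [← h1]
    exact map_star (D.ψ i) _)

theorem limHom_spec (y : D.thread) : ∀ᶠ i in atTop, D.ψ i (y.1 i) = D.limHom y := D.lim_spec y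

/-- From some index on, a thread is the orbit of a single element under the connecting maps. This
lets functionals on the stages be bounded in the limit by the norm in A. -/
theorem tendsto_norm_thread (y : D.thread) :
    Tendsto (fun i => ‖y.1 i‖) atTop (𝓝 ‖D.limHom y‖) := by
  obtain ⟨l, hl⟩ := eventually_atTop.1 y.2
  obtain ⟨l', hl'⟩ := eventually_atTop.1 (D.limHom_spec y)
  set m := max l l' with hm
  have h1 : ∀ k, D.sys.map m k (y.1 m) = y.1 (m + k) := by
    intro k
    induction k with
    | zero => rfl
    | succ k ih =>
      change D.sys.φ (m + k) (D.sys.map m k (y.1 m)) = _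
      rw [ih, ← hl (m + k) (by omega)]
      rfl
  have h2 := D.tendsto_norm m (y.1 m)
  rw [hl' m (le_max_right _ _)] at h2
  simp only [h1] at h2
  rw [← tendsto_add_atTop_iff_nat m]
  exact h2.congr fun k => by rw [Nat.add_comm m k]

/-- Every element of a stage gives rise to a thread. -/
theorem exists_thread (l : ℕ) (x : (D.sys.S l).Alg) :
    ∃ y : D.thread, y.1 l = x ∧ (∀ i ≥ l, y.1 (i + 1) = D.sys.φ i (y.1 i)) ∧
      D.limHom y = D.ψ l x := by
  classical
  set y : ∀ i, (D.sys.S i).Alg := fun i => if h : l ≤ i then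
    Nat.leRec (motive := fun i _ => (D.sys.S i).Alg) x (fun i _ z => D.sys.φ i z) h else 0 with hy
  have h1 : ∀ i ≥ l, y (i + 1) = D.sys.φ i (y i) := by
    intro i hi
    simp only [hy, dif_pos hi, dif_pos (Nat.le_succ_of_le hi)]
    rw [Nat.leRec_succ]
  have h2 : y l = x := by
    simp only [hy, dif_pos le_rfl, Nat.leRec_self]
  refine ⟨⟨y, eventually_atTop.2 ⟨l, h1⟩⟩, h2, h1, D.lim_eq (eventually_atTop.2 ⟨l, fun i hi => ?_⟩)⟩
  induction i, hi using Nat.le_induction with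
  | base => exact congrArg _ h2
  | succ i hi ih => exact (congrArg _ (h1 i hi)).trans ((D.ψ_φ _ _).trans ih)

theorem denseRange_limHom : DenseRange D.limHom := by
  refine D.dense.mono (Set.iUnion_subset fun i => ?_)
  rintro _ ⟨x, rfl⟩
  obtain ⟨y, -, -, hy⟩ := D.exists_thread i x
  exact ⟨y, hy⟩

end AHData

theorem IsAH.nonempty_AHData {A : Type u} [CStarAlgebra A] (h : IsAH A) : Nonempty (AHData A) := by
  obtain ⟨S, ψ, h1, h2, h3⟩ := h
  exact ⟨⟨S, ψ, h1, h2, h3⟩⟩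

/-- A direct sum of homogeneous algebras as a corner in matrix valued functions. -/
structure MatrixModel (S : SemiHomogeneousData) where
  X : Type
  [top : TopologicalSpace X]
  [compact : CompactSpace X]
  [t2 : T2Space X]
  n : ℕ
  Φ : S.Alg →⋆ₙₐ[ℂ] MF X n
  Ψ : MF X n →ₗ[ℂ] S.Alg
  P : MF X n
  Ψ_Φ : ∀ z, Ψ (Φ z) = z
  Φ_Ψ : ∀ f, Φ (Ψ f) = P * f * P
  isStarProjection_P : IsStarProjection P
  Ψ_star : ∀ f, Ψ (star f) = star (Ψ f)

attribute [instance] MatrixModel.top MatrixModel.compact MatrixModel.t2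

theorem SemiHomogeneousData.nonempty_matrixModel (S : SemiHomogeneousData) :
    Nonempty (MatrixModel S) := by
  obtain ⟨X, h1, h2, h3, n, Φ, Ψ, P, h4, h5, h6, h7⟩ := S.exists_matrix_model
  exact ⟨⟨X, n, Φ, Ψ, P, h4, h5, h6, h7⟩⟩

/-- A matrix model of a direct sum of homogeneous algebras. -/
def SemiHomogeneousData.model (S : SemiHomogeneousData) : MatrixModel S :=
  S.nonempty_matrixModel.some

namespace MatrixModel

variable {S : SemiHomogeneousData} (M : MatrixModel S)

theorem Φ_injective : Function.Injective M.Φ := fun x y h => by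
  rw [← M.Ψ_Φ x, h, M.Ψ_Φ]

theorem P_mul_Φ (z : S.Alg) : M.P * M.Φ z = M.Φ z := by
  have := M.Φ_Ψ (M.Φ z)
  rw [M.Ψ_Φ] at this
  rw [this, ← mul_assoc, ← mul_assoc, M.isStarProjection_P.isIdempotentElem.eq]

theorem Φ_mul_P (z : S.Alg) : M.Φ z * M.P = M.Φ z := by
  have := M.Φ_Ψ (M.Φ z)
  rw [M.Ψ_Φ] at this
  rw [this, mul_assoc, M.isStarProjection_P.isIdempotentElem.eq]

/-- The unit of a direct sum of homogeneous algebras. -/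
def unit : S.Alg := M.Ψ 1

theorem Φ_unit : M.Φ M.unit = M.P := by
  rw [unit, M.Φ_Ψ, mul_one, M.isStarProjection_P.isIdempotentElem.eq]

theorem unit_mul (z : S.Alg) : M.unit * z = z :=
  M.Φ_injective (by rw [map_mul, M.Φ_unit, M.P_mul_Φ])

theorem mul_unit (z : S.Alg) : z * M.unit = z :=
  M.Φ_injective (by rw [map_mul, M.Φ_unit, M.Φ_mul_P])

theorem isStarProjection_unit : IsStarProjection M.unit :=
  ⟨M.unit_mul _, M.Φ_injective (by
    rw [map_star, M.Φ_unit, M.isStarProjection_P.isSelfAdjoint.star_eq])⟩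

variable {A : Type u} [CStarAlgebra A] (ψ : S.Alg →⋆ₙₐ[ℂ] A) {q : S.Alg}

/-- The corner map of a projection. -/
def cornerMap (hq : IsStarProjection q) : CornerMap M.X M.n A where
  Q := M.Φ q
  isStarProjection := ⟨by rw [IsIdempotentElem, ← map_mul, hq.isIdempotentElem.eq], by
    rw [IsSelfAdjoint, ← map_star, hq.isSelfAdjoint.star_eq]⟩
  toFun :=
    { toFun := fun f => ψ (q * M.Ψ f * q)
      map_add' := fun f g => by rw [map_add, mul_add, add_mul, map_add]
      map_smul' := fun c f => by
        rw [map_smul, mul_smul_comm, smul_mul_assoc, map_smul]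
        rfl }
  map_star f := by
    change ψ (q * M.Ψ (star f) * q) = star (ψ (q * M.Ψ f * q))
    rw [← map_star, star_mul, star_mul, hq.isSelfAdjoint.star_eq, M.Ψ_star, mul_assoc]
  map_mul f g := by
    change ψ (q * M.Ψ f * q) * ψ (q * M.Ψ g * q) = ψ (q * M.Ψ (f * M.Φ q * g) * q)
    rw [← map_mul]
    congr 1
    apply M.Φ_injective
    have hq1 : M.Φ q * M.Φ q = M.Φ q := by rw [← map_mul, hq.isIdempotentElem.eq]
    have h1 := M.P_mul_Φ q
    have h2 := M.Φ_mul_P q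
    have e1 : ∀ f, M.Φ q * (M.P * f * M.P) * M.Φ q = M.Φ q * f * M.Φ q := fun f => by
      calc _ = (M.Φ q * M.P) * f * (M.P * M.Φ q) := by simp only [mul_assoc]
        _ = _ := by rw [h1, h2]
    simp only [map_mul, M.Φ_Ψ, e1]
    calc _ = M.Φ q * f * (M.Φ q * M.Φ q) * g * M.Φ q := by simp only [mul_assoc]
      _ = _ := by rw [hq1]; simp only [mul_assoc]
  map_cut f := by
    change ψ (q * M.Ψ (M.Φ q * f * M.Φ q) * q) = ψ (q * M.Ψ f * q)
    congr 1
    apply M.Φ_injective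
    have hq1 : M.Φ q * M.Φ q = M.Φ q := by rw [← map_mul, hq.isIdempotentElem.eq]
    have h1 := M.P_mul_Φ q
    have h2 := M.Φ_mul_P q
    have e1 : ∀ f, M.Φ q * (M.P * f * M.P) * M.Φ q = M.Φ q * f * M.Φ q := fun f => by
      calc _ = (M.Φ q * M.P) * f * (M.P * M.Φ q) := by simp only [mul_assoc]
        _ = _ := by rw [h1, h2]
    simp only [map_mul, M.Φ_Ψ, e1]
    calc _ = (M.Φ q * M.Φ q) * f * (M.Φ q * M.Φ q) := by simp only [mul_assoc]
      _ = _ := by rw [hq1]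

theorem cornerMap_apply (hq : IsStarProjection q) (f : MF M.X M.n) :
    (M.cornerMap ψ hq).toFun f = ψ (q * M.Ψ f * q) := rfl

theorem cornerMap_Φ (hq : IsStarProjection q) (z : S.Alg) :
    (M.cornerMap ψ hq).toFun (M.Φ z) = ψ (q * z * q) := by
  rw [cornerMap_apply, M.Ψ_Φ]

end MatrixModel

namespace AHData

variable {A : Type u} [CStarAlgebra A] (D : AHData A)

/-- The image e of the unit of a stage fixes an element within 1/2 of 1, so 1 - e = (1 - e)(1 - ψ z)
has norm at most half of itself. -/
theorem exists_unit : ∃ l, D.ψ l (D.sys.S l).model.unit = 1 := by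
  obtain ⟨a, ha, hlt⟩ := D.dense.exists_dist_lt (1 : A) (show (0 : ℝ) < 1 / 2 by norm_num)
  obtain ⟨l, z, rfl⟩ := Set.mem_iUnion.1 ha
  refine ⟨l, ?_⟩
  set M := (D.sys.S l).model
  set e := D.ψ l M.unit with he
  have hu := M.isStarProjection_unit
  have hee : e * e = e := by rw [he, ← map_mul, hu.isIdempotentElem.eq]
  have hes : star e = e := by rw [he, ← map_star, hu.isSelfAdjoint.star_eq]
  have hez : e * D.ψ l z = D.ψ l z := by rw [he, ← map_mul, M.unit_mul]
  have hp : IsStarProjection (1 - e) := (show IsStarProjection e from ⟨hee, hes⟩).one_sub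
  have h1 : 1 - e = (1 - e) * (1 - D.ψ l z) := by
    rw [mul_sub, mul_one, sub_mul (1 : A) e (D.ψ l z), one_mul, hez, sub_self, sub_zero]
  rw [dist_eq_norm] at hlt
  have h2 : ‖1 - e‖ ≤ ‖1 - e‖ * (1 / 2) := by
    conv_lhs => rw [h1]
    exact (norm_mul_le _ _).trans (by gcongr)
  have h3 : ‖1 - e‖ = 0 := by linarith [norm_nonneg (1 - e)]
  exact (sub_eq_zero.1 (norm_eq_zero.1 h3)).symm

end AHData

/-! ### From quasitraces to tracial states -/

section Pullback

variable {M N : Type u} [CStarAlgebra M] [CStarAlgebra N]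

/-- The closure of the image of a commutative subalgebra is again commutative, so the linearity
axiom pulls back. -/
theorem IsQuasitrace.comp {σ : N → ℂ} (hσ : IsQuasitrace σ) (f : M →⋆ₙₐ[ℂ] N) :
    IsQuasitrace fun x => σ (f x) where
  nonneg x := by rw [map_mul, map_star]; exact hσ.nonneg _
  tracial x := by rw [map_mul, map_mul, map_star]; exact hσ.tracial _
  add_I_smul a b ha hb := by
    rw [_root_.map_add, _root_.map_smul]
    exact hσ.add_I_smul _ _ (ha.map f) (hb.map f)
  linear B _ hB x hx y hy c := by
    set B' := B.map f with hB'
    have hcomm : ∀ x ∈ B', ∀ y ∈ B', x * y = y * x := by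
      rintro _ ⟨x, hx, rfl⟩ _ ⟨y, hy, rfl⟩
      have := congrArg f (hB x hx y hy)
      rwa [map_mul, map_mul] at this
    letI := B'.nonUnitalCommSemiringTopologicalClosure fun x y => Subtype.ext (hcomm x x.2 y y.2)
    have hmem : ∀ x ∈ B, f x ∈ B'.topologicalClosure := fun x hx =>
      B'.le_topologicalClosure ⟨x, hx, rfl⟩
    have := hσ.linear _ B'.isClosed_topologicalClosure
      (fun x hx y hy => congrArg Subtype.val (mul_comm (⟨x, hx⟩ : B'.topologicalClosure) ⟨y, hy⟩))
      (f x) (hmem x hx) (f y) (hmem y hy) c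
    rw [_root_.map_add, _root_.map_smul]
    exact this

theorem IsQuasitrace.norm_le [PartialOrder M] [StarOrderedRing M] {σ : M → ℂ}
    (hσ : IsQuasitrace σ) (h1 : σ 1 = 1) (x : M) : ‖σ x‖ ≤ 2 * ‖x‖ := by
  have key : ∀ y : M, IsSelfAdjoint y → ‖σ y‖ ≤ ‖y‖ := fun y hy => by
    have h2 : ((‖y‖ : ℝ) : ℂ) • (1 : M) = algebraMap ℝ M ‖y‖ := by
      rw [Algebra.algebraMap_eq_smul_one]
      exact Complex.coe_smul _ _
    have := hσ.abs_re_le hy (IsSelfAdjoint.one M) (Commute.one_right y) (c := ‖y‖)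
      (by rw [h2]; exact sub_nonneg.2 (le_algebraMap_of_norm_le hy le_rfl))
      (by rw [h2]; exact neg_le_iff_add_nonneg'.1 (neg_algebraMap_le_of_norm_le hy le_rfl))
    rwa [h1, Complex.one_re, mul_one] at this
  conv_lhs => rw [← realPart_add_I_smul_imaginaryPart x]
  rw [hσ.add_I_smul _ _ (realPart x).2 (imaginaryPart x).2]
  refine (norm_add_le _ _).trans ?_
  rw [norm_mul, Complex.norm_I, one_mul, two_mul]
  exact add_le_add ((key _ (realPart x).2).trans (realPart.norm_le x))
    ((key _ (imaginaryPart x).2).trans (imaginaryPart.norm_le x))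

end Pullback

namespace AHData

variable {A : Type u} [CStarAlgebra A] [PartialOrder A] [StarOrderedRing A] (D : AHData A)
  {σ : A → ℂ}

/-- Both elements lift to a common stage, which is a corner, and there quasitraces are additive. -/
theorem quasitrace_add (hσ : IsQuasitrace σ) {a b : A} (ha : IsSelfAdjoint a)
    (hb : IsSelfAdjoint b) (ha' : a ∈ Set.range D.limHom) (hb' : b ∈ Set.range D.limHom) :
    σ (a + b) = σ a + σ b := by
  obtain ⟨x, rfl⟩ := ha'
  obtain ⟨y, rfl⟩ := hb'
  obtain ⟨i, h1, h2⟩ := ((D.limHom_spec x).and (D.limHom_spec y)).exists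
  set M := (D.sys.S i).model
  set Θ := M.cornerMap (D.ψ i) M.isStarProjection_unit
  have key : ∀ (a : A) (z : (D.sys.S i).Alg), IsSelfAdjoint a → D.ψ i z = a →
      ∃ w : MF M.X M.n, IsSelfAdjoint w ∧ Θ.toFun w = a := by
    intro a z ha hz
    -- A lift of a selfadjoint element need not be selfadjoint, so it is symmetrised.
    refine ⟨(1 / 2 : ℂ) • (M.Φ z + star (M.Φ z)), ?_, ?_⟩
    · rw [IsSelfAdjoint, star_smul, star_add, star_star, add_comm (M.Φ z)]
      congr 1
      simp
    · rw [map_smul, map_add, Θ.map_star, M.cornerMap_Φ, M.unit_mul, M.mul_unit, hz, ha.star_eq,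
        ← two_smul ℂ a, smul_smul]
      norm_num
  obtain ⟨w, hw, hwx⟩ := key _ _ ha h1
  obtain ⟨w', hw', hwy⟩ := key _ _ hb h2
  rw [← hwx, ← hwy, ← map_add]
  exact Θ.quasitrace_add_of_isSelfAdjoint hσ hw hw'

theorem realPart_mem (y : D.thread) : (realPart (D.limHom y) : A) ∈ Set.range D.limHom := by
  refine ⟨(((2⁻¹ : ℝ)) : ℂ) • (y + star y), ?_⟩
  rw [map_smul, map_add, map_star, realPart_apply_coe]
  exact Complex.coe_smul _ _

theorem imaginaryPart_mem (y : D.thread) :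
    (imaginaryPart (D.limHom y) : A) ∈ Set.range D.limHom := by
  refine ⟨-Complex.I • (((2⁻¹ : ℝ)) : ℂ) • (y - star y), ?_⟩
  rw [map_smul, map_smul, map_sub, map_star, imaginaryPart_apply_coe]
  congr 1

/-- Additivity and real homogeneity on selfadjoint elements, combined with σ(a + ib) = σ(a) + iσ(b),
give complex linearity after splitting into real and imaginary parts. -/
theorem quasitrace_linear (hσ : IsQuasitrace σ) (y y' : D.thread) (c c' : ℂ) :
    σ (D.limHom (c • y + c' • y')) = c * σ (D.limHom y) + c' * σ (D.limHom y') := by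
  set V : Submodule ℂ A := LinearMap.range
    ({ toFun := D.limHom, map_add' := map_add _, map_smul' := map_smul _ } : D.thread →ₗ[ℂ] A) with hV
  have hVr : ∀ {a}, a ∈ V → a ∈ Set.range D.limHom := fun h => h
  have h1 := D.realPart_mem y
  have h2 := D.imaginaryPart_mem y
  have h1' := D.realPart_mem y'
  have h2' := D.imaginaryPart_mem y'
  set a := D.limHom y
  set a' := D.limHom y'
  set x₁ : A := ((realPart a : selfAdjoint A) : A)
  set x₂ : A := ((imaginaryPart a : selfAdjoint A) : A)
  set x₁' : A := ((realPart a' : selfAdjoint A) : A)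
  set x₂' : A := ((imaginaryPart a' : selfAdjoint A) : A)
  have s1 : IsSelfAdjoint x₁ := (realPart a).2
  have s2 : IsSelfAdjoint x₂ := (imaginaryPart a).2
  have s1' : IsSelfAdjoint x₁' := (realPart a').2
  have s2' : IsSelfAdjoint x₂' := (imaginaryPart a').2
  have ea : a = x₁ + Complex.I • x₂ := (realPart_add_I_smul_imaginaryPart a).symm
  have ea' : a' = x₁' + Complex.I • x₂' := (realPart_add_I_smul_imaginaryPart a').symm
  have sr : ∀ (r : ℝ) {x : A}, IsSelfAdjoint x → IsSelfAdjoint ((r : ℂ) • x) := fun r x hx =>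
    IsSelfAdjoint.smul (Complex.conj_ofReal r) hx
  have comb : ∀ (p q r s : ℝ), IsSelfAdjoint
      (((p : ℂ) • x₁ + (q : ℂ) • x₂) + ((r : ℂ) • x₁' + (s : ℂ) • x₂')) ∧
      σ (((p : ℂ) • x₁ + (q : ℂ) • x₂) + ((r : ℂ) • x₁' + (s : ℂ) • x₂'))
        = (p * σ x₁ + q * σ x₂) + (r * σ x₁' + s * σ x₂') := by
    intro p q r s
    have m1 : (p : ℂ) • x₁ ∈ V := V.smul_mem _ h1
    have m2 : (q : ℂ) • x₂ ∈ V := V.smul_mem _ h2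
    have m3 : (r : ℂ) • x₁' ∈ V := V.smul_mem _ h1'
    have m4 : (s : ℂ) • x₂' ∈ V := V.smul_mem _ h2'
    refine ⟨((sr p s1).add (sr q s2)).add ((sr r s1').add (sr s s2')), ?_⟩
    rw [D.quasitrace_add hσ ((sr p s1).add (sr q s2)) ((sr r s1').add (sr s s2'))
      (hVr (V.add_mem m1 m2)) (hVr (V.add_mem m3 m4)),
      D.quasitrace_add hσ (sr p s1) (sr q s2) (hVr m1) (hVr m2),
      D.quasitrace_add hσ (sr r s1') (sr s s2') (hVr m3) (hVr m4),
      hσ.map_smul s1, hσ.map_smul s2, hσ.map_smul s1', hσ.map_smul s2']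
  have e : D.limHom (c • y + c' • y')
      = (((c.re : ℂ) • x₁ + ((-c.im : ℝ) : ℂ) • x₂) + ((c'.re : ℂ) • x₁' + ((-c'.im : ℝ) : ℂ) • x₂'))
        + Complex.I • (((c.im : ℂ) • x₁ + (c.re : ℂ) • x₂)
          + ((c'.im : ℂ) • x₁' + (c'.re : ℂ) • x₂')) := by
    rw [map_add, map_smul, map_smul]
    change c • a + c' • a' = _
    rw [ea, ea']
    have hI := Complex.I_mul_I
    conv_lhs => rw [← Complex.re_add_im c, ← Complex.re_add_im c']
    push_cast
    match_scalars
    · ring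
    · linear_combination (c.im : ℂ) * hI
    · ring
    · linear_combination (c'.im : ℂ) * hI
  rw [e, hσ.add_I_smul _ _ (comb _ _ _ _).1 (comb _ _ _ _).1, (comb _ _ _ _).2, (comb _ _ _ _).2,
    ea, ea', hσ.add_I_smul _ _ s1 s2, hσ.add_I_smul _ _ s1' s2']
  conv_rhs => rw [← Complex.re_add_im c, ← Complex.re_add_im c']
  have hI := Complex.I_mul_I
  push_cast
  linear_combination (-(c.im : ℂ) * σ x₂ - c'.im * σ x₂') * hI

/-- A normalised quasitrace restricts to a tracial state on the dense subalgebra. -/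
theorem exists_tracialState_of_quasitrace (hσ : IsQuasitrace σ) (h1 : σ 1 = 1) :
    ∃ τ : tracialStates A, ∀ y, (τ : WeakDual ℂ A) (D.limHom y) = σ (D.limHom y) := by
  obtain ⟨l, hl⟩ := D.exists_unit
  obtain ⟨v, -, -, hv⟩ := D.exists_thread l (D.sys.S l).model.unit
  rw [hl] at hv
  refine exists_tracialState D.limHom D.denseRange_limHom
    { toFun := fun y => σ (D.limHom y)
      map_add' := fun y y' => by simpa using D.quasitrace_linear hσ y y' 1 1
      map_smul' := fun c y => by
        have := D.quasitrace_linear hσ y 0 c 0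
        simpa [hσ.map_zero] using this } (C := 2) (fun y => hσ.norm_le h1 _) (fun y => ?_)
    (fun y => ?_) hv (by rw [LinearMap.coe_mk, AddHom.coe_mk, hv, h1])
  · change 0 ≤ σ (D.limHom (star y * y))
    rw [map_mul, map_star]; exact hσ.nonneg _
  · change σ (D.limHom (star y * y)) = σ (D.limHom (y * star y))
    rw [map_mul, map_mul, map_star]; exact hσ.tracial _

end AHData

/-! ### Faithfulness of traces on simple algebras -/

section Faithful

variable {A : Type u} [CStarAlgebra A] [PartialOrder A] [StarOrderedRing A]

/-- Tracial states of simple algebras are faithful. -/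
theorem tracialStates_faithful (hA : IsSimpleCStar A) (τ : tracialStates A) {a : A}
    (ha : (τ : WeakDual ℂ A) (star a * a) = 0) : a = 0 := by
  set t : WeakDual ℂ A := τ.1 with ht
  have hτ : t ∈ tracialStates A := τ.2
  have hsq : ∀ x : A, 0 ≤ (t (star x * x)).re := fun x => (Complex.le_def.1 (hτ.1 x)).1
  have hiff : ∀ x : A, t (star x * x) = 0 ↔ (t (star x * x)).re ≤ 0 := fun x =>
    ⟨fun h => by rw [h]; exact le_rfl, fun h => by
      rw [tracialStates_eq_re hτ (IsSelfAdjoint.star_mul_self x), le_antisymm h (hsq x),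
        Complex.ofReal_zero]⟩
  have hleft : ∀ x y : A, t (star y * y) = 0 → t (star (x * y) * (x * y)) = 0 := fun x y hy => by
    rw [hiff]
    have h1 : star (x * y) * (x * y) ≤ ‖star x * x‖ • (star y * y) := by
      have := CStarAlgebra.star_left_conjugate_le_norm_smul (a := y) (b := star x * x)
        (IsSelfAdjoint.star_mul_self x)
      rwa [star_mul, show star y * star x * (x * y) = star y * (star x * x) * y by
        simp only [mul_assoc]]
    refine (tracialStates_re_mono hτ h1).trans ?_
    rw [← Complex.coe_smul, map_smul, hy, smul_zero, Complex.zero_re]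
  have hstar : ∀ y : A, t (star y * y) = 0 → t (star (star y) * star y) = 0 := fun y hy => by
    rw [star_star, hτ.2.2, hy]
  -- The left kernel of the trace: closed under sums by the parallelogram law, and two-sided because
  -- the trace property makes it stable under the involution.
  set I : TwoSidedIdeal A := TwoSidedIdeal.mk' {x | t (star x * x) = 0} (by simp)
    (by
      intro x y hx hy
      rw [Set.mem_ofPred_eq] at hx hy ⊢
      have h1 := hsq (x - y)
      rw [hiff]
      have h2 : t (star (x + y) * (x + y)) + t (star (x - y) * (x - y))
          = 2 * t (star x * x) + 2 * t (star y * y) := by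
        simp only [star_add, star_sub, add_mul, mul_add, sub_mul, mul_sub, map_add, map_sub]
        ring
      rw [hx, hy, mul_zero, add_zero] at h2
      have h3 := congrArg Complex.re h2
      rw [Complex.add_re, Complex.zero_re] at h3
      linarith)
    (by
      intro x hx
      rw [Set.mem_ofPred_eq] at hx ⊢
      rwa [star_neg, neg_mul_neg])
    (by intro x y hy; exact hleft x y hy)
    (by
      intro x y hx
      rw [Set.mem_ofPred_eq] at hx ⊢
      have := hstar _ (hleft (star y) (star x) (hstar x hx))
      rwa [star_mul, star_star, star_star] at this) with hI
  have hmem : ∀ x, x ∈ I ↔ t (star x * x) = 0 := fun x => TwoSidedIdeal.mem_mk' _ _ _ _ _ _ x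
  have hcl : IsClosed (I : Set A) := by
    have : (I : Set A) = {x | t (star x * x) = 0} := Set.ext hmem
    rw [this]
    have hc : Continuous fun x : A => t (star x * x) :=
      (WeakDual.toStrongDual t).continuous.comp (by fun_prop)
    exact isClosed_eq hc continuous_const
  rcases hA.2 I hcl with h | h
  · have := (hmem a).2 ha
    rw [h] at this
    exact (TwoSidedIdeal.mem_bot A).1 this
  · have h1 : (1 : A) ∈ I := by rw [h]; trivial
    have := (hmem 1).1 h1
    rw [star_one, mul_one, hτ.2.1] at this
    exact absurd this one_ne_zero

end Faithful

/-! ### Dimension and normalised trace of a matrix corner -/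

namespace Mat

variable {n : ℕ}

/-- The compression to a projection. -/
def compression (Q : Mat n ℂ) : Mat n ℂ →ₗ[ℂ] Mat n ℂ where
  toFun a := Q * a * Q
  map_add' a b := by rw [mul_add, add_mul]
  map_smul' c a := by
    rw [RingHom.id_apply, mul_smul_comm, smul_mul_assoc]

/-- The matrix units. -/
def single (i j : Fin n) : Mat n ℂ := of fun k l => if k = i ∧ l = j then 1 else 0

/-- The canonical basis. -/
def basis (n : ℕ) : Module.Basis (Fin n × Fin n) ℂ (Mat n ℂ) :=
  (Matrix.stdBasis ℂ (Fin n) (Fin n) : Module.Basis _ ℂ (Matrix (Fin n) (Fin n) ℂ))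

/-- The dimension is the trace of the idempotent a ↦ QaQ, which on matrix units is ∑ Q_ii Q_jj. -/
theorem finrank_compression {Q : Mat n ℂ} (hQ : IsStarProjection Q) :
    (Module.finrank ℂ (LinearMap.range (compression Q)) : ℂ) = Q.trace * Q.trace := by
  have hp : LinearMap.IsProj (LinearMap.range (compression Q)) (compression Q) := by
    refine ⟨fun x => ⟨x, rfl⟩, ?_⟩
    rintro _ ⟨x, rfl⟩
    change Q * (Q * x * Q) * Q = Q * x * Q
    rw [← mul_assoc, ← mul_assoc, hQ.isIdempotentElem.eq, mul_assoc, hQ.isIdempotentElem.eq]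
  have : FiniteDimensional ℂ (Mat n ℂ) := Module.Finite.of_basis (basis n)
  have h1 := hp.trace
  rw [← h1, LinearMap.trace_eq_matrix_trace ℂ (basis n), Matrix.trace, Fintype.sum_prod_type,
    trace_apply, Finset.sum_mul_sum]
  refine Finset.sum_congr rfl fun i _ => Finset.sum_congr rfl fun j _ => ?_
  rw [Matrix.diag_apply, LinearMap.toMatrix_apply]
  have h2 : basis n (i, j) = single i j := by
    change Matrix.stdBasis ℂ (Fin n) (Fin n) (i, j) = _
    rw [Matrix.stdBasis_eq_single]
    apply Mat.ext; intro k l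
    change Matrix.single i j (1 : ℂ) k l = if k = i ∧ l = j then 1 else 0
    rw [Matrix.single_apply]
    simp only [eq_comm]
  rw [h2]
  change (Q * single i j * Q).entry i j = _
  simp [Mat.entry_mul, single, Finset.sum_ite, ite_and]

/-- The normalised trace of the compression to a projection. -/
def cornerTrace (Q : Mat n ℂ) : Mat n ℂ →ₗ[ℂ] ℂ :=
  (Q.trace)⁻¹ • (Mat.trace : Mat n ℂ →L[ℂ] ℂ).toLinearMap ∘ₗ compression Q

theorem cornerTrace_apply (Q a : Mat n ℂ) : cornerTrace Q a = (Q.trace)⁻¹ * (Q * a * Q).trace := rfl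

theorem trace_star_mul_self_nonneg (a : Mat n ℂ) : 0 ≤ (star a * a).trace := by
  rw [Mat.trace_apply]
  refine Finset.sum_nonneg fun i _ => ?_
  rw [Mat.entry_mul]
  exact Finset.sum_nonneg fun k _ => star_mul_self_nonneg (a.entry k i)

variable {Q : Mat n ℂ}

theorem trace_inv_nonneg (hQ : IsStarProjection Q) : 0 ≤ (Q.trace)⁻¹ := by
  rw [trace_of_isStarProjection hQ, ← Complex.ofReal_inv]
  exact_mod_cast inv_nonneg.2 (by positivity)

theorem cornerTrace_nonneg (hQ : IsStarProjection Q) (a : Mat n ℂ) : 0 ≤ cornerTrace Q (star a * a) := by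
  rw [cornerTrace_apply]
  refine mul_nonneg (trace_inv_nonneg hQ) ?_
  have : Q * (star a * a) * Q = star (a * Q) * (a * Q) := by
    rw [star_mul, hQ.isSelfAdjoint.star_eq]; simp only [mul_assoc]
  rw [this]
  exact trace_star_mul_self_nonneg _

theorem cornerTrace_comm (hQ : IsStarProjection Q) {a b : Mat n ℂ} (ha : Q * a * Q = a) (hb : Q * b * Q = b) :
    cornerTrace Q (a * b) = cornerTrace Q (b * a) := by
  have hQQ := hQ.isIdempotentElem.eq
  have h1 : ∀ {x : Mat n ℂ}, Q * x * Q = x → Q * x = x ∧ x * Q = x := fun {x} hx => by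
    constructor
    · rw [← hx, ← mul_assoc, ← mul_assoc, hQQ]
    · rw [← hx, mul_assoc, hQQ]
  rw [cornerTrace_apply, cornerTrace_apply, ← mul_assoc, (h1 ha).1, mul_assoc, (h1 hb).2,
    ← mul_assoc, (h1 hb).1, mul_assoc, (h1 ha).2, trace_mul_comm]

theorem trace_ne_zero (hQ : IsStarProjection Q) (h0 : Q ≠ 0) : Q.trace ≠ 0 := fun h => by
  have := one_le_trace_re hQ h0
  rw [h, Complex.zero_re] at this
  linarith

theorem cornerTrace_self (hQ : IsStarProjection Q) (h0 : Q ≠ 0) : cornerTrace Q Q = 1 := by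
  rw [cornerTrace_apply, hQ.isIdempotentElem.eq, hQ.isIdempotentElem.eq,
    inv_mul_cancel₀ (trace_ne_zero hQ h0)]

theorem norm_cornerTrace_le (hQ : IsStarProjection Q) (h0 : Q ≠ 0) (a : Mat n ℂ) : ‖cornerTrace Q a‖ ≤ 2 * ‖a‖ := by
  have h1 : cornerTrace Q 1 = 1 := by
    rw [cornerTrace_apply, mul_one, hQ.isIdempotentElem.eq,
      inv_mul_cancel₀ (trace_ne_zero hQ h0)]
  have hpos : ∀ y : Mat n ℂ, 0 ≤ y → 0 ≤ cornerTrace Q y := fun y hy => by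
    obtain ⟨z, rfl⟩ := CStarAlgebra.nonneg_iff_eq_star_mul_self.1 hy
    exact cornerTrace_nonneg hQ z
  have key : ∀ y : Mat n ℂ, IsSelfAdjoint y → ‖cornerTrace Q y‖ ≤ ‖y‖ := fun y hy => by
    have e : cornerTrace Q (algebraMap ℝ (Mat n ℂ) ‖y‖) = ((‖y‖ : ℝ) : ℂ) := by
      rw [Algebra.algebraMap_eq_smul_one, ← Complex.coe_smul, map_smul, h1, smul_eq_mul, mul_one]
    have h2 := hpos _ (sub_nonneg.2 (le_algebraMap_of_norm_le hy le_rfl))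
    have h3 := hpos _ (sub_nonneg.2 (neg_algebraMap_le_of_norm_le hy le_rfl))
    rw [map_sub, e] at h2
    rw [sub_neg_eq_add, map_add, e] at h3
    rw [Complex.le_def] at h2 h3
    simp at h2 h3
    have : cornerTrace Q y = ((cornerTrace Q y).re : ℂ) := Complex.ext rfl (by simp [h3.2.symm])
    rw [this, Complex.norm_real, Real.norm_eq_abs, abs_le]
    constructor <;> linarith [h2.1, h3.1]
  conv_lhs => rw [← realPart_add_I_smul_imaginaryPart a]
  rw [map_add, map_smul]
  refine (norm_add_le _ _).trans ?_
  rw [norm_smul, Complex.norm_I, one_mul, two_mul]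
  exact add_le_add ((key _ (realPart a).2).trans (realPart.norm_le a))
    ((key _ (imaginaryPart a).2).trans (imaginaryPart.norm_le a))

/-- Gram determinants vanish in corners of small rank. -/
theorem det_cornerTrace_eq_zero (hQ : IsStarProjection Q) {N : ℕ} (hN : Q.trace.re < N)
    {ι : Type*} [Fintype ι] [DecidableEq ι] (hι : N * N < Fintype.card ι) {a : ι → Mat n ℂ}
    (ha : ∀ i, Q * a i * Q = a i) :
    (Matrix.of fun i j => cornerTrace Q (star (a i) * a j)).det = 0 := by
  have : FiniteDimensional ℂ (Mat n ℂ) := Module.Finite.of_basis (basis n)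
  set V := LinearMap.range (compression Q) with hV
  -- The corner has dimension (tr Q)² ≤ N², so the given elements are dependent, and so are the
  -- columns of their Gram matrix.
  have h1 : Module.finrank ℂ V < Fintype.card ι := by
    have h2 := congrArg Complex.re (finrank_compression hQ)
    have h3 : Q.trace.im = 0 := trace_im hQ.isSelfAdjoint
    have h4 : 0 ≤ Q.trace.re := by
      rw [trace_of_isStarProjection hQ, Complex.ofReal_re]; positivity
    rw [Complex.mul_re, h3, mul_zero, sub_zero, Complex.natCast_re] at h2
    have h5 : (Module.finrank ℂ V : ℝ) ≤ N * N := by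
      rw [h2]; nlinarith
    exact lt_of_le_of_lt (by exact_mod_cast h5) hι
  set w : ι → V := fun i => ⟨a i, a i, ha i⟩ with hw
  have h2 : ¬ LinearIndependent ℂ w := fun h => by
    have := h.fintype_card_le_finrank
    omega
  rw [Fintype.not_linearIndependent_iff] at h2
  obtain ⟨c, hc, i, hi⟩ := h2
  have hc' : ∑ j, c j • a j = 0 := by
    have := congrArg V.subtype hc
    rw [map_sum, map_zero] at this
    rw [← this]
    exact Finset.sum_congr rfl fun j _ => rfl
  rw [← Matrix.exists_mulVec_eq_zero_iff]
  refine ⟨c, fun h => hi (congrFun h i), ?_⟩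
  ext j
  simp only [Matrix.mulVec, dotProduct, Matrix.of_apply, Pi.zero_apply]
  calc ∑ k, cornerTrace Q (star (a j) * a k) * c k
      = cornerTrace Q (star (a j) * ∑ k, c k • a k) := by
        rw [Finset.mul_sum, map_sum]
        refine Finset.sum_congr rfl fun k _ => ?_
        rw [mul_smul_comm, map_smul, smul_eq_mul, mul_comm]
    _ = 0 := by rw [hc', mul_zero, map_zero]

end Mat

/-- A linear functional which is a tracial state after compression by a projection. -/
structure IsCornerState {B : Type*} [NonUnitalCStarAlgebra B] (q : B) (s : B →ₗ[ℂ] ℂ) : Prop where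
  norm_le : ∀ a, ‖s a‖ ≤ 2 * ‖a‖
  nonneg : ∀ a, 0 ≤ s (star a * a)
  map_self : s q = 1
  map_cut : ∀ a, s (q * a * q) = s a
  comm : ∀ a b, q * a * q = a → q * b * q = b → s (a * b) = s (b * a)

theorem MatrixModel.isCornerState {S : SemiHomogeneousData} (M : MatrixModel S) {q : S.Alg}
    (hq : IsStarProjection q) {x : M.X} (hx : M.Φ q x ≠ 0) (s : S.Alg →ₗ[ℂ] ℂ)
    (hs : ∀ a, s a = Mat.cornerTrace (M.Φ q x) (M.Φ a x)) : IsCornerState q s := by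
  have hQ : IsStarProjection (M.Φ q x) := by
    constructor
    · rw [IsIdempotentElem, ← MF.mul_apply, ← map_mul, hq.isIdempotentElem.eq]
    · rw [IsSelfAdjoint, ← MF.star_apply, ← map_star, hq.isSelfAdjoint.star_eq]
  have hcut : ∀ a, q * a * q = a → M.Φ q x * M.Φ a x * M.Φ q x = M.Φ a x := fun a ha => by
    rw [← MF.mul_apply, ← MF.mul_apply, ← map_mul, ← map_mul, ha]
  refine ⟨fun a => ?_, fun a => ?_, ?_, fun a => ?_, fun a b ha hb => ?_⟩
  · rw [hs]
    refine (Mat.norm_cornerTrace_le hQ hx _).trans ?_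
    have h1 : ‖M.Φ a x‖ ≤ ‖M.Φ a‖ := ContinuousMap.norm_coe_le_norm (M.Φ a : C(M.X, Mat M.n ℂ)) x
    have h2 : ‖M.Φ a‖ ≤ ‖a‖ := NonUnitalStarAlgHom.norm_apply_le M.Φ a
    linarith
  · rw [hs, map_mul, map_star, MF.mul_apply, MF.star_apply]
    exact Mat.cornerTrace_nonneg hQ _
  · rw [hs, Mat.cornerTrace_self hQ hx]
  · rw [hs, hs, map_mul, map_mul, MF.mul_apply, MF.mul_apply, Mat.cornerTrace_apply,
      Mat.cornerTrace_apply]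
    congr 2
    rw [← mul_assoc, ← mul_assoc, hQ.isIdempotentElem.eq, mul_assoc _ (M.Φ q x),
      hQ.isIdempotentElem.eq]
  · rw [hs, hs, map_mul, map_mul, MF.mul_apply, MF.mul_apply]
    exact Mat.cornerTrace_comm hQ (hcut a ha) (hcut b hb)

/-! ### Ultrafilter limits of traces and growth of ranks -/

namespace AHData

variable {A : Type u} [CStarAlgebra A] (D : AHData A)

/-- Limits of tracial states of the stages along an ultrafilter. -/
theorem exists_limit_state (𝒰 : Ultrafilter ℕ) (h𝒰 : (𝒰 : Filter ℕ) ≤ atTop) {v : D.thread}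
    (hv : ∀ᶠ i in atTop, IsStarProjection (v.1 i)) (hv1 : D.limHom v = 1)
    (s : ∀ i, (D.sys.S i).Alg →ₗ[ℂ] ℂ) (hs : ∀ᶠ i in (𝒰 : Filter ℕ), IsCornerState (v.1 i) (s i)) :
    ∃ τ : tracialStates A, ∀ y : D.thread,
      Tendsto (fun i => s i (y.1 i)) 𝒰 (𝓝 ((τ : WeakDual ℂ A) (D.limHom y))) := by
  have hnorm : ∀ y : D.thread, Tendsto (fun i => 2 * ‖y.1 i‖) 𝒰 (𝓝 (2 * ‖D.limHom y‖)) :=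
    fun y => ((D.tendsto_norm_thread y).mono_left h𝒰).const_mul 2
  have hex : ∀ y : D.thread, ∃ L : ℂ, Tendsto (fun i => s i (y.1 i)) 𝒰 (𝓝 L) := by
    intro y
    have h1 : ∀ᶠ i in (𝒰 : Filter ℕ), s i (y.1 i) ∈ Metric.closedBall (0 : ℂ) (2 * ‖D.limHom y‖ + 1) := by
      filter_upwards [hs, (hnorm y).eventually_le_const (lt_add_one _)] with i h2 h3
      rw [mem_closedBall_zero_iff]
      exact (h2.norm_le _).trans h3
    obtain ⟨L, -, hL⟩ := (isCompact_closedBall (0 : ℂ) (2 * ‖D.limHom y‖ + 1)).ultrafilter_le_nhds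
      (𝒰.map fun i => s i (y.1 i)) (le_principal_iff.2 h1)
    exact ⟨L, hL⟩
  choose f hf using hex
  have huniq : ∀ (y : D.thread) (L : ℂ), Tendsto (fun i => s i (y.1 i)) 𝒰 (𝓝 L) → f y = L :=
    fun y L h => tendsto_nhds_unique (hf y) h
  have hbound : ∀ y, ‖f y‖ ≤ 2 * ‖D.limHom y‖ := fun y =>
    le_of_tendsto_of_tendsto (hf y).norm (hnorm y) (hs.mono fun i h => h.norm_le _)
  set fL : D.thread →ₗ[ℂ] ℂ :=
    { toFun := f
      map_add' := fun y z => huniq _ _ (((hf y).add (hf z)).congr fun i => (map_add (s i) _ _).symm)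
      map_smul' := fun c y => huniq _ _ (((hf y).const_smul c).congr fun i =>
        (map_smul (s i) c _).symm) } with hfL
  -- The bound by the limit norm makes the limit functional depend only on the element of A.
  have hcongr : ∀ y z : D.thread, D.limHom y = D.limHom z → fL y = fL z := fun y z h => by
    have := hbound (y - z)
    rw [map_sub, h, sub_self, norm_zero, mul_zero] at this
    exact sub_eq_zero.1 ((map_sub fL y z).symm.trans (norm_le_zero_iff.1 this))
  have hfv : f v = 1 := huniq _ _ (tendsto_const_nhds.congr' (by
    filter_upwards [hs] with i h
    exact h.map_self.symm))
  obtain ⟨τ, hτ⟩ := exists_tracialState D.limHom D.denseRange_limHom fL hbound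
    (fun y => ge_of_tendsto (hf (star y * y)) (hs.mono fun i h => h.nonneg (y.1 i)))
    (fun y => by
      -- The stage functionals are tracial only on the corner of v, so y is replaced by a thread in
      -- that corner with the same limit.
      set w := v * y * v with hw
      have e : D.limHom w = D.limHom y := by rw [hw, map_mul, map_mul, hv1, one_mul, mul_one]
      rw [hcongr (star y * y) (star w * w) (by rw [map_mul, map_mul, map_star, map_star, e]),
        hcongr (y * star y) (w * star w) (by rw [map_mul, map_mul, map_star, map_star, e])]
      refine huniq _ _ ((hf (w * star w)).congr' ?_)
      filter_upwards [hs, h𝒰 hv] with i h1 h2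
      have h3 := h2.isIdempotentElem.eq
      have h4 : v.1 i * w.1 i * v.1 i = w.1 i := by
        change v.1 i * (v.1 i * y.1 i * v.1 i) * v.1 i = v.1 i * y.1 i * v.1 i
        rw [← mul_assoc, ← mul_assoc, h3, mul_assoc _ (v.1 i) (v.1 i), h3]
      refine h1.comm _ _ h4 ?_
      have := congrArg star h4
      rwa [star_mul, star_mul, h2.isSelfAdjoint.star_eq, ← mul_assoc] at this) hv1 hfv
  exact ⟨τ, fun y => by rw [hτ]; exact hf y⟩

/-- A thread of projections with limit `1`. -/
theorem exists_unit_thread : ∃ v : D.thread, (∀ᶠ i in atTop, IsStarProjection (v.1 i)) ∧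
    D.limHom v = 1 := by
  obtain ⟨l, hl⟩ := D.exists_unit
  obtain ⟨v, hvl, hvi, hv⟩ := D.exists_thread l (D.sys.S l).model.unit
  refine ⟨v, eventually_atTop.2 ⟨l, fun i hi => ?_⟩, hv.trans hl⟩
  induction i, hi using Nat.le_induction with
  | base => rw [hvl]; exact (D.sys.S l).model.isStarProjection_unit
  | succ i hi ih =>
    rw [hvi i hi]
    exact ⟨by rw [IsIdempotentElem, ← map_mul, ih.isIdempotentElem.eq],
      by rw [IsSelfAdjoint, ← map_star, ih.isSelfAdjoint.star_eq]⟩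

/-- If a tracial state is a limit of normalised traces of bounded rank, then the algebra is
finite-dimensional. -/
theorem finiteDimensional_of_rank_bounded [PartialOrder A] [StarOrderedRing A]
    (hA : IsSimpleCStar A) (𝒰 : Ultrafilter ℕ) (h𝒰 : (𝒰 : Filter ℕ) ≤ atTop) {v : D.thread}
    (hv : ∀ᶠ i in atTop, IsStarProjection (v.1 i)) (hv1 : D.limHom v = 1)
    (s : ∀ i, (D.sys.S i).Alg →ₗ[ℂ] ℂ) (τ : tracialStates A)
    (hτ : ∀ y : D.thread,
      Tendsto (fun i => s i (y.1 i)) 𝒰 (𝓝 ((τ : WeakDual ℂ A) (D.limHom y)))) (N : ℕ)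
    (hdet : ∀ᶠ i in (𝒰 : Filter ℕ), ∀ a : Fin (N * N + 1) → (D.sys.S i).Alg,
      (∀ j, v.1 i * a j * v.1 i = a j) →
        (Matrix.of fun j k => s i (star (a j) * a k)).det = 0) :
    FiniteDimensional ℂ A := by
  -- The Gram determinants vanish in the limit as well; a null vector gives an element a with τ(a⋆a)
  -- = 0, and faithfulness turns this into a linear relation.
  have hdep : ∀ y : Fin (N * N + 1) → D.thread, ¬ LinearIndependent ℂ fun j => D.limHom (y j) := by
    intro y hli
    set w : Fin (N * N + 1) → D.thread := fun j => v * y j * v with hw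
    have ew : ∀ j, D.limHom (w j) = D.limHom (y j) := fun j => by
      simp only [hw, map_mul, hv1, one_mul, mul_one]
    set G : Matrix (Fin (N * N + 1)) (Fin (N * N + 1)) ℂ :=
      Matrix.of fun j k => (τ : WeakDual ℂ A) (D.limHom (star (w j) * w k)) with hG
    have hlim : Tendsto (fun i => Matrix.of fun j k => s i (star ((w j).1 i) * (w k).1 i)) 𝒰 (𝓝 G) :=
      tendsto_pi_nhds.2 fun j => tendsto_pi_nhds.2 fun k => hτ (star (w j) * w k)
    have hdetc : Continuous fun M : Matrix (Fin (N * N + 1)) (Fin (N * N + 1)) ℂ => M.det :=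
      Continuous.matrix_det continuous_id
    have hG0 : G.det = 0 := by
      refine tendsto_nhds_unique ((hdetc.tendsto G).comp hlim) (tendsto_const_nhds.congr' ?_)
      filter_upwards [hdet, h𝒰 hv] with i h1 h2
      refine (h1 (fun j => (w j).1 i) fun j => ?_).symm
      have h3 := h2.isIdempotentElem.eq
      change v.1 i * (v.1 i * (y j).1 i * v.1 i) * v.1 i = v.1 i * (y j).1 i * v.1 i
      rw [← mul_assoc, ← mul_assoc, h3, mul_assoc _ (v.1 i) (v.1 i), h3]
    obtain ⟨c, hc, hGc⟩ := Matrix.exists_mulVec_eq_zero_iff.2 hG0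
    set a : A := ∑ j, c j • D.limHom (y j) with ha
    have h1 : ∀ j, (τ : WeakDual ℂ A) (star (D.limHom (y j)) * a) = 0 := fun j => by
      have := congrFun hGc j
      simp only [Matrix.mulVec, dotProduct, hG, Matrix.of_apply, Pi.zero_apply, map_mul, map_star,
        ew] at this
      rw [← this, ha, Finset.mul_sum, map_sum]
      refine Finset.sum_congr rfl fun k _ => ?_
      rw [mul_smul_comm, map_smul, smul_eq_mul, mul_comm]
    have h2 : (τ : WeakDual ℂ A) (star a * a) = 0 := by
      conv_lhs => rw [ha, star_sum, Finset.sum_mul, map_sum]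
      refine Finset.sum_eq_zero fun j _ => ?_
      rw [star_smul, smul_mul_assoc, map_smul, ← ha, h1, smul_zero]
    have h3 := tracialStates_faithful hA τ h2
    rw [Fintype.linearIndependent_iff] at hli
    exact hc (funext fun j => hli c h3 j)
  set V : Submodule ℂ A := LinearMap.range
    ({ toFun := D.limHom, map_add' := map_add _, map_smul' := map_smul _ } : D.thread →ₗ[ℂ] A)
  have hV : Module.rank ℂ V ≤ (N * N : ℕ) := by
    refine rank_le fun t ht => ?_
    by_contra! hlt
    obtain ⟨t', ht't, ht'⟩ := Finset.exists_subset_card_eq (show N * N + 1 ≤ t.card from hlt)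
    set g : Fin (N * N + 1) ≃ t' := (Fintype.equivFinOfCardEq (by simpa using ht')).symm
    have h1 := (ht.comp (fun j => (⟨g j, ht't (g j).2⟩ : t)) fun j k h => g.injective
      (Subtype.ext (congrArg (fun x : t => (x : V)) h))).map' V.subtype (Submodule.ker_subtype V)
    have h2 : ∀ j, ∃ y, D.limHom y = ((g j : V) : A) := fun j => (g j : V).2
    choose y hy using h2
    refine hdep y ?_
    have e : (fun j => D.limHom (y j)) = fun j => ((g j : V) : A) := funext hy
    rw [e]
    exact h1
  have hfin : FiniteDimensional ℂ V :=
    Module.rank_lt_aleph0_iff.1 (hV.trans_lt (Cardinal.natCast_lt_aleph0))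
  -- A finite-dimensional subspace is closed, so the dense image is all of A.
  have hclosed : IsClosed (V : Set A) := V.closed_of_finiteDimensional
  have htop : V = ⊤ := by
    rw [← SetLike.coe_set_eq, ← hclosed.closure_eq]
    exact D.denseRange_limHom.closure_range
  rw [htop] at hfin
  exact Module.Finite.equiv Submodule.topEquiv

/-- Elements which are positive on traces may be approximated in a stage by elements with
nonnegative pointwise trace, supported in a corner of large rank. -/
theorem exists_asymptotic [PartialOrder A] [StarOrderedRing A] (hA : IsSimpleCStar A)
    (hinf : ¬ FiniteDimensional ℂ A) {c : A} (hc : IsSelfAdjoint c)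
    (hpos : ∀ τ : tracialStates A, 0 < ((τ : WeakDual ℂ A) c).re) (N : ℕ) {ε : ℝ} (hε : 0 < ε) :
    ∃ (m : ℕ) (q z : (D.sys.S m).Alg), IsStarProjection q ∧ D.ψ m q = 1 ∧ q * z * q = z ∧
      IsSelfAdjoint z ∧ ‖D.ψ m z - c‖ < ε ∧ ∀ x : (D.sys.S m).model.X,
        0 ≤ ((D.sys.S m).model.Φ z x).trace.re ∧
          ((D.sys.S m).model.Φ q x = 0 ∨ (N : ℝ) ≤ ((D.sys.S m).model.Φ q x).trace.re) := by
  obtain ⟨γ, hγ, hγc⟩ : ∃ γ > 0, ∀ τ : tracialStates A, γ ≤ ((τ : WeakDual ℂ A) c).re := by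
    rcases isEmpty_or_nonempty (tracialStates A) with h | h
    · exact ⟨1, one_pos, fun τ => (h.false τ).elim⟩
    · obtain ⟨τ₀, -, hτ₀⟩ := isCompact_univ.exists_isMinOn Set.univ_nonempty
        (continuous_tracialStates_re c).continuousOn
      exact ⟨_, hpos τ₀, fun τ => hτ₀ (Set.mem_univ τ)⟩
  obtain ⟨v, hv, hv1⟩ := D.exists_unit_thread
  obtain ⟨y, hy⟩ := D.denseRange_limHom.exists_dist_lt c (lt_min hε hγ)
  rw [dist_comm, dist_eq_norm] at hy
  -- Symmetrised and cut down by v, so that it lives in the corner at all late stages; the limit is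
  -- unchanged up to taking the real part.
  set z : D.thread := v * ((1 / 2 : ℂ) • (y + star y)) * v with hz
  have hzlim : ‖D.limHom z - c‖ < min ε γ := by
    have e : D.limHom z - c = (1 / 2 : ℂ) • ((D.limHom y - c) + star (D.limHom y - c)) := by
      rw [hz, map_mul, map_mul, hv1, one_mul, mul_one, map_smul, map_add, map_star, star_sub,
        hc.star_eq]
      module
    rw [e]
    refine lt_of_le_of_lt ?_ hy
    rw [norm_smul]
    have := norm_add_le (D.limHom y - c) (star (D.limHom y - c))
    rw [norm_star] at this
    rw [show ‖(1 / 2 : ℂ)‖ = 1 / 2 by simp]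
    linarith
  have hzs : ∀ᶠ i in atTop, v.1 i * z.1 i * v.1 i = z.1 i ∧ IsSelfAdjoint (z.1 i) := by
    filter_upwards [hv] with i h2
    have h3 := h2.isIdempotentElem.eq
    have e : z.1 i = v.1 i * ((1 / 2 : ℂ) • (y.1 i + star (y.1 i))) * v.1 i := rfl
    rw [e]
    constructor
    · rw [← mul_assoc, ← mul_assoc, h3, mul_assoc _ (v.1 i) (v.1 i), h3]
    · rw [IsSelfAdjoint, star_mul, star_mul, star_smul, star_add, star_star,
        h2.isSelfAdjoint.star_eq, mul_assoc, add_comm (star (y.1 i))]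
      congr 3
      simp
  -- If no stage works, every late stage has a point x in the support of v where the trace of z is
  -- negative or the rank of v is below N. The normalised traces at these points feed the
  -- ultrafilter limit.
  by_contra! hcon
  have hbad : ∀ᶠ i in atTop, ∃ x : (D.sys.S i).model.X, (D.sys.S i).model.Φ (v.1 i) x ≠ 0 ∧
      (((D.sys.S i).model.Φ (z.1 i) x).trace.re < 0 ∨
        ((D.sys.S i).model.Φ (v.1 i) x).trace.re < N) := by
    filter_upwards [hv, hzs, D.limHom_spec v, D.limHom_spec z] with i h1 h2 h3 h4
    obtain ⟨x, hx⟩ := hcon i (v.1 i) (z.1 i) h1 (h3.trans hv1) h2.1 h2.2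
      (by rw [h4]; exact hzlim.trans_le (min_le_left _ _))
    refine ⟨x, ?_⟩
    by_cases h0 : 0 ≤ ((D.sys.S i).model.Φ (z.1 i) x).trace.re
    · exact ⟨(hx h0).1, Or.inr (hx h0).2⟩
    · refine ⟨fun h5 => h0 ?_, Or.inl (not_le.1 h0)⟩
      rw [← h2.1, map_mul, map_mul, MF.mul_apply, h5, mul_zero, map_zero, Complex.zero_re]
  have hst : ∀ᶠ i in atTop, ∃ s : (D.sys.S i).Alg →ₗ[ℂ] ℂ, IsCornerState (v.1 i) s ∧
      ((s (z.1 i)).re ≤ 0 ∨ ∀ a : Fin (N * N + 1) → (D.sys.S i).Alg,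
        (∀ j, v.1 i * a j * v.1 i = a j) →
          (Matrix.of fun j k => s (star (a j) * a k)).det = 0) := by
    filter_upwards [hbad, hv, hzs] with i h0 h1 h2
    set M := (D.sys.S i).model
    obtain ⟨x, hx, hx'⟩ := h0
    have hQ : IsStarProjection (M.Φ (v.1 i) x) := by
      constructor
      · rw [IsIdempotentElem, ← MF.mul_apply, ← map_mul, h1.isIdempotentElem.eq]
      · rw [IsSelfAdjoint, ← MF.star_apply, ← map_star, h1.isSelfAdjoint.star_eq]
    have hcut : ∀ a, v.1 i * a * v.1 i = a →
        M.Φ (v.1 i) x * M.Φ a x * M.Φ (v.1 i) x = M.Φ a x := fun a ha => by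
      rw [← MF.mul_apply, ← MF.mul_apply, ← map_mul, ← map_mul, ha]
    refine ⟨{ toFun := fun a => Mat.cornerTrace (M.Φ (v.1 i) x) (M.Φ a x)
              map_add' := fun a b => by rw [map_add, MF.add_apply, map_add]
              map_smul' := fun c a => by
                rw [map_smul, MF.smul_apply, map_smul, RingHom.id_apply] },
      M.isCornerState h1 (x := x) hx _ fun a => rfl, hx'.imp (fun h => ?_) fun h a ha => ?_⟩
    · change (Mat.cornerTrace (M.Φ (v.1 i) x) (M.Φ (z.1 i) x)).re ≤ 0
      rw [Mat.cornerTrace_apply, hcut _ h2.1]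
      have h3 := Mat.trace_inv_nonneg hQ
      rw [Complex.le_def, Complex.zero_re, Complex.zero_im] at h3
      rw [Complex.mul_re, ← h3.2, zero_mul, sub_zero]
      exact mul_nonpos_of_nonneg_of_nonpos h3.1 h.le
    · have := Mat.det_cornerTrace_eq_zero hQ h (ι := Fin (N * N + 1)) (by simp)
        (a := fun j => M.Φ (a j) x) fun j => hcut _ (ha j)
      rw [← this]
      congr 1
      ext j k
      change Mat.cornerTrace _ (M.Φ (star (a j) * a k) x) = _
      rw [map_mul, map_star]
      rfl
  choose! s hs using fun (i : ℕ) (h : ∃ s : (D.sys.S i).Alg →ₗ[ℂ] ℂ, IsCornerState (v.1 i) s ∧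
      ((s (z.1 i)).re ≤ 0 ∨ ∀ a : Fin (N * N + 1) → (D.sys.S i).Alg,
        (∀ j, v.1 i * a j * v.1 i = a j) →
          (Matrix.of fun j k => s (star (a j) * a k)).det = 0)) => h
  set 𝒰 : Ultrafilter ℕ := hyperfilter ℕ
  have h𝒰 : (𝒰 : Filter ℕ) ≤ atTop := Nat.hyperfilter_le_atTop
  have hs' : ∀ᶠ i in (𝒰 : Filter ℕ), _ := h𝒰 (hst.mono fun i h => hs i h)
  obtain ⟨τ, hτ⟩ := D.exists_limit_state 𝒰 h𝒰 hv hv1 s (hs'.mono fun i h => h.1)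
  -- The ultrafilter selects one defect: either the limit trace is nonpositive on an element within
  -- γ of c, although it is at least γ on c, or the ranks are bounded and A is finite-dimensional.
  rcases Ultrafilter.eventually_or.1 (hs'.mono fun i h => h.2) with h | h
  · have h1 : ((τ : WeakDual ℂ A) (D.limHom z)).re ≤ 0 :=
      le_of_tendsto ((Complex.continuous_re.tendsto _).comp (hτ z)) h
    have hds : IsSelfAdjoint (D.limHom z - c) := by
      obtain ⟨i, h2, h3⟩ := (hzs.and (D.limHom_spec z)).exists
      rw [← h3]
      exact (h2.2.map (D.ψ i)).sub hc
    have h2 := (abs_le.1 (tracialStates_abs_re_le τ.2 hds)).1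
    rw [map_sub, Complex.sub_re] at h2
    have h3 := hγc τ
    have h4 := hzlim.trans_le (min_le_right ε γ)
    linarith
  · exact hinf (D.finiteDimensional_of_rank_bounded hA 𝒰 h𝒰 hv hv1 s τ hτ N h)

end AHData

/-- A quasitrace as a function on the algebra. -/
def QT.one {A : Type u} [CStarAlgebra A] [PartialOrder A] [StarOrderedRing A] (σ : QT A) (a : A) : ℂ :=
  σ.toFun 1 (Mat.of fun _ _ => a)

section QTOne

variable {A : Type u} [CStarAlgebra A] [PartialOrder A] [StarOrderedRing A] (σ : QT A)

/-- Elements as `1 × 1` matrices. -/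
def Mat.scalar (A : Type u) [CStarAlgebra A] [PartialOrder A] [StarOrderedRing A] :
    A →⋆ₙₐ[ℂ] Mat 1 A where
  toFun a := Mat.of fun _ _ => a
  map_smul' _ _ := rfl
  map_zero' := rfl
  map_add' _ _ := rfl
  map_mul' a b := Mat.ext fun i j => by simp
  map_star' _ := rfl

theorem QT.isQuasitrace_one : IsQuasitrace σ.one := (σ.isQuasitrace 1).comp (Mat.scalar A)

theorem QT.one_one : σ.one 1 = 1 := by
  rw [← σ.normalized, QT.one]
  congr 1
  apply Mat.ext; intro i j
  rw [Mat.entry_of, Mat.entry_one, if_pos (Subsingleton.elim i j)]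

theorem QT.toFun_pad {n N : ℕ} (h : n ≤ N) (a : Mat n A) : σ.toFun N (pad N a) = σ.toFun n a := by
  induction N, h using Nat.le_induction with
  | base => rw [pad_self]
  | succ N h ih => rw [← pad_pad h, σ.compat, ih]

end QTOne

theorem Mat.single_mul_mul_single {n : ℕ} (Q : Mat n ℂ) (l m p : Fin n) :
    Mat.single l m * Q * Mat.single m p = Q.entry m m • Mat.single l p := by
  apply Mat.ext; intro i j
  by_cases hi : i = l <;> by_cases hj : j = p <;>
    simp [Mat.entry_mul, Mat.single, hi, hj]

theorem Mat.star_single {n : ℕ} (l m : Fin n) : star (Mat.single l m) = Mat.single m l := by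
  apply Mat.ext; intro i j
  simp only [Mat.entry_star, Mat.single, Mat.entry_of, and_comm]
  split_ifs <;> simp

theorem Mat.sum_single (n : ℕ) : ∑ l : Fin n, Mat.single l l = 1 := by
  apply Mat.ext; intro i j
  rw [Mat.entry_sum, Mat.entry_one]
  simp [Mat.single, ite_and, eq_comm]

theorem toComplex_add {X : Type*} [TopologicalSpace X] (g h : C(X, ℝ)) :
    toComplex (g + h) = toComplex g + toComplex h :=
  ContinuousMap.ext fun _ => Complex.ofReal_add _ _

theorem toComplex_const_smul {X : Type*} [TopologicalSpace X] (c : ℝ) (g : C(X, ℝ)) :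
    toComplex (c • g) = (c : ℂ) • toComplex g :=
  ContinuousMap.ext fun _ => Complex.ofReal_mul _ _

/-! ### Diagonal block matrices over a corner -/

namespace CornerMap

variable {X : Type} [TopologicalSpace X] [CompactSpace X] {n : ℕ} {A : Type u} [CStarAlgebra A]
  (Θ : CornerMap X n A)

/-- The rescaled images of the matrix units. -/
def unitMap (l m : Fin n) : C(X, ℝ) →ₗ[ℝ] A where
  toFun g := Θ.toFun (fsmul (toComplex (g * Θ.invRho)) (MF.const X (Mat.single l m)))
  map_add' g h := by rw [add_mul, toComplex_add, add_fsmul, map_add]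
  map_smul' c g := by
    rw [smul_mul_assoc, toComplex_const_smul, RingHom.id_apply, ← Complex.coe_smul, ← map_smul]
    congr 1
    exact MF.ext fun x => smul_assoc (c : ℂ) _ _

theorem unitMap_apply (l m : Fin n) (g : C(X, ℝ)) : Θ.unitMap l m g =
    Θ.toFun (fsmul (toComplex (g * Θ.invRho)) (MF.const X (Mat.single l m))) := rfl

theorem star_unitMap (l m : Fin n) (g : C(X, ℝ)) : star (Θ.unitMap l m g) = Θ.unitMap m l g := by
  rw [unitMap_apply, unitMap_apply, ← Θ.map_star, star_fsmul, star_toComplex]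
  congr 2
  exact MF.ext fun x => Mat.star_single l m

/-- The diagonal entries of the corner projection. -/
def diag (m : Fin n) : C(X, ℝ) := ⟨fun x => ((Θ.Q x).entry m m).re,
  Complex.continuous_re.comp ((entryL (A := ℂ) n m m).continuous.comp Θ.Q.continuous)⟩

theorem entry_diag (m : Fin n) (x : X) : (Θ.Q x).entry m m = (Θ.diag m x : ℂ) := by
  have h := Mat.entry_diag_of_isStarProjection (Θ.isStarProjection_apply x) m
  refine Complex.ext rfl ?_
  rw [h, Complex.ofReal_im, Complex.ofReal_im]

theorem sum_diag : ∑ m, Θ.diag m = Θ.rho := by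
  ext x
  simp only [ContinuousMap.sum_apply, diag, rho, ContinuousMap.coe_mk, Mat.trace_apply,
    Complex.re_sum]

theorem invRho_mul_rho_mul_invRho : Θ.invRho * Θ.rho * Θ.invRho = Θ.invRho := by
  ext x
  simp only [ContinuousMap.mul_apply]
  rcases Θ.rho_cases x with ⟨-, -, h⟩ | ⟨-, h⟩
  · rw [h]; ring
  · rw [h, one_mul]

theorem unitMap_mul (g h : C(X, ℝ)) (l m p : Fin n) :
    Θ.unitMap l m g * Θ.unitMap m p h = Θ.unitMap l p (g * h * (Θ.invRho * Θ.diag m)) := by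
  rw [unitMap_apply, unitMap_apply, unitMap_apply, Θ.map_mul, fsmul_mul, fsmul_mul_fsmul]
  congr 1
  refine MF.ext fun x => ?_
  rw [fsmul_apply, fsmul_apply, MF.mul_apply, MF.mul_apply, MF.const_apply, MF.const_apply,
    MF.const_apply, Mat.single_mul_mul_single, entry_diag, smul_smul]
  congr 1
  simp only [ContinuousMap.mul_apply, toComplex_apply]
  push_cast
  ring

theorem unitMap_mul_rank (g : C(X, ℝ)) (l p : Fin n) :
    Θ.unitMap l p (g * (Θ.invRho * Θ.rho)) = Θ.unitMap l p g := by
  rw [unitMap_apply, unitMap_apply, mul_assoc, Θ.invRho_mul_rho_mul_invRho]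

/-- The matrix (Q e_lm Q)_{l,m} is ξξ⋆ for ξ = ∑ Q e_l ⊗ e_l, and ‖ξ‖² = ∑ Q_mm = ρ. Dividing by ρ
therefore gives a rank one projection over the support of Q, and the matrices with entries `unitMap
l m g` multiply like the functions g. -/
theorem sum_unitMap_mul (g h : C(X, ℝ)) (l p : Fin n) :
    ∑ m, Θ.unitMap l m g * Θ.unitMap m p h = Θ.unitMap l p (g * h) := by
  simp only [unitMap_mul]
  rw [← map_sum, ← Finset.mul_sum, ← Finset.mul_sum, sum_diag, unitMap_mul_rank]

variable [PartialOrder A] [StarOrderedRing A]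

/-- Functions on `X × {0, …, K - 1}` as block diagonal matrices. -/
def block (K : ℕ) (h : Fin K → C(X, ℝ)) : Mat (K * n) A := Mat.of fun i j =>
  if (finProdFinEquiv.symm i).1 = (finProdFinEquiv.symm j).1 then
    Θ.unitMap (finProdFinEquiv.symm i).2 (finProdFinEquiv.symm j).2 (h (finProdFinEquiv.symm i).1)
  else 0

theorem block_entry {K : ℕ} (h : Fin K → C(X, ℝ)) (a b : Fin K × Fin n) :
    (Θ.block K h).entry (finProdFinEquiv a) (finProdFinEquiv b) =
      if a.1 = b.1 then Θ.unitMap a.2 b.2 (h a.1) else 0 := by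
  simp only [block, Mat.entry_of, Equiv.symm_apply_apply]

theorem _root_.CStarCuntz.Mat.ext_prod {K n : ℕ} {a b : Mat (K * n) A}
    (h : ∀ i j : Fin K × Fin n, a.entry (finProdFinEquiv i) (finProdFinEquiv j)
      = b.entry (finProdFinEquiv i) (finProdFinEquiv j)) : a = b :=
  Mat.ext fun i j => by
    have := h (finProdFinEquiv.symm i) (finProdFinEquiv.symm j)
    simpa only [Equiv.apply_symm_apply] using this

theorem _root_.CStarCuntz.Mat.entry_mul_prod {K n : ℕ} (a b : Mat (K * n) A) (i j : Fin (K * n)) :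
    (a * b).entry i j
      = ∑ k, ∑ m, a.entry i (finProdFinEquiv (k, m)) * b.entry (finProdFinEquiv (k, m)) j := by
  rw [Mat.entry_mul, ← finProdFinEquiv.sum_comp, Fintype.sum_prod_type]

theorem block_mul {K : ℕ} (g h : Fin K → C(X, ℝ)) :
    Θ.block K g * Θ.block K h = Θ.block K (g * h) := by
  refine Mat.ext_prod fun i j => ?_
  rw [Mat.entry_mul_prod, block_entry, Finset.sum_eq_single i.1]
  · simp only [block_entry, if_true]
    by_cases hij : i.1 = j.1
    · simp only [if_pos hij, Pi.mul_apply, Θ.sum_unitMap_mul]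
    · simp only [if_neg hij, mul_zero, Finset.sum_const_zero]
  · intro k _ hk
    refine Finset.sum_eq_zero fun m _ => ?_
    rw [block_entry, if_neg (Ne.symm hk), zero_mul]
  · simp

theorem star_block {K : ℕ} (h : Fin K → C(X, ℝ)) : star (Θ.block K h) = Θ.block K h := by
  refine Mat.ext_prod fun i j => ?_
  rw [Mat.entry_star, block_entry, block_entry]
  by_cases hij : i.1 = j.1
  · rw [if_pos hij, if_pos hij.symm, star_unitMap, hij]
  · rw [if_neg hij, if_neg (Ne.symm hij), star_zero]

/-- `block` as a linear map. -/
def blockL (K : ℕ) : (Fin K → C(X, ℝ)) →ₗ[ℝ] Mat (K * n) A where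
  toFun := Θ.block K
  map_add' g h := by
    refine Mat.ext_prod fun i j => ?_
    rw [Mat.entry_add, block_entry, block_entry, block_entry]
    split_ifs
    · rw [Pi.add_apply, map_add]
    · rw [add_zero]
  map_smul' c h := by
    refine Mat.ext_prod fun i j => ?_
    rw [RingHom.id_apply, ← Complex.coe_smul, Mat.entry_smul, block_entry, block_entry]
    split_ifs
    · rw [Pi.smul_apply, map_smul, Complex.coe_smul]
    · rw [smul_zero]

theorem blockL_apply {K : ℕ} (h : Fin K → C(X, ℝ)) : Θ.blockL K h = Θ.block K h := rfl

theorem block_nonneg {K : ℕ} {h : Fin K → C(X, ℝ)} (hh : ∀ k x, 0 ≤ h k x) : 0 ≤ Θ.block K h := by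
  set s : Fin K → C(X, ℝ) := fun k => ⟨fun x => √(h k x), by fun_prop⟩ with hs
  have : h = s * s := by
    ext k x
    simp [hs, Real.mul_self_sqrt (hh k x)]
  rw [this, ← block_mul]
  conv_rhs => enter [1]; rw [← star_block]
  exact star_mul_self_nonneg _

/-- The quasitrace of a block with one nonzero entry. -/
theorem quasitrace_block_single (σ : QT A) {K : ℕ} (k : Fin K) (l : Fin n) {g : C(X, ℝ)}
    (hg : ∀ x, 0 ≤ g x) :
    σ.toFun (K * n) (Θ.block K (Pi.single k (g * (Θ.invRho * Θ.diag l))))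
      = σ.one (Θ.unitMap l l g) := by
  have hpos : 0 < K * n := Nat.mul_pos (Fin.pos k) (Fin.pos l)
  set s : C(X, ℝ) := ⟨fun x => √(g x), by fun_prop⟩ with hs
  have hss : s * s = g := by
    ext x
    simp [hs, Real.mul_self_sqrt (hg x)]
  set z : Fin (K * n) := ⟨0, hpos⟩ with hz
  -- A matrix with a single nonzero row: y⋆y is the block and y y⋆ has only one entry, so the trace
  -- property moves the block to a 1 × 1 corner.
  set y : Mat (K * n) A := Mat.of fun i j =>
    if i = z ∧ (finProdFinEquiv.symm j).1 = k then Θ.unitMap l (finProdFinEquiv.symm j).2 s else 0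
    with hy
  have hyz : ∀ b : Fin K × Fin n, y.entry z (finProdFinEquiv b) =
      if b.1 = k then Θ.unitMap l b.2 s else 0 := fun b => by
    simp only [hy, Mat.entry_of, Equiv.symm_apply_apply, true_and]
  have hy0 : ∀ i j, i ≠ z → y.entry i j = 0 := fun i j hi => by
    simp only [hy, Mat.entry_of, hi, false_and, if_false]
  have h1 : star y * y = Θ.block K (Pi.single k (g * (Θ.invRho * Θ.diag l))) := by
    refine Mat.ext_prod fun i j => ?_
    rw [Mat.entry_mul, Finset.sum_eq_single z, Mat.entry_star, hyz, hyz, block_entry]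
    · by_cases hi : i.1 = k
      · by_cases hj : j.1 = k
        · rw [if_pos hi, if_pos hj, if_pos (hi.trans hj.symm), star_unitMap, unitMap_mul, hss, hi,
            Pi.single_eq_same]
        · rw [if_neg hj, mul_zero, if_neg fun h' => hj (h'.symm.trans hi)]
      · rw [if_neg hi, star_zero, zero_mul]
        split_ifs
        · rw [Pi.single_eq_of_ne hi, map_zero]
        · rfl
    · intro b _ hb
      rw [hy0 b _ hb, mul_zero]
    · simp
  have h2 : y * star y = pad (K * n) (Mat.of fun _ _ => Θ.unitMap l l g : Mat 1 A) := by
    apply Mat.ext; intro i j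
    have hlt : ∀ i : Fin (K * n), (i : ℕ) < 1 ↔ i = z := fun i => by
      rw [Nat.lt_one_iff, Fin.ext_iff]
    by_cases hi : i = z
    · by_cases hj : j = z
      · subst hi; subst hj
        rw [Mat.entry_mul_prod, Finset.sum_eq_single k]
        · simp only [Mat.entry_star, hyz, if_true, star_unitMap, Θ.sum_unitMap_mul, hss]
          simp [pad, hlt]
        · intro b _ hb
          refine Finset.sum_eq_zero fun m _ => ?_
          rw [hyz, if_neg hb, zero_mul]
        · simp
      · have : (pad (K * n) (Mat.of fun _ _ => Θ.unitMap l l g : Mat 1 A)).entry i j = 0 := by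
          simp [pad, hlt, hj]
        rw [this, Mat.entry_mul]
        exact Finset.sum_eq_zero fun b _ => by rw [Mat.entry_star, hy0 j _ hj, star_zero, mul_zero]
    · have : (pad (K * n) (Mat.of fun _ _ => Θ.unitMap l l g : Mat 1 A)).entry i j = 0 := by
        simp [pad, hlt, hi]
      rw [this, Mat.entry_mul]
      exact Finset.sum_eq_zero fun b _ => by rw [hy0 i _ hi, zero_mul]
  rw [← h1, (σ.isQuasitrace _).tracial, h2, σ.toFun_pad hpos]
  rfl

/-- The quasitrace of a block diagonal matrix. -/
theorem quasitrace_block [T2Space X] (σ : QT A) {K : ℕ} {h : Fin K → C(X, ℝ)}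
    (hh : ∀ k x, 0 ≤ h k x) : σ.toFun (K * n) (Θ.block K h)
      = σ.one (Θ.toFun (fsmul (toComplex ((∑ k, h k) * Θ.invRho)) 1)) := by
  -- ρ is the sum of the diagonal entries of Q, so the block matrix splits into commuting pieces,
  -- each equivalent to a single entry.
  have hsum : Θ.block K h = ∑ a : Fin K × Fin n,
      Θ.block K (Pi.single a.1 (h a.1 * (Θ.invRho * Θ.diag a.2))) := by
    simp only [← blockL_apply]
    rw [← map_sum, Fintype.sum_prod_type, blockL_apply, blockL_apply]
    refine Mat.ext_prod fun i j => ?_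
    rw [block_entry, block_entry]
    congr 1
    rw [Finset.sum_apply, Finset.sum_eq_single i.1, Finset.sum_apply]
    · simp only [Pi.single_eq_same]
      rw [← Finset.mul_sum, ← Finset.mul_sum, sum_diag, unitMap_mul_rank]
    · intro k _ hk
      rw [Finset.sum_apply]
      exact Finset.sum_eq_zero fun m _ => Pi.single_eq_of_ne (Ne.symm hk) _
    · simp
  rw [hsum, (σ.isQuasitrace _).map_sum _ (fun a _ => Θ.star_block _) fun a _ b _ => by
    
    rw [Commute, SemiconjBy, block_mul, block_mul]
    exact congrArg (Θ.block K) (mul_comm _ _)]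
  rw [Finset.sum_congr rfl fun a _ => Θ.quasitrace_block_single σ a.1 a.2 (hh a.1)]
  -- The images in A of the diagonal matrix units need not commute; additivity on selfadjoint
  -- elements of the corner is what allows summing them.
  have hadd : ∀ t : Finset (Fin K × Fin n), σ.one (∑ a ∈ t, Θ.unitMap a.2 a.2 (h a.1))
      = ∑ a ∈ t, σ.one (Θ.unitMap a.2 a.2 (h a.1)) := by
    classical
    set w : Fin K × Fin n → MF X n := fun a =>
      fsmul (toComplex (h a.1 * Θ.invRho)) (MF.const X (Mat.single a.2 a.2)) with hw
    have hws : ∀ a, IsSelfAdjoint (w a) := fun a => isSelfAdjoint_fsmul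
      (MF.ext fun x => Mat.star_single a.2 a.2) _
    intro t
    induction t using Finset.induction_on with
    | empty => simpa using σ.isQuasitrace_one.map_zero
    | insert a t ha ih =>
      rw [Finset.sum_insert ha, Finset.sum_insert ha, ← ih]
      have e : ∑ b ∈ t, Θ.unitMap b.2 b.2 (h b.1) = Θ.toFun (∑ b ∈ t, w b) := by
        rw [map_sum]; rfl
      rw [e]
      have := Θ.quasitrace_add_of_isSelfAdjoint σ.isQuasitrace_one (hws a)
        (isSelfAdjoint_sum t fun b _ => hws b)
      rw [map_add] at this
      exact this
  rw [← hadd, Fintype.sum_prod_type]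
  congr 1
  have e1 : ∀ l, ∑ k, Θ.unitMap l l (h k) = Θ.unitMap l l (∑ k, h k) := fun l => (map_sum _ _ _).symm
  rw [Finset.sum_comm]
  rw [Finset.sum_congr rfl fun l _ => e1 l]
  simp only [unitMap_apply]
  rw [← map_sum]
  congr 1
  have : (1 : MF X n) = ∑ l, MF.const X (Mat.single l l) := by
    refine MF.ext fun x => ?_
    change _ = MF.eval x _
    rw [map_sum]
    exact (Mat.sum_single n).symm
  rw [this]
  exact (map_sum (fsmulL _) _ _).symm

end CornerMap

/-- The layers fill up one after another; for K above f they recover f. -/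
theorem sum_clamp (f : ℝ) (hf : 0 ≤ f) (K : ℕ) :
    ∑ k : Fin K, min (max (f - (k : ℕ)) 0) 1 = min f K := by
  rw [Fin.sum_univ_eq_sum_range (fun k => min (max (f - (k : ℝ)) 0) 1) K]
  induction K with
  | zero => simp [hf]
  | succ K ih =>
    rw [Finset.sum_range_succ, ih]
    push_cast
    rcases le_total f K with h | h
    · rw [max_eq_right (by linarith), min_eq_left zero_le_one, min_eq_left h,
        min_eq_left (by linarith), add_zero]
    · rw [max_eq_left (by linarith), min_eq_right h]
      rcases le_total f (K + 1) with h' | h'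
      · rw [min_eq_left (by linarith), min_eq_left h']; ring
      · rw [min_eq_right (by linarith), min_eq_right h']

/-- Fewer than f + 1 indices k satisfy k < f. This bounds the roots of the layers uniformly. -/
theorem sum_le_add_one {f : ℝ} (hf : 0 ≤ f) {K : ℕ} (w : Fin K → ℝ) (h1 : ∀ k, w k ≤ 1)
    (h0 : ∀ k : Fin K, f ≤ (k : ℕ) → w k = 0) : ∑ k, w k ≤ f + 1 := by
  -- The trivial bound K is carried along for the case f > K, where the last term may be nonzero.
  suffices ∑ k, w k ≤ f + 1 ∧ ∑ k, w k ≤ K from this.1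
  induction K with
  | zero => simp; linarith
  | succ K ih =>
    rw [Fin.sum_univ_castSucc]
    obtain ⟨h2, h3⟩ := ih (fun k => w k.castSucc) (fun k => h1 _) fun k hk => h0 k.castSucc (by simpa using hk)
    have h4 := h1 (Fin.last K)
    push_cast
    refine ⟨?_, by linarith⟩
    by_cases h : f ≤ (K : ℝ)
    · rw [h0 (Fin.last K) (by simpa using h)]; linarith
    · linarith

/-! ### Rank functions of block matrices -/

namespace CornerMap

variable {X : Type} [TopologicalSpace X] [CompactSpace X] {n : ℕ} {A : Type u} [CStarAlgebra A]
  (Θ : CornerMap X n A) [PartialOrder A] [StarOrderedRing A]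

theorem map_fsmul_one (g : C(X, ℂ)) : Θ.toFun (fsmul g 1) = Θ.toFun (fsmul g Θ.Q) := by
  rw [← Θ.map_cut (fsmul g 1), mul_fsmul, mul_one, fsmul_mul, Θ.isStarProjection.isIdempotentElem.eq]

theorem nonneg_fsmul_one {g : C(X, ℝ)} (hg : ∀ x, 0 ≤ g x) :
    0 ≤ Θ.toFun (fsmul (toComplex g) 1) := by
  set s : C(X, ℝ) := ⟨fun x => √(g x), by fun_prop⟩ with hs
  have hss : toComplex s * toComplex s = toComplex g := by
    ext x
    simp only [ContinuousMap.mul_apply, toComplex_apply, ← Complex.ofReal_mul, hs,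
      ContinuousMap.coe_mk, Real.mul_self_sqrt (hg x)]
  have hQs := Θ.isStarProjection.isSelfAdjoint
  have hQQ := Θ.isStarProjection.isIdempotentElem.eq
  have := Θ.nonneg_of_star_mul_self (y := fsmul (toComplex s) Θ.Q) (by rw [mul_fsmul, hQQ])
  rwa [(isSelfAdjoint_fsmul hQs s).star_eq, fsmul_mul_fsmul, hss, hQQ, ← Θ.map_fsmul_one] at this

/-- The integral of a function against a tracial state. -/
def integral (τ : tracialStates A) : C(X, ℝ) →ₗ[ℝ] ℝ where
  toFun g := ((τ : WeakDual ℂ A) (Θ.toFun (fsmul (toComplex (g * Θ.invRho)) 1))).re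
  map_add' g h := by rw [add_mul, toComplex_add, add_fsmul, map_add, map_add, Complex.add_re]
  map_smul' c g := by
    have : fsmul (toComplex (c • g * Θ.invRho)) (1 : MF X n)
        = (c : ℂ) • fsmul (toComplex (g * Θ.invRho)) 1 := by
      rw [smul_mul_assoc, toComplex_const_smul]
      exact MF.ext fun x => smul_assoc (c : ℂ) _ _
    rw [this, map_smul, map_smul, smul_eq_mul, Complex.re_ofReal_mul]
    rfl

theorem integral_apply (τ : tracialStates A) (g : C(X, ℝ)) : Θ.integral τ g =
    ((τ : WeakDual ℂ A) (Θ.toFun (fsmul (toComplex (g * Θ.invRho)) 1))).re := rfl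

theorem integral_nonneg (τ : tracialStates A) {g : C(X, ℝ)} (hg : ∀ x, 0 ≤ g x) :
    0 ≤ Θ.integral τ g :=
  (Complex.le_def.1 (tracialStates_nonneg τ.2 (Θ.nonneg_fsmul_one (g := g * Θ.invRho)
    fun x => mul_nonneg (hg x) (Θ.invRho_nonneg x)))).1

theorem integral_mono (τ : tracialStates A) {g h : C(X, ℝ)} (hgh : ∀ x, g x ≤ h x) :
    Θ.integral τ g ≤ Θ.integral τ h := by
  have := Θ.integral_nonneg τ (g := h - g) fun x => sub_nonneg.2 (hgh x)
  rw [map_sub] at this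
  linarith

/-- The integral of 1 is the trace of ρ⁻¹Q, so large ranks make it small. It is the price of
rounding F to integer ranks. -/
theorem integral_one_le (τ : tracialStates A) (h1 : Θ.toFun 1 = 1) {C : ℝ}
    (hC : ∀ x, Θ.invRho x ≤ C) : Θ.integral τ 1 ≤ C := by
  have h := (Complex.le_def.1 (tracialStates_nonneg τ.2 (Θ.nonneg_fsmul_one
    (g := ContinuousMap.const X C - Θ.invRho) fun x => sub_nonneg.2 (hC x)))).1
  have e1 : fsmul (toComplex (ContinuousMap.const X C - Θ.invRho)) (1 : MF X n)
      = (C : ℂ) • 1 - fsmul (toComplex (1 * Θ.invRho)) 1 := by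
    refine MF.ext fun x => ?_
    rw [fsmul_apply, MF.sub_apply, fsmul_apply, MF.smul_apply, one_mul, toComplex_apply,
      toComplex_apply, ContinuousMap.sub_apply, ContinuousMap.const_apply, Complex.ofReal_sub]
    exact sub_smul (C : ℂ) (Θ.invRho x : ℂ) ((1 : MF X n) x)
  rw [e1, map_sub, map_smul, h1, map_sub, map_smul, τ.2.2.1] at h
  rw [integral_apply]
  simp at h ⊢
  linarith

theorem quasitrace_block_re [T2Space X] {σ : QT A} {τ : tracialStates A}
    (hτ : ∀ f, (τ : WeakDual ℂ A) (Θ.toFun f) = σ.one (Θ.toFun f)) {K : ℕ} {h : Fin K → C(X, ℝ)}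
    (hh : ∀ k x, 0 ≤ h k x) :
    (σ.toFun (K * n) (Θ.block K h)).re = Θ.integral τ (∑ k, h k) := by
  rw [Θ.quasitrace_block σ hh, ← hτ]
  rfl

/-- (tr y / ρ) Q and y have the same pointwise trace, hence the same quasitrace. -/
theorem integral_tr [T2Space X] {σ : QT A} {τ : tracialStates A}
    (hτ : ∀ f, (τ : WeakDual ℂ A) (Θ.toFun f) = σ.one (Θ.toFun f)) {y : MF X n}
    (hy : IsSelfAdjoint y) :
    Θ.integral τ (Θ.tr y) = ((τ : WeakDual ℂ A) (Θ.toFun y)).re := by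
  rw [integral_apply, hτ, hτ, Θ.quasitrace_eq σ.isQuasitrace_one hy, map_fsmul_one, mul_comm]

theorem block_pow {K : ℕ} (h : Fin K → C(X, ℝ)) (s : ℕ) :
    Θ.block K h ^ (s + 1) = Θ.block K (h ^ (s + 1)) := by
  induction s with
  | zero => rw [zero_add, pow_one, pow_one]
  | succ s ih => rw [pow_succ, ih, block_mul, ← pow_succ]

/-- Pointwise roots. -/
def root {K : ℕ} (h : Fin K → C(X, ℝ)) (s : ℕ) : Fin K → C(X, ℝ) := fun k =>
  ⟨fun x => h k x ^ ((s + 1 : ℝ)⁻¹), (h k).continuous.rpow_const fun _ => Or.inr (by positivity)⟩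

theorem root_apply {K : ℕ} (h : Fin K → C(X, ℝ)) (s : ℕ) (k : Fin K) (x : X) :
    root h s k x = h k x ^ ((s + 1 : ℝ)⁻¹) := rfl

theorem block_root {K : ℕ} {h : Fin K → C(X, ℝ)} (hh : ∀ k x, 0 ≤ h k x) (s : ℕ) :
    Θ.block K h ^ ((s + 1 : ℝ≥0)⁻¹) = Θ.block K (root h s) := by
  have h1 : root h s ^ (s + 1) = h := by
    ext k x
    change (h k x ^ ((s + 1 : ℝ)⁻¹)) ^ (s + 1) = h k x
    have := Real.rpow_inv_natCast_pow (hh k x) (Nat.succ_ne_zero s)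
    push_cast at this
    exact this
  have h0 : 0 ≤ Θ.block K (root h s) := Θ.block_nonneg fun k x => Real.rpow_nonneg (hh k x) _
  have h2 : Θ.block K (root h s) ^ ((s + 1 : ℝ≥0)) = Θ.block K h := by
    rw [CFC.nnrpow_eq_rpow (by positivity)]
    have := CFC.rpow_natCast (Θ.block K (root h s)) (s + 1) h0
    push_cast at this ⊢
    rw [this, block_pow, h1]
  rw [← h2]
  exact CFC.nnrpow_nnrpow_inv _ (by positivity) h0

/-- Rank functions of block diagonal matrices. -/
theorem dimLim_block [T2Space X] {σ : QT A} {τ : tracialStates A}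
    (hτ : ∀ f, (τ : WeakDual ℂ A) (Θ.toFun f) = σ.one (Θ.toFun f)) {K : ℕ} {h : Fin K → C(X, ℝ)}
    (h0 : ∀ k x, 0 ≤ h k x) (h1 : ∀ k x, h k x ≤ 1) {G : C(X, ℝ)}
    (hG : ∀ s x, ∑ k, root h s k x ≤ G x) :
    Θ.integral τ (∑ k, h k) ≤ dimLim (σ.toFun (K * n)) (Θ.block K h) ∧
      dimLim (σ.toFun (K * n)) (Θ.block K h) ≤ Θ.integral τ G := by
  have e : ∀ s : ℕ, (σ.toFun (K * n) (Θ.block K h ^ ((s + 1 : ℝ≥0)⁻¹))).re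
      = Θ.integral τ (∑ k, root h s k) := fun s => by
    rw [Θ.block_root h0, Θ.quasitrace_block_re hτ]
    exact fun k x => Real.rpow_nonneg (h0 k x) _
  have hmono : Monotone fun s : ℕ => Θ.integral τ (∑ k, root h s k) := by
    refine monotone_nat_of_le_succ fun s => Θ.integral_mono τ fun x => ?_
    rw [ContinuousMap.sum_apply, ContinuousMap.sum_apply]
    refine Finset.sum_le_sum fun k _ => ?_
    rw [root_apply, root_apply]
    rcases (h0 k x).eq_or_lt with h2 | h2
    · rw [← h2, Real.zero_rpow (by positivity), Real.zero_rpow (by positivity)]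
    · refine Real.rpow_le_rpow_of_exponent_ge h2 (h1 k x) ?_
      push_cast
      gcongr
      linarith
  have hle : ∀ s : ℕ, Θ.integral τ (∑ k, root h s k) ≤ Θ.integral τ G := fun s =>
    Θ.integral_mono τ fun x => by rw [ContinuousMap.sum_apply]; exact hG s x
  have hbdd : BddAbove (Set.range fun s : ℕ => Θ.integral τ (∑ k, root h s k)) :=
    ⟨_, by rintro _ ⟨s, rfl⟩; exact hle s⟩
  -- Since h ≤ 1 the roots increase, so the limit is a supremum; its term at 0 is h itself, which is
  -- the lower bound.
  have hlim : dimLim (σ.toFun (K * n)) (Θ.block K h) = ⨆ s : ℕ, Θ.integral τ (∑ k, root h s k) := by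
    refine Tendsto.limUnder_eq ?_
    simp only [e]
    exact tendsto_atTop_ciSup hmono hbdd
  rw [hlim]
  refine ⟨?_, ciSup_le hle⟩
  refine le_trans (le_of_eq ?_) (le_ciSup hbdd 0)
  congr 2
  ext k x
  simp [root]

/-- With d = min(h, δ), the block of (h - δ)⁺ and δ - block(d) are orthogonal and positive. The
projection block(1) can be smaller than 1, and the difference contributes only to the negative part.
-/
theorem posPart_block_sub {K : ℕ} (h : Fin K → C(X, ℝ)) (h0 : ∀ k x, 0 ≤ h k x) {δ : ℝ}
    (hδ : 0 ≤ δ) : (Θ.block K h - algebraMap ℝ (Mat (K * n) A) δ)⁺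
      = Θ.block K fun k => (h k - ContinuousMap.const X δ) ⊔ 0 := by
  set c : Fin K → C(X, ℝ) := fun k => (h k - ContinuousMap.const X δ) ⊔ 0 with hc
  set d : Fin K → C(X, ℝ) := fun k => h k ⊓ ContinuousMap.const X δ with hd
  have hcd : h = c + d := by
    ext k x
    change h k x = max (h k x - δ) 0 + min (h k x) δ
    rcases le_total (h k x) δ with h' | h'
    · rw [max_eq_right (by linarith), min_eq_left h']; ring
    · rw [max_eq_left (by linarith), min_eq_right h']; ring
  have hdc : d * c = δ • c := by
    ext k x
    change min (h k x) δ * max (h k x - δ) 0 = δ * max (h k x - δ) 0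
    rcases le_total (h k x) δ with h' | h'
    · rw [max_eq_right (by linarith)]; ring
    · rw [min_eq_right h']
  have hb1 : Θ.block K h = Θ.block K c + Θ.block K d := by
    conv_lhs => rw [hcd]
    exact map_add (Θ.blockL K) c d
  have hproj : IsStarProjection (Θ.block K 1) :=
    ⟨by rw [IsIdempotentElem, block_mul, one_mul], Θ.star_block 1⟩
  refine (CFC.posPart_negPart_unique (b := Θ.block K c)
    (c := algebraMap ℝ (Mat (K * n) A) δ - Θ.block K d) ?_ ?_ ?_ ?_).1
  · rw [hb1]; abel
  · rw [mul_sub, block_mul, mul_comm c d, hdc, Algebra.algebraMap_eq_smul_one, mul_smul_comm, mul_one,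
      ← blockL_apply, ← blockL_apply, map_smul, sub_self]
  · exact Θ.block_nonneg fun k x => le_max_right _ _
  · have h2 : algebraMap ℝ (Mat (K * n) A) δ - Θ.block K d
        = δ • (1 - Θ.block K 1) + Θ.block K (δ • 1 - d) := by
      have : Θ.block K (δ • 1 - d) = δ • Θ.block K 1 - Θ.block K d := by
        rw [← blockL_apply, map_sub, map_smul]; rfl
      rw [this, Algebra.algebraMap_eq_smul_one, smul_sub]
      abel
    rw [h2]
    refine add_nonneg (smul_nonneg hδ (sub_nonneg.2 hproj.le_one)) (Θ.block_nonneg fun k x => ?_)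
    change 0 ≤ δ * 1 - min (h k x) δ
    have := min_le_right (h k x) δ
    linarith

end CornerMap

/-! ### Realising affine functions as ranks -/

namespace AHData

variable {A : Type u} [CStarAlgebra A] [PartialOrder A] [StarOrderedRing A] (D : AHData A)

/-- Positive elements whose rank function approximates a given affine function. -/
theorem exists_rank_approx (hA : IsSimpleCStar A) (hinf : ¬ FiniteDimensional ℂ A) {c : A}
    (hc : IsSelfAdjoint c) (hpos : ∀ τ : tracialStates A, 0 < ((τ : WeakDual ℂ A) c).re) {ε : ℝ}
    (hε : 0 < ε) : ∃ (b : MInftyPos A) (δ : ℝ), 0 < δ ∧ ∀ (σ : QT A) (τ : tracialStates A),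
      (∀ y, (τ : WeakDual ℂ A) (D.limHom y) = σ.one (D.limHom y)) →
        ((τ : WeakDual ℂ A) c).re - ε ≤ dimLim (σ.toFun (b.cutDown δ).size) (b.cutDown δ).mat ∧
        dimLim (σ.toFun (b.cutDown δ).size) (b.cutDown δ).mat ≤ ((τ : WeakDual ℂ A) c).re + ε ∧
        dimLim (σ.toFun b.size) b.mat ≤ ((τ : WeakDual ℂ A) c).re + ε := by
  -- The rounding error, at most the integral of 1, is then at most 1/N ≤ ε/2; the other half of ε
  -- pays for approximating c by a stage element in the upper bounds.
  obtain ⟨N, hN⟩ := exists_nat_gt (2 / ε)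
  have hN0 : (0 : ℝ) < N := lt_trans (by positivity) hN
  have hN1 : (1 : ℝ) ≤ N := by exact_mod_cast Nat.one_le_iff_ne_zero.2 fun h => by simp [h] at hN0
  have hNε : (1 : ℝ) / N ≤ ε / 2 := by
    rw [div_le_div_iff₀ hN0 two_pos]
    rw [div_lt_iff₀ hε] at hN
    linarith
  obtain ⟨m, q, z, hq, hq1, hqz, hzs, hzc, hx⟩ := D.exists_asymptotic hA hinf hc hpos N
    (half_pos hε)
  set M := (D.sys.S m).model with hM
  set Θ := M.cornerMap (D.ψ m) hq with hΘ
  have hΘ1 : Θ.toFun 1 = 1 := by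
    have h1 : q * M.Ψ 1 * q = q := by
      change q * M.unit * q = q
      rw [M.mul_unit, hq.isIdempotentElem.eq]
    rw [hΘ, M.cornerMap_apply, h1, hq1]
  have hΘz : Θ.toFun (M.Φ z) = D.ψ m z := by rw [hΘ, M.cornerMap_Φ, hqz]
  have hΦz : IsSelfAdjoint (M.Φ z) := hzs.map M.Φ
  set F := Θ.tr (M.Φ z) with hF
  have hFx : ∀ x, F x = (M.Φ z x).trace.re := fun x => by
    change ((M.Φ q x * M.Φ z x * M.Φ q x).trace).re = _
    rw [← MF.mul_apply, ← MF.mul_apply, ← map_mul, ← map_mul, hqz]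
  have hF0 : ∀ x, 0 ≤ F x := fun x => by rw [hFx]; exact (hx x).1
  have hr : ∀ x, Θ.invRho x ≤ 1 / N := fun x => by
    rcases Θ.rho_cases x with ⟨-, -, h⟩ | ⟨h1, h2⟩
    · rw [h]; positivity
    · have h3 : (N : ℝ) ≤ Θ.rho x := by
        rcases (hx x).2 with h | h
        · have h4 : Θ.rho x = 0 := by
            change ((M.Φ q x).trace).re = 0
            rw [h, map_zero, Complex.zero_re]
          linarith
        · exact h
      rw [le_div_iff₀ hN0]
      calc Θ.invRho x * N ≤ Θ.invRho x * Θ.rho x :=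
            mul_le_mul_of_nonneg_left h3 (Θ.invRho_nonneg x)
        _ = 1 := h2
  obtain ⟨K, hK⟩ := exists_nat_ge ‖F‖
  have hFK : ∀ x, F x ≤ K := fun x =>
    ((le_abs_self _).trans (F.norm_coe_le_norm x)).trans hK
  -- Layers of the pointwise trace F: their sum is F, and at most F + 1 of them are nonzero at each
  -- point.
  set h : Fin K → C(M.X, ℝ) := fun k =>
    ⟨fun x => min (max (F x - (k : ℕ)) 0) 1, by fun_prop⟩ with hh
  have h0 : ∀ k x, 0 ≤ h k x := fun k x => le_min (le_max_right _ _) zero_le_one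
  have h1 : ∀ k x, h k x ≤ 1 := fun k x => min_le_right _ _
  have hsum : ∑ k, h k = F := by
    ext x
    rw [ContinuousMap.sum_apply]
    exact (sum_clamp (F x) (hF0 x) K).trans (min_eq_left (hFK x))
  have hvan : ∀ (k : Fin K) x, F x ≤ (k : ℕ) → h k x = 0 := fun k x hk => by
    change min (max (F x - (k : ℕ)) 0) 1 = 0
    rw [max_eq_right (by linarith), min_eq_left zero_le_one]
  -- Cutting each of K layers by δ costs at most Kδ times the integral of 1, hence at most ε/2.
  set δ : ℝ := ε / (2 * (K + 1)) with hδ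
  have hδ0 : 0 < δ := by positivity
  have hKδ : K * δ ≤ ε / 2 := by
    rw [hδ, ← mul_div_assoc, div_le_div_iff₀ (by positivity) two_pos]
    nlinarith
  refine ⟨⟨K * M.n, Θ.block K h, Θ.block_nonneg h0⟩, δ, hδ0, fun σ τ hτ => ?_⟩
  -- σ and τ are known to agree only on the images of threads; all values of Θ come from one stage.
  have hτΘ : ∀ f, (τ : WeakDual ℂ A) (Θ.toFun f) = σ.one (Θ.toFun f) := fun f => by
    obtain ⟨y, -, -, hy⟩ := D.exists_thread m (q * M.Ψ f * q)
    have : Θ.toFun f = D.limHom y := by rw [hy]; rfl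
    rw [this, hτ]
  have hFint : Θ.integral τ F = ((τ : WeakDual ℂ A) (D.ψ m z)).re := by
    rw [hF, Θ.integral_tr hτΘ hΦz, hΘz]
  have hclose := tracialStates_abs_re_le τ.2 (a := D.ψ m z - c) ((hzs.map (D.ψ m)).sub hc)
  rw [map_sub, Complex.sub_re] at hclose
  have hclose' := abs_le.1 (hclose.trans hzc.le)
  have hone := Θ.integral_one_le τ hΘ1 hr
  have hone0 := Θ.integral_nonneg τ (g := 1) fun x => zero_le_one
  set h' : Fin K → C(M.X, ℝ) := fun k => (h k - ContinuousMap.const M.X δ) ⊔ 0 with hh'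
  have h0' : ∀ k x, 0 ≤ h' k x := fun k x => le_max_right _ _
  have hle' : ∀ k x, h' k x ≤ h k x := fun k x =>
    max_le (show h k x - δ ≤ h k x by linarith) (h0 k x)
  have hroot : ∀ (g : Fin K → C(M.X, ℝ)), (∀ k x, 0 ≤ g k x) → (∀ k x, g k x ≤ h k x) →
      ∀ s x, ∑ k, CornerMap.root g s k x ≤ (F + 1) x := fun g hg hgh s x => by
    refine sum_le_add_one (hF0 x) _ (fun k => Real.rpow_le_one (hg k x) ((hgh k x).trans (h1 k x))
      (by positivity)) fun k hk => ?_
    rw [CornerMap.root_apply, le_antisymm ((hgh k x).trans (hvan k x hk).le) (hg k x),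
      Real.zero_rpow (by positivity)]
  have key := Θ.dimLim_block hτΘ h0 h1 (hroot h h0 fun _ _ => le_rfl)
  have key' := Θ.dimLim_block hτΘ h0' (fun k x => (hle' k x).trans (h1 k x)) (hroot h' h0' hle')
  rw [map_add, hFint] at key key'
  have hlow : Θ.integral τ (F - ((K : ℝ) * δ) • 1) ≤ Θ.integral τ (∑ k, h' k) := by
    refine Θ.integral_mono τ fun x => ?_
    rw [ContinuousMap.sum_apply]
    have e1 : ∑ k : Fin K, (h k x - δ) ≤ ∑ k, h' k x :=
      Finset.sum_le_sum fun k _ => le_max_left _ _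
    rw [Finset.sum_sub_distrib, ← ContinuousMap.sum_apply, hsum, Finset.sum_const,
      Finset.card_univ, Fintype.card_fin, nsmul_eq_mul] at e1
    simpa using e1
  rw [map_sub, map_smul, hFint, smul_eq_mul] at hlow
  have h3 : (1 : ℝ) / N ≤ 1 := (div_le_one hN0).2 hN1
  have h4 : K * δ * Θ.integral τ 1 ≤ ε / 2 * 1 :=
    mul_le_mul hKδ (by linarith) hone0 (by positivity)
  have e : (MInftyPos.cutDown ⟨K * M.n, Θ.block K h, Θ.block_nonneg h0⟩ δ).mat = Θ.block K h' :=
    Θ.posPart_block_sub h h0 hδ0.le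
  rw [e]
  change _ ≤ dimLim (σ.toFun (K * M.n)) (Θ.block K h') ∧
    dimLim (σ.toFun (K * M.n)) (Θ.block K h') ≤ _ ∧ dimLim (σ.toFun (K * M.n)) (Θ.block K h) ≤ _
  exact ⟨by linarith [hclose'.1, key'.1], by linarith [hclose'.2, key'.2],
    by linarith [hclose'.2, key.2]⟩

end AHData

/-! ### Quasitraces of unit matrices -/

variable {A : Type u} [CStarAlgebra A] [PartialOrder A] [StarOrderedRing A]

/-- Tracial states are quasitraces. -/
def QT.ofTrace (τ : tracialStates A) : QT A where
  toFun n a := traceExt (τ : WeakDual ℂ A) n a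
  isQuasitrace n :=
    { nonneg := (isPosTrace_traceExt τ.2 n).nonneg
      tracial := fun x => (isPosTrace_traceExt τ.2 n).tracial _ _
      add_I_smul := fun a b _ _ => by rw [map_add, map_smul, smul_eq_mul]
      linear := fun _ _ _ x _ y _ c => ⟨map_add _ _ _, map_smul _ _ _⟩ }
  compat n a := traceExt_pad _ (Nat.le_succ n) a
  normalized := by
    rw [traceExt_apply, Fin.sum_univ_one, Mat.entry_one, if_pos rfl]
    exact τ.2.2.1

theorem QT.one_ofTrace (τ : tracialStates A) (a : A) :
    (QT.ofTrace τ).one a = (τ : WeakDual ℂ A) a := by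
  change traceExt (τ : WeakDual ℂ A) 1 _ = _
  rw [traceExt_apply, Fin.sum_univ_one, Mat.entry_of]

/-- The diagonal matrix units commute, and each is equivalent to the 1 × 1 corner, where σ is
normalised. -/
theorem QT.map_one (σ : QT A) (K : ℕ) : σ.toFun K 1 = K := by
  classical
  set e : Fin K → Mat K A := fun i => Mat.of fun k l => if k = i ∧ l = i then 1 else 0 with he
  have hes : ∀ i, IsSelfAdjoint (e i) := fun i => by
    apply Mat.ext; intro k l
    simp only [Mat.entry_star, he, Mat.entry_of, and_comm]
    split_ifs <;> simp
  have hmul : ∀ i j, e i * e j = if i = j then e i else 0 := fun i j => by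
    apply Mat.ext; intro k l
    by_cases hij : i = j
    · subst hij
      by_cases hk : k = i <;> by_cases hl : l = i <;> simp [he, Mat.entry_mul, hk, hl]
    · rw [if_neg hij, Mat.entry_mul]
      refine Finset.sum_eq_zero fun m _ => ?_
      by_cases hm : m = i
      · simp [he, hm, hij]
      · simp [he, hm]
  have hsum : (1 : Mat K A) = ∑ i, e i := by
    apply Mat.ext; intro k l
    have : (∑ i, e i).entry k l = ∑ i, (e i).entry k l := by
      change entryL (A := A) K k l (∑ i, e i) = ∑ i, entryL (A := A) K k l (e i)
      exact map_sum (entryL (A := A) K k l) _ _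
    rw [this, Mat.entry_one]
    simp [he, ite_and, eq_comm]
  have hval : ∀ i, σ.toFun K (e i) = 1 := fun i => by
    set z : Fin K := ⟨0, Fin.pos i⟩ with hz
    set y : Mat K A := Mat.of fun k l => if k = z ∧ l = i then 1 else 0 with hy
    have h1 : star y * y = e i := by
      apply Mat.ext; intro k l
      rw [Mat.entry_mul, Finset.sum_eq_single z]
      · by_cases hk : k = i <;> by_cases hl : l = i <;> simp [hy, he, hk, hl]
      · intro b _ hb
        simp [hy, hb]
      · simp
    have h2 : y * star y = pad K (1 : Mat 1 A) := by
      have hlt : ∀ k : Fin K, (k : ℕ) < 1 ↔ k = z := fun k => by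
        rw [Nat.lt_one_iff, Fin.ext_iff]
      apply Mat.ext; intro k l
      rw [Mat.entry_mul, Finset.sum_eq_single i]
      · by_cases hk : k = z <;> by_cases hl : l = z <;>
          simp [hy, pad, hk, hl, hlt, Mat.entry_one]
      · intro b _ hb
        simp [hy, hb]
      · simp
    rw [← h1, (σ.isQuasitrace K).tracial, h2, σ.toFun_pad (Fin.pos i), σ.normalized]
  rw [hsum, (σ.isQuasitrace K).map_sum _ (fun i _ => hes i) fun i _ j _ => by
    rw [Commute, SemiconjBy, hmul, hmul]
    by_cases hij : i = j
    · rw [hij]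
    · rw [if_neg hij, if_neg (Ne.symm hij)]]
  simp [hval]

theorem QT.dimLim_oneMat (σ : QT A) (K : ℕ) : dimLim (σ.toFun K) (oneMat A K).mat = K := by
  refine Tendsto.limUnder_eq ?_
  have : ∀ k : ℕ, (σ.toFun K ((oneMat A K).mat ^ ((k + 1 : ℝ≥0)⁻¹))).re = K := fun k => by
    have h1 : (1 : Mat K A) ^ ((k + 1 : ℝ≥0)⁻¹) = 1 := by
      rw [CFC.nnrpow_eq_rpow (by positivity), CFC.one_rpow]
    change (σ.toFun K ((1 : Mat K A) ^ ((k + 1 : ℝ≥0)⁻¹))).re = K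
    rw [h1, σ.map_one, Complex.natCast_re]
  exact tendsto_const_nhds.congr fun k => (this k).symm

theorem not_cuntzLE_zero [Nontrivial A] {a : MInftyPos A} (ha : a.mat = 0) :
    ¬ CuntzLE (oneMat A 1) a := by
  intro h
  obtain ⟨N, h1, h2, v, hv⟩ := h 1 one_pos
  have h3 : pad N a.mat = 0 := by rw [ha]; exact map_zero (padHom h2)
  rw [h3, mul_zero, zero_mul, zero_sub, norm_neg, norm_pad h1] at hv
  have : Nontrivial (Mat 1 A) := ⟨0, 1, fun h => by
    have := congrArg (fun x : Mat 1 A => x.entry 0 0) h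
    rw [Mat.entry_zero, Mat.entry_one, if_pos rfl] at this
    exact zero_ne_one this⟩
  change ‖(1 : Mat 1 A)‖ < 1 at hv
  rw [CStarRing.norm_one] at hv
  exact lt_irrefl _ hv

/-! ### Ranks are bounded, positive, lower semicontinuous and affine -/

section RankMap

theorem traceExt_pos (hA : IsSimpleCStar A) (τ : tracialStates A) {n : ℕ} {a : Mat n A}
    (ha : 0 ≤ a) (h0 : a ≠ 0) : 0 < (traceExt (τ : WeakDual ℂ A) n a).re := by
  obtain ⟨x, rfl⟩ := CStarAlgebra.nonneg_iff_eq_star_mul_self.1 ha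
  have h1 := (Complex.le_def.1 ((isPosTrace_traceExt τ.2 n).nonneg x)).1
  refine lt_of_le_of_ne h1 fun h2 => h0 ?_
  have hx : x = 0 := by
    rw [traceExt_apply, Complex.re_sum] at h2
    simp only [Mat.entry_mul, Mat.entry_star, map_sum, Complex.re_sum, Complex.zero_re] at h2
    have hnn : ∀ i k, 0 ≤ ((τ : WeakDual ℂ A) (star (x.entry k i) * x.entry k i)).re := fun i k =>
      (Complex.le_def.1 (τ.2.1 _)).1
    have h3 := (Finset.sum_eq_zero_iff_of_nonneg fun i _ =>
      Finset.sum_nonneg fun k _ => hnn i k).1 h2.symm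
    apply Mat.ext; intro k i
    have h4 := (Finset.sum_eq_zero_iff_of_nonneg fun k _ => hnn i k).1 (h3 i (Finset.mem_univ i)) k
      (Finset.mem_univ k)
    refine tracialStates_faithful hA τ ?_
    rw [tracialStates_eq_re τ.2 (IsSelfAdjoint.star_mul_self _), h4, Complex.ofReal_zero]
  rw [hx, mul_zero]

/-- After division by C^(1/k), the traces of the roots are continuous minorants of the rank
converging to it, which gives lower semicontinuity; affinity passes to the limit; positivity is
faithfulness. -/
theorem dTrace_mem_LAffPos (hA : IsSimpleCStar A) {a : MInftyPos A} (ha : a.mat ≠ 0) :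
    (fun τ => dTrace τ a) ∈ LAffPos A := by
  set C : ℝ≥0 := ‖a.mat‖₊ + 1 with hC
  have hC0 : C ≠ 0 := by positivity
  have haC : ‖a.mat‖ ≤ C := by simp [hC]
  have htr := fun τ : tracialStates A => isPosTrace_traceExt τ.2 a.size
  have hle : ∀ (τ : tracialStates A) (k : ℕ),
      (traceExt (τ : WeakDual ℂ A) a.size (a.mat ^ ((k + 1 : ℝ≥0)⁻¹))).re ≤
        (C ^ (((k + 1 : ℝ≥0)⁻¹ : ℝ≥0) : ℝ) : ℝ≥0) * dTrace τ a := fun τ k =>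
    (htr τ).le_dimLim a.nonneg hC0 haC k
  have hlim : ∀ τ : tracialStates A, Tendsto (fun k : ℕ =>
      (traceExt (τ : WeakDual ℂ A) a.size (a.mat ^ ((k + 1 : ℝ≥0)⁻¹))).re) atTop (𝓝 (dTrace τ a)) :=
    fun τ => (htr τ).tendsto a.nonneg
  have hnn : ∀ τ : tracialStates A, 0 ≤ dTrace τ a := fun τ => (htr τ).dimLim_nonneg a.nonneg
  refine ⟨⟨a.size, fun τ => ?_⟩, fun τ => ?_, ?_, ?_⟩
  · rw [abs_of_nonneg (hnn τ)]
    have h1 : dTrace τ a ≤ dTrace τ (oneMat A a.size) := by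
      refine (htr τ).dimLim_le_of_le_smul (b := (1 : Mat a.size A)) (c := C) a.nonneg zero_le_one ?_
      have := le_algebraMap_of_norm_le (IsSelfAdjoint.of_nonneg a.nonneg) haC
      rwa [Algebra.algebraMap_eq_smul_one] at this
    refine h1.trans (le_of_eq ?_)
    exact (QT.ofTrace τ).dimLim_oneMat a.size
  -- The term of index 0 is the trace of a itself, which is positive and at most C times the rank.
  · have h1 := hle τ 0
    have h2 := traceExt_pos hA τ a.nonneg ha
    have h3 : a.mat ^ (((0 : ℕ) + 1 : ℝ≥0)⁻¹) = a.mat := by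
      simp only [Nat.cast_zero, zero_add, inv_one]
      exact CFC.nnrpow_one _ a.nonneg
    rw [h3] at h1
    refine lt_of_le_of_ne (hnn τ) fun h4 => ?_
    have h5 : 0 = dTrace τ a := h4
    rw [← h5, mul_zero] at h1
    linarith
  · intro τ₀ y hy
    set t : ℕ → ℝ := fun k => ((C ^ (((k + 1 : ℝ≥0)⁻¹ : ℝ≥0) : ℝ) : ℝ≥0) : ℝ) with ht
    have ht0 : ∀ k, 0 < t k := fun k => by
      rw [ht]
      exact_mod_cast NNReal.rpow_pos (pos_iff_ne_zero.2 hC0)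
    have h1 : Tendsto (fun k : ℕ =>
        (traceExt (τ₀ : WeakDual ℂ A) a.size (a.mat ^ ((k + 1 : ℝ≥0)⁻¹))).re / t k) atTop
        (𝓝 (dTrace τ₀ a)) := by
      have := (hlim τ₀).div (tendsto_rpow_inv_succ hC0) one_ne_zero
      rwa [div_one] at this
    obtain ⟨k, hk⟩ := (h1.eventually (lt_mem_nhds hy)).exists
    have hc : Continuous fun τ : tracialStates A =>
        (traceExt (τ : WeakDual ℂ A) a.size (a.mat ^ ((k + 1 : ℝ≥0)⁻¹))).re / t k := by
      refine Continuous.div_const ?_ _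
      simp only [traceExt_apply, Complex.re_sum]
      exact continuous_finset_sum _ fun i _ => continuous_tracialStates_re _
    filter_upwards [hc.continuousAt.eventually (lt_mem_nhds hk)] with τ hτ
    refine hτ.trans_le ?_
    rw [div_le_iff₀ (ht0 k), mul_comm]
    exact hle τ k
  · intro τ₁ τ₂ τ s t _ _ _ h
    refine tendsto_nhds_unique (hlim τ) ((((hlim τ₁).const_mul s).add
      ((hlim τ₂).const_mul t)).congr fun k => ?_)
    have e : ∀ x : A, (τ : WeakDual ℂ A) x
        = (s : ℂ) * (τ₁ : WeakDual ℂ A) x + (t : ℂ) * (τ₂ : WeakDual ℂ A) x := fun x => by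
      rw [h]; rfl
    simp only [traceExt_apply, e, Finset.sum_add_distrib, ← Finset.mul_sum, Complex.add_re,
      Complex.re_ofReal_mul]

theorem IsPurelyPositive.mat_ne_zero {a : MInftyPos A} (ha : IsPurelyPositive a) : a.mat ≠ 0 :=
  fun h => ha a (by rw [h]; exact .zero _) ⟨.refl a, .refl a⟩

end RankMap

/-- The supremum of approximants squeezed between consecutive c_n: cut-downs at stage n + 1 push the
rank above c_n, while the partial sums keep it at most f. -/
theorem exists_rank_eq [TopologicalSpace.SeparableSpace A] (hA : IsSimpleCStar A)
    (hinf : ¬ FiniteDimensional ℂ A) (D : AHData A) (hsr : StableRankOne A)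
    (hcomp : StrictComparison A) {f : tracialStates A → ℝ} (hf : f ∈ LAffPos A) :
    ∃ a : MInftyPos A, IsPurelyPositive a ∧ ∀ τ, dTrace τ a = f τ := by
  have hQT : ∀ σ : QT A, ∃ τ : tracialStates A,
      ∀ y, (τ : WeakDual ℂ A) (D.limHom y) = σ.one (D.limHom y) := fun σ =>
    D.exists_tracialState_of_quasitrace σ.isQuasitrace_one σ.one_one
  have hne : Nonempty (tracialStates A) := by
    by_contra hempty
    have := hA.1
    -- Without tracial states there are no quasitraces, so strict comparison would hold vacuously
    -- and give 1 ≾ 0.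
    refine not_cuntzLE_zero (a := ⟨0, 0, le_rfl⟩) rfl (hcomp (oneMat A 1) _ ?_)
    rintro _ ⟨σ, rfl⟩
    exact absurd ⟨(hQT σ).choose⟩ hempty
  obtain ⟨c, hcs, hc0, hclt, hcf, hcsup⟩ := exists_increasing_selfAdjoint hf
  have hcpos : ∀ n (τ : tracialStates A), 0 < ((τ : WeakDual ℂ A) (c n)).re := fun n τ => by
    induction n with
    | zero => exact hc0 τ
    | succ n ih => exact ih.trans (hclt n τ)
  have hgap : ∀ n, ∃ g > 0, ∀ τ : tracialStates A,
      ((τ : WeakDual ℂ A) (c n)).re + g ≤ ((τ : WeakDual ℂ A) (c (n + 1))).re := fun n => by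
    obtain ⟨τ₀, -, hτ₀⟩ := isCompact_univ.exists_isMinOn Set.univ_nonempty
      ((continuous_tracialStates_re (c (n + 1))).sub (continuous_tracialStates_re (c n))).continuousOn
    refine ⟨_, sub_pos.2 (hclt n τ₀), fun τ => ?_⟩
    have := hτ₀ (Set.mem_univ τ)
    change ((τ₀ : WeakDual ℂ A) (c (n + 1))).re - ((τ₀ : WeakDual ℂ A) (c n)).re ≤
      ((τ : WeakDual ℂ A) (c (n + 1))).re - ((τ : WeakDual ℂ A) (c n)).re at this
    linarith
  choose g hg hgc using hgap
  -- ε n must fit into the gaps on both sides of c n, and thirds leave room for ε n + ε (n + 1) < g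
  -- n. At n = 0 truncated subtraction just repeats g 0.
  set ε : ℕ → ℝ := fun n => min (g n) (g (n - 1)) / 3 with hε
  have hε0 : ∀ n, 0 < ε n := fun n => by
    have := lt_min (hg n) (hg (n - 1))
    simp only [hε]; positivity
  have hε1 : ∀ n, ε n ≤ g n / 3 := fun n => by
    simp only [hε]; gcongr; exact min_le_left _ _
  have hε2 : ∀ n, ε (n + 1) ≤ g n / 3 := fun n => by
    simp only [hε, Nat.add_sub_cancel]; gcongr; exact min_le_right _ _
  choose b δ hδ hb using fun n => D.exists_rank_approx hA hinf (hcs n) (hcpos n) (hε0 n)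
  have hstep : ∀ n (τ : tracialStates A), ((τ : WeakDual ℂ A) (c n)).re + ε n <
      ((τ : WeakDual ℂ A) (c (n + 1))).re - ε (n + 1) := fun n τ => by
    linarith [hgc n τ, hε1 n, hε2 n, hg n]
  have hup : ∀ n (τ : tracialStates A), ((τ : WeakDual ℂ A) (c n)).re + ε n < f τ := fun n τ => by
    linarith [hstep n τ, hcf (n + 1) τ, hε0 (n + 1)]
  obtain ⟨⟨C, hC⟩, -⟩ := id hf
  obtain ⟨K, hK⟩ := exists_nat_gt C
  -- Comparison is tested on a quasitrace σ through the tracial state that agrees with it on the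
  -- images of threads; K exceeds a bound for f, so 1_K dominates all the b_n.
  obtain ⟨a, ha, s, hs, hsa, hsup⟩ := exists_sup hsr K b δ hδ
    (fun n => hcomp _ _ (by
      rintro _ ⟨σ, rfl⟩
      obtain ⟨τ, hτ⟩ := hQT σ
      exact ((hb n σ τ hτ).2.2.trans_lt (hstep n τ)).trans_le (hb (n + 1) σ τ hτ).1))
    (fun n => hcomp _ _ (by
      rintro _ ⟨σ, rfl⟩
      obtain ⟨τ, hτ⟩ := hQT σ
      refine ((hb n σ τ hτ).2.2.trans_lt (hup n τ)).trans_le ?_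
      change f τ ≤ dimLim (σ.toFun K) (oneMat A K).mat
      rw [σ.dimLim_oneMat]
      exact ((le_abs_self _).trans (hC τ)).trans hK.le))
  have hbτ : ∀ n (τ : tracialStates A), ((τ : WeakDual ℂ A) (c n)).re - ε n ≤
      dTrace τ ((b n).cutDown (δ n)) ∧
      dTrace τ ((b n).cutDown (δ n)) ≤ ((τ : WeakDual ℂ A) (c n)).re + ε n := fun n τ =>
    ⟨(hb n (QT.ofTrace τ) τ fun y => (QT.one_ofTrace τ _).symm).1,
      (hb n (QT.ofTrace τ) τ fun y => (QT.one_ofTrace τ _).symm).2.1⟩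
  have hlt : ∀ m (τ : tracialStates A), dTrace τ ⟨K, s m, hs m⟩ < f τ := fun m τ =>
    (((hsup τ).2 m).trans (hbτ m τ).2).trans_lt (hup m τ)
  have hrank : ∀ τ : tracialStates A, dTrace τ ⟨K, a, ha⟩ = f τ := fun τ => by
    refine le_antisymm ?_ (le_of_forall_lt fun r hr => ?_)
    · exact (isPosTrace_traceExt τ.2 K).dimLim_le_of_tendsto hs ha hsa fun m => (hlt m τ).le
    · obtain ⟨n, hn⟩ := hcsup τ r hr
      linarith [hstep n τ, hε0 n, (hbτ (n + 1) τ).1, (hsup τ).1 (n + 1)]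
  obtain ⟨τ₀⟩ := hne
  exact ⟨⟨K, a, ha⟩, isPurelyPositive_of_tendsto τ₀ ha hs hsa fun m => by
    rw [hrank τ₀]; exact hlt m τ₀, hrank⟩

end

end CStarCuntz

theorem mainTheorem5 {A : Type*} [CStarAlgebra A] [PartialOrder A] [StarOrderedRing A]
    [TopologicalSpace.SeparableSpace A]
    (hsimple : IsSimpleCStar A) (hinf : ¬ FiniteDimensional ℂ A) (hAH : IsAH A)
    (hsr : StableRankOne A) (hcomp : StrictComparison A) :
    Set.MapsTo (rankMap A) (WPos A) (LAffPos A) ∧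
      Set.SurjOn (rankMap A) (WPos A) (LAffPos A) := by
  obtain ⟨D⟩ := hAH.nonempty_AHData
  refine ⟨?_, fun f hf => ?_⟩
  · rintro _ ⟨a, ha, rfl⟩
    exact dTrace_mem_LAffPos hsimple ha.mat_ne_zero
  · obtain ⟨a, ha, h⟩ := exists_rank_eq hsimple hinf D hsr hcomp hf
    exact ⟨W.mk a, ⟨a, ha, rfl⟩, funext h⟩
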